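/- Let $T>0$, let $\mathcal D$ be the space of càdlàg paths $[0,T]\to[0,1]$ with the Borel $\sigma$-algebra of the Skorokhod topology (generated by the evaluations), and for probability measures $\mu,\nu$ on $\mathcal D$ let $$d_{\mathcal W}^{sup}(\mu,\nu)=\inf_{X\sim\mu,\,Y\sim\nu}\mathbb E\,\|X-Y\|_{sup},\qquad I(\mu)=\mathbb E_{\gamma\sim\mu}\,\sup_{0=t_0<\dots<t_k=T}\ \frac12\sum_{i=1}^k\frac{|\gamma(t_i)-\gamma(t_{i-1})|^2}{t_i-t_{i-1}}\in[0,\infty],$$ where the infimum is over all couplings. **The process.** Let $\pi$ be the law of a permuton process (continuous paths, uniform marginals on $[0,1]$) which is a generalized solution to the Euler equations: for some $p:[0,T]\times[0,1]\to\mathbb R$, differentiable in $x$, almost every path satisfies $x'(t)=v(t)$, $v'(t)=-\partial_xp(t,x(t))$ on $[0,T]$. For each $t\in[0,T]$ let the law $\mu_t$ of $(x(t),x'(t))$ have a density $\rho_t(x,v)$ on $[0,1]\times\mathbb R$, normalised so that $\mu_{t,x}=\rho_t(x,v)\,dv$ is a probability measure for every $x\in(0,1)$ (the conditional law of $v$ given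 $x$), and put $\mu_{t,0}=\mu_{t,1}=\delta_0$. Assume: (1) $p$ is measurable in $t$, and $\partial_xp(t,\cdot)$ is Lipschitz with a constant independent of $t$; (2) all $\rho_t$ are supported in one compact set $K\subseteq[0,1]\times\mathbb R$; (3) the support of every $\mu_{t,x}$ is an interval; (4) $\rho$ is continuously differentiable in $(t,x,v)$ for $t\in[0,T]$ and $(x,v)$ in the interior of the support of $\rho_t$. With $F_{t,x}$ the distribution function of $\mu_{t,x}$, let $V_t(x,\phi)=\inf\{v: F_{t,x}(v)\ge\phi\}$ for $\phi\in(0,1]$ and $V_t(x,0)=\inf\{v:F_{t,x}(v)>0\}$. **The approximation.** For $\beta\in(0,\frac14)$ let $V^\beta_t(x,\phi)$ be functions such that (a) $V^\beta$ is continuously differentiable on $[0,T]\times[0,1]^2$; (b) $V^\beta_t(x,\phi)=V_t(x,\phi)$ for $x\in[\beta,1-\beta]$ and $V^\beta_t(0,\phi)=V^\beta_t(1,\phi)=0$; (c) $\int_0^1V^\beta_t(x,\psi)\,d\psi=0$; (d) $|V^\beta_t|\le|V_t|+1$; (e) $\int_0^1\!\int_0^1|V^\beta_t|^2dx\,d\phi\to\int_0^1\!\int_0^1|V_t|^2dx\,d\phi$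 as $\beta\to0$, for each $t\in[0,T]$. For $\delta>0$ put $V^{\beta,\delta}(t,x,\phi)=V^\beta_{k\delta}(x,\phi)$ for $t\in[k\delta,(k+1)\delta)\cap[0,T]$, and $R^{\beta,\delta}(t,x,\phi)=-\int_0^\phi\partial_xV^{\beta,\delta}(t,x,\psi)\,d\psi$; define $R^\beta$ from $V^\beta$ in the same way. Let $\pi^{\beta,\delta}$ be the law of $(X^{\beta,\delta}_t)_{0\le t\le T}$, where $(X^{\beta,\delta},\Phi^{\beta,\delta})$ starts from a uniform point of $[0,1]^2$ and follows a solution in $[0,1]^2$ of $$x'=V^{\beta,\delta}(t,x,\phi),\qquad \phi'=R^{\beta,\delta}(t,x,\phi)$$ (right-hand derivatives at the times $k\delta$). If the solution through an initial point is not unique, any choice that depends measurably on the initial point is allowed. **Claim.** As first $\delta\to0$ and then $\beta\to0$, $$d_{\mathcal W}^{sup}(\pi,\pi^{\beta,\delta})\to0\quad\text{and}\quad I(\pi^{\beta,\delta})\to I(\pi),$$ that is, for every neighbourhood of the limit, for all sufficiently small $\beta>0$ and then all sufficiently small $\delta>0$ (depending on $\beta$) the quantity lies in that neighbourhood. If moreover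 for every $\beta\in(0,\frac14)$ the system $x'=V^\beta_t(x,\phi)$, $\phi'=R^\beta_t(x,\phi)$ has at most one solution in $[0,1]^2$ for each initial point, then for every such $\beta$ the inner limits as $\delta\to0$ exist in $[0,\infty]$, and $$\lim_{\beta\to0}\lim_{\delta\to0}d_{\mathcal W}^{sup}(\pi,\pi^{\beta,\delta})=0,\qquad \lim_{\beta\to0}\lim_{\delta\to0}I(\pi^{\beta,\delta})=I(\pi).$$ -/

import Mathlib

open Set Filter Topology MeasureTheory
open scoped ENNReal

namespace PermutonEuler

/-- The path space of càdlàg functions from `[0,T]` to `[0,1]`. As a subtype of a product it carries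
the σ-algebra generated by the evaluations, which is the Borel σ-algebra of the Skorokhod
topology. -/
abbrev CadlagPath (T : ℝ) : Type :=
  {γ : Icc (0 : ℝ) T → unitInterval //
    ∀ t, ContinuousWithinAt γ (Ici t) t ∧ ∃ l, Tendsto γ (𝓝[<] t) (𝓝 l)}

/-- A path as a real function of a real variable; the values outside `[0,T]` are never used. -/
noncomputable def CadlagPath.toReal {T : ℝ} (γ : CadlagPath T) (t : ℝ) : ℝ :=
  open Classical in if h : t ∈ Icc (0 : ℝ) T then (γ.1 ⟨t, h⟩ : ℝ) else 0

/-- The supremum distance of two paths. -/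
noncomputable def supDist {T : ℝ} (γ η : CadlagPath T) : ℝ≥0∞ :=
  ⨆ t, edist (γ.1 t) (η.1 t)

/-- The Wasserstein distance associated with the supremum norm: the infimum of the expected supremum
distance over all couplings. -/
noncomputable def wassersteinSup {T : ℝ} (μ ν : Measure (CadlagPath T)) : ℝ≥0∞ :=
  ⨅ (c : Measure (CadlagPath T × CadlagPath T)) (_ : c.map Prod.fst = μ) (_ : c.map Prod.snd = ν),
    ∫⁻ q, supDist q.1 q.2 ∂c

/-- The energy of a path with respect to the partition `t 0 < t 1 < ... < t k`. -/
noncomputable def partitionEnergy {T : ℝ} (γ : CadlagPath T) (k : ℕ) (t : Fin (k + 1) → ℝ) : ℝ :=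
  (1 / 2) * ∑ i : Fin k,
    |γ.toReal (t i.succ) - γ.toReal (t i.castSucc)| ^ 2 / (t i.succ - t i.castSucc)

/-- The energy of a path: the supremum over all finite partitions of `[0,T]`. -/
noncomputable def pathEnergy {T : ℝ} (γ : CadlagPath T) : ℝ≥0∞ :=
  ⨆ (k : ℕ) (t : Fin (k + 1) → ℝ) (_ : StrictMono t) (_ : t 0 = 0) (_ : t (Fin.last k) = T),
    ENNReal.ofReal (partitionEnergy γ k t)

/-- The energy of a process (given by its law): the expected energy of a path. -/
noncomputable def energy {T : ℝ} (π : Measure (CadlagPath T)) : ℝ≥0∞ :=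
  ∫⁻ γ, pathEnergy γ ∂π

/-- `π` is the law of a permuton process: continuous paths and uniform marginals. -/
structure IsPermutonProcess {T : ℝ} (π : Measure (CadlagPath T)) : Prop where
  isProbability : IsProbabilityMeasure π
  continuous_paths : ∀ᵐ γ ∂π, Continuous γ.1
  uniform_marginals : ∀ t, π.map (fun γ => γ.1 t) = (volume : Measure unitInterval)

/-- The derivative in `x ∈ [0,1]` of the pressure `p t x`. -/
noncomputable def pressureGradient (p : ℝ → ℝ → ℝ) (t x : ℝ) : ℝ :=
  derivWithin (p t) (Icc 0 1) x

/-- `π` is a generalized solution to the Euler equations with pressure `p`: it is a permuton process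
and almost every path satisfies `x' = v`, `v' = -∂ₓ p(t, x)` on `[0,T]`. -/
structure IsGeneralizedEulerSolution {T : ℝ} (π : Measure (CadlagPath T)) (p : ℝ → ℝ → ℝ) :
    Prop where
  isPermutonProcess : IsPermutonProcess π
  differentiable_pressure : ∀ t ∈ Icc 0 T, DifferentiableOn ℝ (p t) (Icc 0 1)
  equation : ∀ᵐ γ ∂π, ∃ v : ℝ → ℝ, ∀ t ∈ Icc 0 T,
    HasDerivWithinAt γ.toReal (v t) (Icc 0 T) t ∧
    HasDerivWithinAt v (-pressureGradient p t (γ.toReal t)) (Icc 0 T) t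

/-- The joint law `μ_t` of position and velocity `(x(t), x'(t))` under `π`. -/
noncomputable def phaseLaw {T : ℝ} (π : Measure (CadlagPath T)) (t : ℝ) : Measure (ℝ × ℝ) :=
  π.map (fun γ => (γ.toReal t, derivWithin γ.toReal (Icc 0 T) t))

/-- The conditional law `μ_{t,x}` of the velocity at time `t` given the position `x ∈ [0,1]`, where
`ρ t` is the density of `μ_t`. As the position is uniform, the conditional density at an interior
point is `ρ t x`; at the endpoints the conditional law is by convention the unit mass at `0`. -/
noncomputable def velocityLaw (ρ : ℝ → ℝ → ℝ → ℝ) (t x : ℝ) : Measure ℝ :=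
  open Classical in
  if x = 0 ∨ x = 1 then Measure.dirac 0
  else (volume : Measure ℝ).withDensity (fun v => ENNReal.ofReal (ρ t x v))

/-- The distribution function `F_{t,x}` of the conditional law of the velocity. -/
noncomputable def velocityCDF (ρ : ℝ → ℝ → ℝ → ℝ) (t x v : ℝ) : ℝ :=
  (velocityLaw ρ t x).real (Iic v)

/-- The quantile function `V_t(x, φ)` of the conditional law of the velocity. -/
noncomputable def quantileVelocity (ρ : ℝ → ℝ → ℝ → ℝ) (t x φ : ℝ) : ℝ :=
  open Classical in
  if φ = 0 then sInf {v | 0 < velocityCDF ρ t x v} else sInf {v | φ ≤ velocityCDF ρ t x v}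

/-- `ρ t` is, for each time `t ∈ [0,T]`, a density of the law `μ_t` of position and velocity,
normalised so that `ρ t x` is the conditional density of the velocity at every `x ∈ (0,1)`. -/
structure IsPhaseDensity {T : ℝ} (π : Measure (CadlagPath T)) (ρ : ℝ → ℝ → ℝ → ℝ) : Prop where
  nonneg : ∀ t ∈ Icc 0 T, ∀ x v, 0 ≤ ρ t x v
  measurable : ∀ t ∈ Icc 0 T, Measurable (fun z : ℝ × ℝ => ρ t z.1 z.2)
  density : ∀ t ∈ Icc 0 T, phaseLaw π t =
    (volume.restrict (Icc (0 : ℝ) 1 ×ˢ (univ : Set ℝ))).withDensity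
      (fun z => ENNReal.ofReal (ρ t z.1 z.2))
  normalised : ∀ t ∈ Icc 0 T, ∀ x ∈ Ioo (0 : ℝ) 1, ∫⁻ v, ENNReal.ofReal (ρ t x v) = 1

/-- The regularity assumptions on a generalized solution with pressure `p` and densities `ρ`. -/
structure RegularityAssumptions (T : ℝ) (p : ℝ → ℝ → ℝ) (ρ : ℝ → ℝ → ℝ → ℝ) : Prop where
  pressure_measurable : ∀ x ∈ Icc (0 : ℝ) 1, Measurable (fun t : Icc (0 : ℝ) T => p t x)
  pressure_lipschitz : ∃ L : NNReal, ∀ t ∈ Icc 0 T,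
    LipschitzOnWith L (pressureGradient p t) (Icc 0 1)
  compact_support : ∃ K : Set (ℝ × ℝ), IsCompact K ∧ K ⊆ Icc 0 1 ×ˢ univ ∧
    ∀ t ∈ Icc 0 T, Function.support (fun z : ℝ × ℝ => ρ t z.1 z.2) ⊆ K
  connected_support : ∀ t ∈ Icc 0 T, ∀ x ∈ Icc (0 : ℝ) 1,
    IsConnected (velocityLaw ρ t x).support
  smooth_density : ContDiffOn ℝ 1 (fun q : ℝ × ℝ × ℝ => ρ q.1 q.2.1 q.2.2)
    {q | q.1 ∈ Icc 0 T ∧ q.2 ∈ interior (tsupport (fun z : ℝ × ℝ => ρ q.1 z.1 z.2))}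

/-- `W β`, for `β ∈ (0, 1/4)`, is a family of boundary smoothings `V^β` of the velocity field
`V`. -/
structure IsBoundarySmoothing (T : ℝ) (V : ℝ → ℝ → ℝ → ℝ) (W : ℝ → ℝ → ℝ → ℝ → ℝ) : Prop where
  smooth : ∀ β ∈ Ioo (0 : ℝ) (1 / 4), ContDiffOn ℝ 1 (fun q : ℝ × ℝ × ℝ => W β q.1 q.2.1 q.2.2)
    (Icc 0 T ×ˢ Icc 0 1 ×ˢ Icc 0 1)
  eq_inside : ∀ β ∈ Ioo (0 : ℝ) (1 / 4), ∀ t ∈ Icc 0 T, ∀ x ∈ Icc β (1 - β),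
    ∀ φ ∈ Icc (0 : ℝ) 1, W β t x φ = V t x φ
  eq_zero_left : ∀ β ∈ Ioo (0 : ℝ) (1 / 4), ∀ t ∈ Icc 0 T, ∀ φ ∈ Icc (0 : ℝ) 1, W β t 0 φ = 0
  eq_zero_right : ∀ β ∈ Ioo (0 : ℝ) (1 / 4), ∀ t ∈ Icc 0 T, ∀ φ ∈ Icc (0 : ℝ) 1, W β t 1 φ = 0
  mean_zero : ∀ β ∈ Ioo (0 : ℝ) (1 / 4), ∀ t ∈ Icc 0 T, ∀ x ∈ Icc (0 : ℝ) 1,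
    ∫ ψ in (0 : ℝ)..1, W β t x ψ = 0
  bound : ∀ β ∈ Ioo (0 : ℝ) (1 / 4), ∀ t ∈ Icc 0 T, ∀ x ∈ Icc (0 : ℝ) 1, ∀ φ ∈ Icc (0 : ℝ) 1,
    |W β t x φ| ≤ |V t x φ| + 1
  energy_limit : ∀ t ∈ Icc 0 T,
    Tendsto (fun β => ∫ φ in (0 : ℝ)..1, ∫ x in (0 : ℝ)..1, |W β t x φ| ^ 2) (𝓝[>] 0)
      (𝓝 (∫ φ in (0 : ℝ)..1, ∫ x in (0 : ℝ)..1, |V t x φ| ^ 2))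

/-- The approximation of a velocity field that is constant in time on every interval
`[kδ, (k+1)δ)`. -/
noncomputable def freezeTime (δ : ℝ) (W : ℝ → ℝ → ℝ → ℝ) (t x φ : ℝ) : ℝ :=
  W ((⌊t / δ⌋₊ : ℝ) * δ) x φ

/-- The velocity of the color, `R(t,x,φ) = -∫₀^φ ∂ₓ W(t,x,ψ) dψ`. -/
noncomputable def colorVelocity (W : ℝ → ℝ → ℝ → ℝ) (t x φ : ℝ) : ℝ :=
  -∫ ψ in (0 : ℝ)..φ, derivWithin (fun y => W t y ψ) (Icc 0 1) x

/-- `(x, φ)` is a solution in `[0,1]²` of `x' = W(t,x,φ)`, `φ' = R(t,x,φ)` on `[0,T]`. The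
derivatives are right-handed, so that `W` may jump in time; where the right-hand side is continuous
in time, this is the ordinary equation. -/
structure IsColorSolution (T : ℝ) (W : ℝ → ℝ → ℝ → ℝ) (x φ : ℝ → ℝ) : Prop where
  mem_left : ∀ t ∈ Icc 0 T, x t ∈ Icc (0 : ℝ) 1
  mem_right : ∀ t ∈ Icc 0 T, φ t ∈ Icc (0 : ℝ) 1
  continuous_left : ContinuousOn x (Icc 0 T)
  continuous_right : ContinuousOn φ (Icc 0 T)
  deriv_left : ∀ t ∈ Ico 0 T, HasDerivWithinAt x (W t (x t) (φ t)) (Ici t) t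
  deriv_right : ∀ t ∈ Ico 0 T, HasDerivWithinAt φ (colorVelocity W t (x t) (φ t)) (Ici t) t

/-- For every initial condition in `[0,1]²` there is at most one solution. -/
def HasUniqueColorSolutions (T : ℝ) (W : ℝ → ℝ → ℝ → ℝ) : Prop :=
  ∀ x φ y ψ : ℝ → ℝ, IsColorSolution T W x φ → IsColorSolution T W y ψ →
    x 0 = y 0 → φ 0 = ψ 0 → EqOn x y (Icc 0 T) ∧ EqOn φ ψ (Icc 0 T)

/-- `ν` is the law of the position component of the colored trajectory process of `W`: the initial
point `z` is uniform on `[0,1]²` and the process follows the solution started at `z`. -/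
def IsColoredTrajectoryLaw {T : ℝ} (W : ℝ → ℝ → ℝ → ℝ) (ν : Measure (CadlagPath T)) : Prop :=
  ∃ X Φ : unitInterval × unitInterval → CadlagPath T, Measurable X ∧ Measurable Φ ∧
    (∀ z, (X z).toReal 0 = z.1 ∧ (Φ z).toReal 0 = z.2 ∧
      IsColorSolution T W (X z).toReal (Φ z).toReal) ∧
    ν = (volume : Measure (unitInterval × unitInterval)).map X

end PermutonEuler

open PermutonEuler

/-! A path `γ` of `π` determines its initial position `x` and velocity `v`, hence the initial color
`F_{0,x}(v)`. The pair of position and color is uniform on the unit square, because the conditional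
laws of the velocity have no atoms (`exists_initial_color`). Starting the approximating flow at this
pair therefore couples `π` with `πapp β δ`, and it remains to compare a Newton path with the flow
line that has the same initial data.

The comparison rests on the Euler equation `∂_t u + u ∂_x u + R ∂_φ u = -∂_x p` for the field `u =
V^β` and `β < x < 1 - β` (`eulerDefect_eq_zero`). The expectation of `a(x) b(v)` is differentiated
in time twice, once along the Newton paths and once through the representation `v = u(t,x,φ)`. The
field `(u, R)` is divergence free and tangent to `φ = 0` and `φ = 1`, so an integration by parts
turns the difference into `∫ a(x) b'(u) D = 0`, where `D` is the defect. Localising in `x` gives `∫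
g(u) D dφ = 0` for all bounded continuous `g`. As `u` is injective in `φ`, some `g` satisfies `g(u)
= D`, so `D` vanishes.

Consequently position and velocity along a flow line solve Newton's equation up to the error of
freezing time, as long as the flow line stays in `(β, 1 - β)`. A Grönwall argument
(`exists_forall_flowLine_close`) keeps it close, together with its velocity, to every path that
stays in `[2β, 1 - 2β]`. Uniform closeness of velocities yields closeness of energies
(`pathEnergy_le_add`).

The other paths have small probability because almost no path touches the boundary
(`ae_forall_mem_Ioo`). A path that touches it at an interior time is at rest there, so its final
position and velocity are a Lipschitz function of the time of contact. Such endpoints form a set of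
dimension at most one, which is null for the law at time `T` because that law has a density. All
velocities are bounded, so the exceptional paths contribute little to distance and energy.

If the unfrozen system has unique solutions, compactness forces the frozen flow lines to converge to
them as `δ → 0`. The inner limits then exist (`exists_limit_law`), and regularity of the topology
turns the neighbourhood statements into iterated limits. -/

namespace PermutonEuler

/-! ### Càdlàg paths: reduction to countable grids and measurability. -/

variable {T : ℝ}

lemma CadlagPath.toReal_of_mem (γ : CadlagPath T) {t : ℝ} (h : t ∈ Icc (0 : ℝ) T) :
    γ.toReal t = γ.1 ⟨t, h⟩ := by
  simp only [CadlagPath.toReal, dif_pos h]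

lemma CadlagPath.toReal_coe (γ : CadlagPath T) (t : Icc (0 : ℝ) T) : γ.toReal t = γ.1 t :=
  γ.toReal_of_mem t.2

lemma CadlagPath.toReal_mem (γ : CadlagPath T) (t : ℝ) : γ.toReal t ∈ Icc (0 : ℝ) 1 := by
  by_cases h : t ∈ Icc (0 : ℝ) T
  · rw [γ.toReal_of_mem h]; exact (γ.1 _).2
  · simp [CadlagPath.toReal, h]

lemma CadlagPath.measurable_eval (t : Icc (0 : ℝ) T) :
    Measurable (fun γ : CadlagPath T => γ.1 t) :=
  (measurable_pi_apply t).comp measurable_subtype_coe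

lemma CadlagPath.measurable_toReal (t : ℝ) :
    Measurable (fun γ : CadlagPath T => γ.toReal t) := by
  by_cases h : t ∈ Icc (0 : ℝ) T
  · simp only [CadlagPath.toReal, dif_pos h]
    exact measurable_subtype_coe.comp (CadlagPath.measurable_eval _)
  · simp only [CadlagPath.toReal, dif_neg h]
    exact measurable_const

/-- The smallest multiple of `T / (n + 1)` that is at least `t`. -/
noncomputable def gridAbove (T : ℝ) (n : ℕ) (t : ℝ) : ℝ := ⌈t * (n + 1) / T⌉₊ * T / (n + 1)

lemma gridAbove_zero (T : ℝ) (n : ℕ) : gridAbove T n 0 = 0 := by simp [gridAbove]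

lemma gridAbove_self (hT : 0 < T) (n : ℕ) : gridAbove T n T = T := by
  have : T * (n + 1) / T = ((n + 1 : ℕ) : ℝ) := by push_cast; field_simp
  rw [gridAbove, this, Nat.ceil_natCast]
  push_cast; field_simp

lemma le_gridAbove (hT : 0 < T) (n : ℕ) (t : ℝ) : t ≤ gridAbove T n t := by
  have h := Nat.le_ceil (t * (n + 1) / T)
  rw [gridAbove, le_div_iff₀ (by positivity)]
  rwa [div_le_iff₀ hT] at h

lemma gridAbove_lt (hT : 0 < T) (n : ℕ) {t : ℝ} (ht : 0 ≤ t) :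
    gridAbove T n t < t + T * (1 / ((n : ℝ) + 1)) := by
  have h := Nat.ceil_lt_add_one (a := t * (n + 1) / T) (by positivity)
  have hn : (0 : ℝ) < n + 1 := by positivity
  rw [gridAbove]
  have h2 : t + T * (1 / ((n : ℝ) + 1)) = (t * (n + 1) / T + 1) * T / (n + 1) := by field_simp
  rw [h2]
  gcongr

lemma gridAbove_mem (hT : 0 < T) (n : ℕ) {t : ℝ} (ht : t ∈ Icc 0 T) :
    gridAbove T n t ∈ Icc 0 T := by
  refine ⟨ht.1.trans (le_gridAbove hT n t), ?_⟩
  calc gridAbove T n t ≤ gridAbove T n T := by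
        unfold gridAbove
        gcongr
        exact ht.2
    _ = T := gridAbove_self hT n

lemma tendsto_gridAbove (hT : 0 < T) {t : ℝ} (ht : 0 ≤ t) :
    Tendsto (fun n => gridAbove T n t) atTop (𝓝 t) := by
  have h : Tendsto (fun n : ℕ => t + T * (1 / ((n : ℝ) + 1))) atTop (𝓝 (t + T * 0)) :=
    (tendsto_one_div_add_atTop_nhds_zero_nat.const_mul T).const_add t
  rw [mul_zero, add_zero] at h
  exact tendsto_of_tendsto_of_tendsto_of_le_of_le tendsto_const_nhds h
    (fun n => le_gridAbove hT n t) (fun n => (gridAbove_lt hT n ht).le)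

lemma CadlagPath.tendsto_gridAbove (hT : 0 < T) (γ : CadlagPath T) (t : Icc (0 : ℝ) T) :
    Tendsto (fun n => γ.1 ⟨gridAbove T n t, gridAbove_mem hT n t.2⟩) atTop (𝓝 (γ.1 t)) := by
  refine (γ.2 t).1.tendsto.comp (tendsto_nhdsWithin_iff.2 ⟨?_, ?_⟩)
  · exact tendsto_subtype_rng.2 (PermutonEuler.tendsto_gridAbove hT t.2.1)
  · exact Eventually.of_forall fun n => le_gridAbove hT n t

lemma CadlagPath.tendsto_toReal_gridAbove (hT : 0 < T) (γ : CadlagPath T) {t : ℝ}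
    (ht : t ∈ Icc 0 T) :
    Tendsto (fun n => γ.toReal (gridAbove T n t)) atTop (𝓝 (γ.toReal t)) := by
  have h := (continuous_subtype_val.tendsto _).comp (γ.tendsto_gridAbove hT ⟨t, ht⟩)
  rw [γ.toReal_of_mem ht]
  refine h.congr fun n => ?_
  rw [γ.toReal_of_mem (gridAbove_mem hT n ht)]; rfl

/-- The grid point `m T / (n + 1)`, as a point of `[0,T]`. -/
noncomputable def gridPoint (hT : 0 ≤ T) (n m : ℕ) : Icc (0 : ℝ) T :=
  projIcc 0 T hT (m * T / (n + 1))

lemma exists_gridPoint_eq (hT : 0 < T) (n : ℕ) {t : ℝ} (ht : t ∈ Icc 0 T) :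
    ∃ m, gridPoint hT.le n m = ⟨gridAbove T n t, gridAbove_mem hT n ht⟩ :=
  ⟨⌈t * (n + 1) / T⌉₊, projIcc_of_mem hT.le (gridAbove_mem hT n ht)⟩

/-- Right-continuity lets grid points descending to `t` see the value at `t`. The supremum becomes
countable, which is what makes it measurable. -/
lemma supDist_eq_iSup_gridPoint (hT : 0 < T) (γ η : CadlagPath T) :
    supDist γ η = ⨆ (n : ℕ) (m : ℕ),
      edist (γ.1 (gridPoint hT.le n m)) (η.1 (gridPoint hT.le n m)) := by
  apply le_antisymm
  · refine iSup_le fun t => ?_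
    refine le_of_tendsto ((γ.tendsto_gridAbove hT t).edist (η.tendsto_gridAbove hT t))
      (Eventually.of_forall fun n => ?_)
    obtain ⟨m, hm⟩ := exists_gridPoint_eq hT n t.2
    rw [← hm]
    exact le_iSup₂_of_le n m le_rfl
  · exact iSup₂_le fun n m => le_iSup (fun t => edist (γ.1 t) (η.1 t)) _

lemma measurable_supDist (hT : 0 < T) :
    Measurable (fun q : CadlagPath T × CadlagPath T => supDist q.1 q.2) := by
  simp only [supDist_eq_iSup_gridPoint hT]
  refine Measurable.iSup fun n => Measurable.iSup fun m => ?_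
  exact ((CadlagPath.measurable_eval _).comp measurable_fst).edist
    ((CadlagPath.measurable_eval _).comp measurable_snd)

lemma supDist_triangle (γ η ξ : CadlagPath T) : supDist γ ξ ≤ supDist γ η + supDist η ξ :=
  iSup_le fun t => (edist_triangle _ (η.1 t) _).trans
    (add_le_add (le_iSup (fun t => edist (γ.1 t) (η.1 t)) t)
      (le_iSup (fun t => edist (η.1 t) (ξ.1 t)) t))

lemma supDist_comm (γ η : CadlagPath T) : supDist γ η = supDist η γ := by
  simp only [supDist, edist_comm]

lemma supDist_le_ofReal {γ η : CadlagPath T} {ε : ℝ}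
    (h : ∀ t ∈ Icc 0 T, |γ.toReal t - η.toReal t| ≤ ε) : supDist γ η ≤ ENNReal.ofReal ε := by
  refine iSup_le fun t => ?_
  rw [edist_dist, Subtype.dist_eq, Real.dist_eq, ← γ.toReal_coe, ← η.toReal_coe]
  exact ENNReal.ofReal_le_ofReal (h t t.2)

lemma supDist_le_one (γ η : CadlagPath T) : supDist γ η ≤ 1 := by
  rw [← ENNReal.ofReal_one]
  refine supDist_le_ofReal fun t _ => ?_
  have h1 := γ.toReal_mem t
  have h2 := η.toReal_mem t
  rw [abs_le]
  constructor <;> linarith [h1.1, h1.2, h2.1, h2.2]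

lemma measurableSet_forall_toReal_mem (hT : 0 < T) {s : Set ℝ} (hs : IsClosed s) :
    MeasurableSet {γ : CadlagPath T | ∀ t ∈ Icc 0 T, γ.toReal t ∈ s} := by
  have : {γ : CadlagPath T | ∀ t ∈ Icc 0 T, γ.toReal t ∈ s}
      = ⋂ (n : ℕ) (m : ℕ), {γ | γ.toReal (gridPoint hT.le n m) ∈ s} := by
    ext γ
    simp only [mem_ofPred_eq, mem_iInter]
    refine ⟨fun h n m => h _ (gridPoint hT.le n m).2, fun h t ht => ?_⟩
    refine hs.mem_of_tendsto (γ.tendsto_toReal_gridAbove hT ht) (Eventually.of_forall fun n => ?_)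
    obtain ⟨m, hm⟩ := exists_gridPoint_eq hT n ht
    have := h n m
    rwa [hm] at this
  rw [this]
  exact MeasurableSet.iInter fun n => MeasurableSet.iInter fun m =>
    CadlagPath.measurable_toReal _ hs.measurableSet

/-- Moving each partition point up to the grid changes the energy by an amount that vanishes as the
grid is refined, by right-continuity. The endpoints `0` and `T` are grid points and stay fixed; the
order of the others is strict for fine grids. -/
lemma pathEnergy_eq_iSup_grid (hT : 0 < T) (γ : CadlagPath T) :
    pathEnergy γ = ⨆ (k : ℕ) (n : ℕ) (m : Fin (k + 1) → ℕ)
      (_ : StrictMono fun i => (m i * T / (n + 1) : ℝ)) (_ : (m 0 * T / (n + 1) : ℝ) = 0)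
      (_ : (m (Fin.last k) * T / (n + 1) : ℝ) = T),
        ENNReal.ofReal (partitionEnergy γ k fun i => (m i * T / (n + 1) : ℝ)) := by
  apply le_antisymm
  · refine iSup_le fun k => iSup_le fun t => iSup_le fun ht => iSup_le fun h0 => iSup_le fun h1 => ?_
    have hmem : ∀ i, t i ∈ Icc 0 T := fun i =>
      ⟨h0 ▸ ht.monotone (Fin.zero_le i), h1 ▸ ht.monotone (Fin.le_last i)⟩
    have hlim : Tendsto (fun n => ENNReal.ofReal (partitionEnergy γ k fun i => gridAbove T n (t i)))
        atTop (𝓝 (ENNReal.ofReal (partitionEnergy γ k t))) := by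
      refine ENNReal.tendsto_ofReal ?_
      unfold partitionEnergy
      refine Tendsto.const_mul _ (tendsto_finsetSum _ fun i _ => ?_)
      refine Tendsto.div ?_ ?_ (sub_pos.2 (ht (Fin.castSucc_lt_succ))).ne'
      · exact (((γ.tendsto_toReal_gridAbove hT (hmem _)).sub
          (γ.tendsto_toReal_gridAbove hT (hmem _))).abs).pow 2
      · exact (tendsto_gridAbove hT (hmem _).1).sub (tendsto_gridAbove hT (hmem _).1)
    refine le_of_tendsto hlim ?_
    have hmono : ∀ᶠ n in atTop, StrictMono fun i => gridAbove T n (t i) := by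
      simp only [Fin.strictMono_iff_lt_succ, eventually_all]
      intro i
      exact (tendsto_gridAbove hT (hmem _).1).eventually_lt (tendsto_gridAbove hT (hmem _).1)
        (ht Fin.castSucc_lt_succ)
    filter_upwards [hmono] with n hn
    refine le_iSup_of_le k (le_iSup_of_le n (le_iSup_of_le (fun i => ⌈t i * (n + 1) / T⌉₊)
      (le_iSup_of_le hn (le_iSup_of_le ?_ (le_iSup_of_le ?_ le_rfl)))))
    · change gridAbove T n (t 0) = 0
      rw [h0, gridAbove_zero]
    · change gridAbove T n (t (Fin.last k)) = T
      rw [h1, gridAbove_self hT]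
  · refine iSup_le fun k => iSup_le fun n => iSup_le fun m => iSup_le fun hm => iSup_le fun h0 =>
      iSup_le fun h1 => ?_
    exact le_iSup_of_le k (le_iSup_of_le _ (le_iSup_of_le hm (le_iSup_of_le h0
      (le_iSup_of_le h1 le_rfl))))

lemma measurable_pathEnergy (hT : 0 < T) : Measurable (pathEnergy (T := T)) := by
  simp only [funext (pathEnergy_eq_iSup_grid hT)]
  refine Measurable.iSup fun k => Measurable.iSup fun n => Measurable.iSup fun m =>
    Measurable.iSup_Prop _ (Measurable.iSup_Prop _ (Measurable.iSup_Prop _ ?_))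
  refine ENNReal.measurable_ofReal.comp ?_
  unfold partitionEnergy
  refine Measurable.const_mul (Finset.measurable_sum _ fun i _ => ?_) _
  refine Measurable.div_const ?_ _
  exact ((((CadlagPath.measurable_toReal _).sub (CadlagPath.measurable_toReal _)).norm)).pow_const 2

/-! ### Energy estimates for Lipschitz paths. -/

lemma partition_sum_mul {k : ℕ} {t : Fin (k + 1) → ℝ} (h0 : t 0 = 0) (h1 : t (Fin.last k) = T)
    (c : ℝ) : T * c = ∑ i : Fin k, (t i.succ - t i.castSucc) * c := by
  rw [← Finset.sum_mul, Finset.sum_sub_distrib]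
  have e1 := Fin.sum_univ_succ t
  have e2 := Fin.sum_univ_castSucc t
  rw [h0] at e1
  rw [h1] at e2
  congr 1
  linarith

/-- Two Lipschitz paths whose increments are close have close energies. -/
lemma pathEnergy_le_add {γ η : CadlagPath T} {M ε : ℝ} (hε : 0 ≤ ε)
    (hγ : ∀ s ∈ Icc 0 T, ∀ t ∈ Icc 0 T, s ≤ t → |γ.toReal t - γ.toReal s| ≤ M * (t - s))
    (hη : ∀ s ∈ Icc 0 T, ∀ t ∈ Icc 0 T, s ≤ t → |η.toReal t - η.toReal s| ≤ M * (t - s))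
    (hd : ∀ s ∈ Icc 0 T, ∀ t ∈ Icc 0 T, s ≤ t →
      |(γ.toReal t - γ.toReal s) - (η.toReal t - η.toReal s)| ≤ ε * (t - s)) :
    pathEnergy γ ≤ pathEnergy η + ENNReal.ofReal (T * (M * ε)) := by
  refine iSup_le fun k => iSup_le fun t => iSup_le fun ht => iSup_le fun h0 => iSup_le fun h1 => ?_
  have hmem : ∀ i, t i ∈ Icc 0 T := fun i =>
    ⟨h0 ▸ ht.monotone (Fin.zero_le i), h1 ▸ ht.monotone (Fin.le_last i)⟩
  have key : partitionEnergy γ k t ≤ partitionEnergy η k t + T * (M * ε) := by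
    have hT := partition_sum_mul h0 h1 (M * ε)
    unfold partitionEnergy
    rw [hT, Finset.mul_sum, Finset.mul_sum, ← Finset.sum_add_distrib]
    refine Finset.sum_le_sum fun i _ => ?_
    have hlt := ht (Fin.castSucc_lt_succ (i := i))
    have hpos : 0 < t i.succ - t i.castSucc := sub_pos.2 hlt
    have b1 := hγ _ (hmem i.castSucc) _ (hmem i.succ) hlt.le
    have b2 := hη _ (hmem i.castSucc) _ (hmem i.succ) hlt.le
    have b3 := hd _ (hmem i.castSucc) _ (hmem i.succ) hlt.le
    rw [sq_abs, sq_abs]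
    set a := γ.toReal (t i.succ) - γ.toReal (t i.castSucc)
    set b := η.toReal (t i.succ) - η.toReal (t i.castSucc)
    set h := t i.succ - t i.castSucc
    -- Factor `a² - b² = (a - b)(a + b)`: the first factor is small, the second is bounded by the
    -- two speeds.
    have : a ^ 2 ≤ b ^ 2 + 2 * (M * ε) * h ^ 2 := by
      have e : a ^ 2 - b ^ 2 ≤ |a - b| * |a + b| := by
        rw [← abs_mul]; exact (le_abs_self _).trans_eq' (by ring)
      have e2 : |a + b| ≤ 2 * M * h := (abs_add_le a b).trans (by linarith)
      have e3 : |a - b| * |a + b| ≤ (ε * h) * (2 * M * h) :=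
        mul_le_mul b3 e2 (abs_nonneg _) (by positivity)
      nlinarith
    calc 1 / 2 * (a ^ 2 / h) ≤ 1 / 2 * ((b ^ 2 + 2 * (M * ε) * h ^ 2) / h) := by gcongr
      _ = 1 / 2 * (b ^ 2 / h) + h * (M * ε) := by field_simp
  calc ENNReal.ofReal (partitionEnergy γ k t)
      ≤ ENNReal.ofReal (partitionEnergy η k t + T * (M * ε)) := ENNReal.ofReal_le_ofReal key
    _ ≤ ENNReal.ofReal (partitionEnergy η k t) + ENNReal.ofReal (T * (M * ε)) :=
        ENNReal.ofReal_add_le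
    _ ≤ _ := by
        gcongr
        exact le_iSup_of_le k (le_iSup_of_le t (le_iSup_of_le ht (le_iSup_of_le h0
          (le_iSup_of_le h1 le_rfl))))

/-- A crude bound that only has to be finite; the factor `1/2` is given away. -/
lemma pathEnergy_le {γ : CadlagPath T} {M : ℝ}
    (hγ : ∀ s ∈ Icc 0 T, ∀ t ∈ Icc 0 T, s ≤ t → |γ.toReal t - γ.toReal s| ≤ M * (t - s)) :
    pathEnergy γ ≤ ENNReal.ofReal (T * (M * M)) := by
  refine iSup_le fun k => iSup_le fun t => iSup_le fun ht => iSup_le fun h0 => iSup_le fun h1 => ?_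
  have hmem : ∀ i, t i ∈ Icc 0 T := fun i =>
    ⟨h0 ▸ ht.monotone (Fin.zero_le i), h1 ▸ ht.monotone (Fin.le_last i)⟩
  refine ENNReal.ofReal_le_ofReal ?_
  unfold partitionEnergy
  rw [partition_sum_mul h0 h1 (M * M), Finset.mul_sum]
  refine Finset.sum_le_sum fun i _ => ?_
  have hlt := ht (Fin.castSucc_lt_succ (i := i))
  have hpos : 0 < t i.succ - t i.castSucc := sub_pos.2 hlt
  have b1 := hγ _ (hmem i.castSucc) _ (hmem i.succ) hlt.le
  set a := |γ.toReal (t i.succ) - γ.toReal (t i.castSucc)| with ha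
  set h := t i.succ - t i.castSucc
  have ha0 : 0 ≤ a := abs_nonneg _
  calc 1 / 2 * (a ^ 2 / h) ≤ 1 / 2 * ((M * h) ^ 2 / h) := by gcongr
    _ = 1 / 2 * (h * (M * M)) := by field_simp
    _ ≤ h * (M * M) := by nlinarith [mul_nonneg hpos.le (mul_self_nonneg M)]


/-! ### Couplings and the Wasserstein distance. -/

section Wasserstein

open ProbabilityTheory

variable {T : ℝ} {Ω : Type*} [MeasurableSpace Ω]

/-- A measure on a product whose second marginal is the law of `Y` can be lifted to carry the
source of `Y`. -/
lemma exists_measure_lift_snd {A B : Type*} [MeasurableSpace A] [mB : MeasurableSpace B]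
    [StandardBorelSpace Ω] [Nonempty Ω] {μ : Measure Ω} [IsProbabilityMeasure μ]
    {c : Measure (A × B)} [IsProbabilityMeasure c] {Y : Ω → B} (hY : Measurable Y)
    (hc : c.map Prod.snd = μ.map Y) :
    ∃ m : Measure ((A × B) × Ω), m.map Prod.fst = c ∧
      m.map (fun q => (q.1.2, q.2)) = μ.map (fun z => (Y z, z)) := by
  -- The source point is resampled from its conditional law given `Y`, using only the second
  -- coordinate of `c`. This is the gluing of two couplings along a common marginal.
  let κ := condDistrib id Y μ
  refine ⟨c ⊗ₘ (κ.comap Prod.snd measurable_snd), Measure.fst_compProd c _, ?_⟩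
  have h := compProd_map_condDistrib (X := Y) (Y := id) (μ := μ) (mβ := mB) aemeasurable_id
  simp only [id] at h
  rw [← h]
  have hm : Measurable (fun q : (A × B) × Ω => (q.1.2, q.2)) :=
    (measurable_snd.comp measurable_fst).prodMk measurable_snd
  have : IsProbabilityMeasure (μ.map Y) := Measure.isProbabilityMeasure_map hY.aemeasurable
  ext s hs
  rw [Measure.map_apply hm hs, Measure.compProd_apply (hm hs), Measure.compProd_apply hs, ← hc,
    lintegral_map (Kernel.measurable_kernel_prodMk_left hs) measurable_snd]
  rfl

/-- Replacing a random path by another one defined on the same probability space changes the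
Wasserstein distance by at most their expected distance. -/
lemma wassersteinSup_map_le_add [StandardBorelSpace Ω] [Nonempty Ω] (hT : 0 < T)
    {μ : Measure Ω} [IsProbabilityMeasure μ] (π : Measure (CadlagPath T)) {X Y : Ω → CadlagPath T}
    (hX : Measurable X) (hY : Measurable Y) :
    wassersteinSup π (μ.map X)
      ≤ wassersteinSup π (μ.map Y) + ∫⁻ z, supDist (X z) (Y z) ∂μ := by
  have hd := measurable_supDist hT
  unfold wassersteinSup
  simp only [ENNReal.iInf_add]
  refine le_iInf fun c => le_iInf fun hc1 => le_iInf fun hc2 => ?_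
  have : IsProbabilityMeasure (μ.map Y) := Measure.isProbabilityMeasure_map hY.aemeasurable
  have hcp : IsProbabilityMeasure c := by
    constructor
    have h := measure_univ (μ := μ.map Y)
    rwa [← hc2, Measure.map_apply measurable_snd MeasurableSet.univ, preimage_univ] at h
  obtain ⟨m, hfst, hsnd⟩ := exists_measure_lift_snd hY hc2
  have hZ : Measurable (fun q : (CadlagPath T × CadlagPath T) × Ω => (q.1.1, X q.2)) :=
    (measurable_fst.comp measurable_fst).prodMk (hX.comp measurable_snd)
  refine iInf_le_of_le (m.map fun q => (q.1.1, X q.2)) (iInf_le_of_le ?_ (iInf_le_of_le ?_ ?_))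
  · rw [Measure.map_map measurable_fst hZ, ← hc1, ← hfst, Measure.map_map measurable_fst
      measurable_fst]
    rfl
  · have h2 : m.map Prod.snd = μ := by
      have e1 : m.map Prod.snd = (m.map fun q => (q.1.2, q.2)).map Prod.snd :=
        (Measure.map_map measurable_snd
          ((measurable_snd.comp measurable_fst).prodMk measurable_snd)).symm
      have e2 : (μ.map fun z => (Y z, z)).map Prod.snd = μ.map id :=
        Measure.map_map measurable_snd (hY.prodMk measurable_id)
      rw [e1, hsnd, e2, Measure.map_id]
    rw [Measure.map_map measurable_snd hZ]
    change m.map (X ∘ Prod.snd) = _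
    rw [← Measure.map_map hX measurable_snd, h2]
  · calc ∫⁻ q, supDist q.1 q.2 ∂(m.map fun q => (q.1.1, X q.2))
        = ∫⁻ q, supDist q.1.1 (X q.2) ∂m := lintegral_map hd hZ
      _ ≤ ∫⁻ q, (supDist q.1.1 q.1.2 + supDist q.1.2 (X q.2)) ∂m :=
          lintegral_mono fun q => supDist_triangle _ _ _
      _ = ∫⁻ q, supDist q.1.1 q.1.2 ∂m + ∫⁻ q, supDist q.1.2 (X q.2) ∂m :=
          lintegral_add_left (hd.comp measurable_fst) _
      _ = ∫⁻ q, supDist q.1 q.2 ∂c + ∫⁻ z, supDist (X z) (Y z) ∂μ := by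
          congr 1
          · have h1 := lintegral_map (μ := m) hd (g := Prod.fst) measurable_fst
            rw [hfst] at h1
            exact h1.symm
          · let g : CadlagPath T × Ω → ℝ≥0∞ := fun r => supDist r.1 (X r.2)
            have hp : Measurable (fun r : CadlagPath T × Ω => (r.1, X r.2)) :=
              measurable_fst.prodMk (hX.comp measurable_snd)
            have hg : Measurable g := by
              have h := hd.comp hp
              exact h
            have h1 := lintegral_map (μ := m) hg
              ((measurable_snd.comp measurable_fst).prodMk measurable_snd :
                Measurable fun q : (CadlagPath T × CadlagPath T) × Ω => (q.1.2, q.2))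
            have h2 := lintegral_map (μ := μ) hg (hY.prodMk measurable_id)
            change ∫⁻ a, g a ∂(μ.map fun z => (Y z, z)) = _ at h2
            change ∫⁻ a, g a ∂(m.map fun q => (q.1.2, q.2)) = _ at h1
            rw [hsnd, h2] at h1
            simp only [supDist_comm (X _)]
            exact h1.symm

/-- The joint law of `γ` and `X γ` is itself an admissible coupling. -/
lemma wassersteinSup_map_le_lintegral {π : Measure (CadlagPath T)} {X : CadlagPath T → CadlagPath T}
    (hX : AEMeasurable X π) : wassersteinSup π (π.map X) ≤ ∫⁻ γ, supDist γ (X γ) ∂π := by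
  have h : AEMeasurable (fun γ => (γ, X γ)) π := aemeasurable_id.prodMk hX
  refine iInf_le_of_le (π.map fun γ => (γ, X γ)) (iInf_le_of_le ?_ (iInf_le_of_le ?_ ?_))
  · rw [AEMeasurable.map_map_of_aemeasurable measurable_fst.aemeasurable h]
    exact Measure.map_id
  · rw [AEMeasurable.map_map_of_aemeasurable measurable_snd.aemeasurable h]
    rfl
  · exact lintegral_map_le _ _

end Wasserstein

/-! ### Squeezing and iterated limits. -/

lemma tendsto_of_le_add_of_le_add {ι : Type*} {l : Filter ι} {f r : ι → ℝ≥0∞} {a : ℝ≥0∞}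
    (h1 : ∀ᶠ i in l, f i ≤ a + r i) (h2 : ∀ᶠ i in l, a ≤ f i + r i) (hr : Tendsto r l (𝓝 0)) :
    Tendsto f l (𝓝 a) := by
  have hu : Tendsto (fun i => a + r i) l (𝓝 a) := by simpa using hr.const_add a
  have hl : Tendsto (fun i => a - r i) l (𝓝 a) := by
    simpa using ENNReal.Tendsto.sub (tendsto_const_nhds (x := a)) hr (Or.inr ENNReal.zero_ne_top)
  exact tendsto_of_tendsto_of_tendsto_of_le_of_le' hl hu
    (h2.mono fun i hi => tsub_le_iff_right.2 hi) h1

/-- Closed neighbourhoods form a basis in a regular space, and a closed neighbourhood that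
eventually contains `f β δ` also contains its limit in `δ`. -/
lemma tendsto_of_eventually_eventually {X : Type*} [TopologicalSpace X] [RegularSpace X]
    {f : ℝ → ℝ → X} {d : ℝ → X} {a : X} {r : ℝ} (hr : 0 < r)
    (h : ∀ U ∈ 𝓝 a, ∀ᶠ β in 𝓝[>] (0 : ℝ), ∀ᶠ δ in 𝓝[>] (0 : ℝ), f β δ ∈ U)
    (hd : ∀ β ∈ Ioo 0 r, Tendsto (f β) (𝓝[>] 0) (𝓝 (d β))) : Tendsto d (𝓝[>] 0) (𝓝 a) := by
  refine (closed_nhds_basis a).tendsto_right_iff.2 fun U hU => ?_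
  filter_upwards [h U hU.1, Ioo_mem_nhdsGT hr] with β hβ hβ'
  exact hU.2.mem_of_tendsto (hd β hβ') hβ


/-! ### Quantile functions of continuous distribution functions. -/

/-- The quantile function of a distribution function `F`, where the quantile at `0` is the left end
of the support. -/
noncomputable def quantile (F : ℝ → ℝ) (φ : ℝ) : ℝ :=
  open Classical in if φ = 0 then sInf {v | 0 < F v} else sInf {v | φ ≤ F v}

/-- A continuous distribution function whose law is supported in `[-M, M]`. -/
structure IsCompactCDF (F : ℝ → ℝ) (M : ℝ) : Prop where
  mono : Monotone F
  cont : Continuous F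
  left : ∀ v < -M, F v = 0
  right : ∀ v, M ≤ v → F v = 1

namespace IsCompactCDF

variable {F : ℝ → ℝ} {M : ℝ} (hF : IsCompactCDF F M)

include hF

lemma nonneg (v : ℝ) : 0 ≤ F v := by
  have h := hF.left (min v (-M - 1)) (by linarith [min_le_right v (-M - 1)])
  rw [← h]; exact hF.mono (min_le_left _ _)

lemma le_one (v : ℝ) : F v ≤ 1 := by
  rw [← hF.right (max v M) (le_max_right _ _)]; exact hF.mono (le_max_left _ _)

lemma bddBelow_lt {φ : ℝ} (hφ : 0 ≤ φ) : BddBelow {v | φ < F v} := by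
  refine ⟨-M, fun v hv => ?_⟩
  by_contra! h
  have := hF.left v h
  rw [mem_ofPred_eq] at hv
  linarith

lemma bddBelow_le {φ : ℝ} (hφ : 0 < φ) : BddBelow {v | φ ≤ F v} := by
  refine ⟨-M, fun v hv => ?_⟩
  by_contra! h
  have := hF.left v h
  rw [mem_ofPred_eq] at hv
  linarith

lemma mem_lt : M ∈ {v | 0 < F v} := by simp [hF.right M le_rfl]

lemma mem_le {φ : ℝ} (hφ : φ ≤ 1) : M ∈ {v | φ ≤ F v} := by simp [hF.right M le_rfl, hφ]

lemma quantile_mem {φ : ℝ} (hφ : φ ∈ Icc (0 : ℝ) 1) : quantile F φ ∈ Icc (-M) M := by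
  unfold quantile
  split_ifs with h
  · refine ⟨le_csInf ⟨M, hF.mem_lt⟩ fun v hv => ?_, csInf_le (hF.bddBelow_lt le_rfl) hF.mem_lt⟩
    by_contra! h
    have := hF.left v h
    rw [mem_ofPred_eq] at hv
    linarith
  · have h0 : 0 < φ := lt_of_le_of_ne hφ.1 (Ne.symm h)
    refine ⟨le_csInf ⟨M, hF.mem_le hφ.2⟩ fun v hv => ?_,
      csInf_le (hF.bddBelow_le h0) (hF.mem_le hφ.2)⟩
    by_contra! h
    have := hF.left v h
    rw [mem_ofPred_eq] at hv
    linarith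

/-- Everything to the left of the quantile has `F ≤ φ`, and left-continuity passes this to the
quantile itself. Conversely, for `φ > 0` the infimum of the closed set `{φ ≤ F}` belongs to it. -/
lemma apply_quantile {φ : ℝ} (hφ : φ ∈ Icc (0 : ℝ) 1) : F (quantile F φ) = φ := by
  apply le_antisymm
  · have h1 : ∀ v < quantile F φ, F v ≤ φ := by
      intro v hv
      unfold quantile at hv
      split_ifs at hv with h
      · have := notMem_of_lt_csInf hv (hF.bddBelow_lt le_rfl)
        rw [h]
        exact not_lt.1 this
      · have h0 : 0 < φ := lt_of_le_of_ne hφ.1 (Ne.symm h)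
        have := notMem_of_lt_csInf (s := {v | φ ≤ F v}) hv (hF.bddBelow_le h0)
        exact (not_le.1 this).le
    refine le_of_tendsto (hF.cont.tendsto (quantile F φ) |>.mono_left
      (nhdsWithin_le_nhds (s := Iio (quantile F φ)))) ?_
    filter_upwards [self_mem_nhdsWithin] with v hv using h1 v hv
  · by_cases h : φ = 0
    · rw [h]; exact hF.nonneg _
    · have h0 : 0 < φ := lt_of_le_of_ne hφ.1 (Ne.symm h)
      have hc : IsClosed {v | φ ≤ F v} := isClosed_le continuous_const hF.cont
      have := hc.csInf_mem ⟨M, hF.mem_le hφ.2⟩ (hF.bddBelow_le h0)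
      simpa [quantile, h] using this

/-- The equivalence fails at `φ = 0`, where the right side always holds; this color is discarded as
a null set in `map_quantile`. -/
lemma quantile_le_iff {φ : ℝ} (hφ : φ ∈ Ioc (0 : ℝ) 1) (v : ℝ) :
    quantile F φ ≤ v ↔ φ ≤ F v := by
  refine ⟨fun h => ?_, fun h => ?_⟩
  · rw [← hF.apply_quantile (Ioc_subset_Icc_self hφ)]; exact hF.mono h
  · unfold quantile
    rw [if_neg hφ.1.ne']
    exact csInf_le (hF.bddBelow_le hφ.1) h

lemma monotoneOn_quantile : MonotoneOn (quantile F) (Icc 0 1) := by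
  intro φ hφ ψ hψ h
  by_contra! hlt
  have h2 := hF.mono hlt.le
  rw [hF.apply_quantile hφ, hF.apply_quantile hψ] at h2
  rw [le_antisymm h h2] at hlt
  exact lt_irrefl _ hlt

/-- `F` is a left inverse. Injectivity means that distinct colors at the same position have distinct
velocities, so functions of the color are functions of the velocity. -/
lemma injOn_quantile : InjOn (quantile F) (Icc 0 1) := by
  intro φ hφ ψ hψ h
  rw [← hF.apply_quantile hφ, ← hF.apply_quantile hψ, h]

lemma measurable_quantile : Measurable (fun φ : unitInterval => quantile F φ) :=
  Monotone.measurable fun φ ψ h => hF.monotoneOn_quantile φ.2 ψ.2 h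

/-- The quantile function pushes the uniform law to the law with distribution function `F`. -/
lemma map_quantile {ν : Measure ℝ} [IsProbabilityMeasure ν] (hν : ∀ v, ν.real (Iic v) = F v) :
    (volume : Measure unitInterval).map (fun φ : unitInterval => quantile F φ) = ν := by
  have : IsProbabilityMeasure ((volume : Measure unitInterval).map (fun φ : unitInterval => quantile F φ)) :=
    Measure.isProbabilityMeasure_map hF.measurable_quantile.aemeasurable
  refine Measure.ext_of_Iic _ _ fun v => ?_
  rw [Measure.map_apply hF.measurable_quantile measurableSet_Iic]
  have hae : ((fun φ : unitInterval => quantile F φ) ⁻¹' Iic v) =ᵐ[volume]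
      (Iic (⟨F v, hF.nonneg v, hF.le_one v⟩ : unitInterval)) := by
    have h0 : ∀ᵐ φ : unitInterval, φ ≠ 0 := by
      rw [ae_iff]; simp
    filter_upwards [h0] with φ hφ
    have hφ' : (φ : ℝ) ∈ Ioc (0 : ℝ) 1 :=
      ⟨lt_of_le_of_ne φ.2.1 fun h => hφ (Subtype.ext h.symm), φ.2.2⟩
    exact propext (hF.quantile_le_iff hφ' v)
  rw [measure_congr hae, unitInterval.volume_Iic]
  change ENNReal.ofReal (F v) = _
  rw [← hν v, ofReal_measureReal]

end IsCompactCDF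

/-! ### Position and color as coordinates for position and velocity. -/

section Velocity

variable {T : ℝ} {π : Measure (CadlagPath T)} {p : ℝ → ℝ → ℝ} {ρ : ℝ → ℝ → ℝ → ℝ}

lemma RegularityAssumptions.exists_bound (h : RegularityAssumptions T p ρ) :
    ∃ M > 0, ∀ t ∈ Icc 0 T, ∀ x v, ρ t x v ≠ 0 → |v| ≤ M := by
  obtain ⟨K, hK, -, hs⟩ := h.compact_support
  obtain ⟨C, hC⟩ := hK.isBounded.exists_norm_le
  refine ⟨max C 1, by positivity, fun t ht x v hv => le_max_of_le_left ?_⟩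
  exact (norm_snd_le (x, v)).trans (hC (x, v) (hs t ht hv))

lemma velocityLaw_of_mem_Ioo (ρ : ℝ → ℝ → ℝ → ℝ) (t : ℝ) {x : ℝ} (hx : x ∈ Ioo (0 : ℝ) 1) :
    velocityLaw ρ t x = volume.withDensity fun v => ENNReal.ofReal (ρ t x v) := by
  rw [velocityLaw, if_neg]
  rintro (h | h)
  · exact hx.1.ne' h
  · exact hx.2.ne h

lemma IsPhaseDensity.isProbabilityMeasure_velocityLaw (h : IsPhaseDensity π ρ) {t x : ℝ}
    (ht : t ∈ Icc 0 T) (hx : x ∈ Ioo (0 : ℝ) 1) : IsProbabilityMeasure (velocityLaw ρ t x) := by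
  constructor
  rw [velocityLaw_of_mem_Ioo ρ t hx, withDensity_apply _ MeasurableSet.univ, Measure.restrict_univ,
    h.normalised t ht x hx]

/-- Continuity holds because a law with a density has no atoms: the jump of the distribution
function at `v` is the mass of `{v}`. -/
lemma IsPhaseDensity.isCompactCDF (h : IsPhaseDensity π ρ) {t x M : ℝ}
    (ht : t ∈ Icc 0 T) (hx : x ∈ Ioo (0 : ℝ) 1) (hM : ∀ v, ρ t x v ≠ 0 → |v| ≤ M) :
    IsCompactCDF (velocityCDF ρ t x) M := by
  have := h.isProbabilityMeasure_velocityLaw ht hx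
  have hcdf : velocityCDF ρ t x = ProbabilityTheory.cdf (velocityLaw ρ t x) := by
    ext v; rw [ProbabilityTheory.cdf_eq_real]; rfl
  have hz : ∀ s, MeasurableSet s → (∀ v ∈ s, ρ t x v = 0) → velocityLaw ρ t x s = 0 := by
    intro s hs h0
    rw [velocityLaw_of_mem_Ioo ρ t hx, withDensity_apply _ hs]
    rw [setLIntegral_congr_fun hs (g := fun _ => 0) fun v hv => by simp [h0 v hv]]
    simp
  constructor
  · rw [hcdf]; exact ProbabilityTheory.monotone_cdf _
  · rw [hcdf]
    have hmono := ProbabilityTheory.monotone_cdf (velocityLaw ρ t x)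
    refine continuous_iff_continuousAt.2 fun v => ?_
    rw [hmono.continuousAt_iff_leftLim_eq_rightLim, StieltjesFunction.rightLim_eq]
    have h1 := (ProbabilityTheory.cdf (velocityLaw ρ t x)).measure_singleton v
    have h2 : velocityLaw ρ t x {v} = 0 := by
      rw [velocityLaw_of_mem_Ioo ρ t hx]
      exact withDensity_absolutelyContinuous _ _ (by simp)
    rw [ProbabilityTheory.measure_cdf, h2] at h1
    have h3 := ENNReal.ofReal_eq_zero.1 h1.symm
    exact le_antisymm (hmono.leftLim_le le_rfl) (by linarith)
  · intro v hv
    have : velocityLaw ρ t x (Iic v) = 0 := by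
      refine hz _ measurableSet_Iic fun u hu => ?_
      by_contra h0
      have := abs_le.1 (hM u h0)
      rw [mem_Iic] at hu
      linarith
    rw [velocityCDF, Measure.real, this, ENNReal.toReal_zero]
  · intro v hv
    have : velocityLaw ρ t x (Ioi v) = 0 := by
      refine hz _ measurableSet_Ioi fun u hu => ?_
      by_contra h0
      have := abs_le.1 (hM u h0)
      rw [mem_Ioi] at hu
      linarith
    have h1 := (prob_compl_eq_zero_iff (μ := velocityLaw ρ t x) (measurableSet_Iic (a := v))).1
      (by rwa [compl_Iic])
    rw [velocityCDF, Measure.real, h1, ENNReal.toReal_one]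

/-- The distribution function is rebuilt from the density alone, which gives joint measurability in
position and velocity; the convention at the endpoints `0` and `1` is bypassed. -/
lemma IsPhaseDensity.measurable_velocityCDF (h : IsPhaseDensity π ρ) {t : ℝ} (ht : t ∈ Icc 0 T) :
    ∃ G : ℝ × ℝ → ℝ, Measurable G ∧
      ∀ x ∈ Ioo (0 : ℝ) 1, ∀ v, G (x, v) = velocityCDF ρ t x v := by
  refine ⟨fun z => (∫⁻ u, (Iic z.2).indicator (fun u => ENNReal.ofReal (ρ t z.1 u)) u).toReal,
    ?_, fun x hx v => ?_⟩
  · refine ENNReal.measurable_toReal.comp (Measurable.lintegral_prod_right' (f := fun q : (ℝ × ℝ) × ℝ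
      => (Iic q.1.2).indicator (fun u => ENNReal.ofReal (ρ t q.1.1 u)) q.2) ?_)
    have h1 : Measurable (fun q : (ℝ × ℝ) × ℝ => ENNReal.ofReal (ρ t q.1.1 q.2)) :=
      ENNReal.measurable_ofReal.comp ((h.measurable t ht).comp
        ((measurable_fst.comp measurable_fst).prodMk measurable_snd))
    have h2 : MeasurableSet {q : (ℝ × ℝ) × ℝ | q.2 ≤ q.1.2} :=
      measurableSet_le measurable_snd (measurable_snd.comp measurable_fst)
    exact h1.indicator h2
  · simp only
    rw [lintegral_indicator measurableSet_Iic, velocityCDF, velocityLaw_of_mem_Ioo ρ t hx,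
      Measure.real, withDensity_apply _ measurableSet_Iic]

/-- The position and velocity that correspond to the position `z.1` and the color `z.2`. -/
noncomputable def phasePoint (ρ : ℝ → ℝ → ℝ → ℝ) (t : ℝ) (z : unitInterval × unitInterval) :
    ℝ × ℝ := (z.1, quantileVelocity ρ t z.1 z.2)

lemma ae_mem_Ioo : ∀ᵐ x : unitInterval, (x : ℝ) ∈ Ioo (0 : ℝ) 1 := by
  have h0 : ∀ᵐ φ : unitInterval, φ ≠ 0 := by rw [ae_iff]; simp
  have h1 : ∀ᵐ φ : unitInterval, φ ≠ 1 := by rw [ae_iff]; simp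
  filter_upwards [h0, h1] with x hx0 hx1
  exact ⟨lt_of_le_of_ne x.2.1 fun h => hx0 (Subtype.ext h.symm),
    lt_of_le_of_ne x.2.2 fun h => hx1 (Subtype.ext h)⟩

lemma ae_prod_mem_Ioo : ∀ᵐ z : unitInterval × unitInterval,
    (z.1 : ℝ) ∈ Ioo (0 : ℝ) 1 ∧ (z.2 : ℝ) ∈ Ioo (0 : ℝ) 1 :=
  (Measure.quasiMeasurePreserving_fst.ae ae_mem_Ioo).and
    (Measure.quasiMeasurePreserving_snd.ae ae_mem_Ioo)

/-- On the open square the sublevel sets of the quantile are `{φ ≤ F(x,v)}`, which are measurable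
because `F` is; off it the velocity is replaced by zero. -/
lemma exists_measurable_phasePoint (h : IsPhaseDensity π ρ) (hreg : RegularityAssumptions T p ρ)
    {t : ℝ} (ht : t ∈ Icc 0 T) : ∃ J : unitInterval × unitInterval → ℝ × ℝ, Measurable J ∧
      ∀ z : unitInterval × unitInterval, (z.1 : ℝ) ∈ Ioo (0 : ℝ) 1 → (z.2 : ℝ) ∈ Ioo (0 : ℝ) 1 →
        J z = phasePoint ρ t z := by
  obtain ⟨M, hM0, hM⟩ := hreg.exists_bound
  obtain ⟨G, hG, hGF⟩ := h.measurable_velocityCDF ht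
  let s : Set (unitInterval × unitInterval) :=
    {z | (z.1 : ℝ) ∈ Ioo (0 : ℝ) 1 ∧ (z.2 : ℝ) ∈ Ioo (0 : ℝ) 1}
  have hs : MeasurableSet s := ((measurable_subtype_coe.comp measurable_fst) measurableSet_Ioo).inter
    ((measurable_subtype_coe.comp measurable_snd) measurableSet_Ioo)
  let f : unitInterval × unitInterval → ℝ := fun z => quantileVelocity ρ t z.1 z.2
  have hf : Measurable (s.indicator f) := by
    refine measurable_of_Iic fun v => ?_
    have hm : MeasurableSet {z : unitInterval × unitInterval | (z.2 : ℝ) ≤ G (z.1, v)} :=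
      measurableSet_le (measurable_subtype_coe.comp measurable_snd)
        (hG.comp ((measurable_subtype_coe.comp measurable_fst).prodMk measurable_const))
    have : s.indicator f ⁻¹' Iic v =
        (s ∩ {z | (z.2 : ℝ) ≤ G (z.1, v)}) ∪ (sᶜ ∩ {z | (0 : ℝ) ≤ v}) := by
      ext z
      by_cases hz : z ∈ s
      · simp only [mem_preimage, indicator_of_mem hz, mem_union, mem_inter_iff, hz, true_and,
          mem_compl_iff, not_true, false_and, or_false, mem_ofPred_eq, mem_Iic]
        rw [hGF _ hz.1]
        exact (h.isCompactCDF ht hz.1 (hM t ht _)).quantile_le_iff (Ioo_subset_Ioc_self hz.2) v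
      · simp [hz]
    rw [this]
    exact (hs.inter hm).union (hs.compl.inter (MeasurableSet.const _))
  refine ⟨fun z => (z.1, s.indicator f z),
    (measurable_subtype_coe.comp measurable_fst).prodMk hf, fun z h1 h2 => ?_⟩
  have hz : z ∈ s := ⟨h1, h2⟩
  simp only [phasePoint, indicator_of_mem hz, f]

lemma aemeasurable_phasePoint (h : IsPhaseDensity π ρ) (hreg : RegularityAssumptions T p ρ)
    {t : ℝ} (ht : t ∈ Icc 0 T) : AEMeasurable (phasePoint ρ t) volume := by
  obtain ⟨J, hJ, hJe⟩ := exists_measurable_phasePoint h hreg ht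
  refine ⟨J, hJ, ?_⟩
  filter_upwards [ae_prod_mem_Ioo] with z hz using (hJe z hz.1 hz.2).symm

/-- The law of position and velocity is the image of the uniform law of position and color. -/
lemma phaseLaw_eq_map (h : IsPhaseDensity π ρ) (hreg : RegularityAssumptions T p ρ)
    {t : ℝ} (ht : t ∈ Icc 0 T) : phaseLaw π t = volume.map (phasePoint ρ t) := by
  obtain ⟨M, hM0, hM⟩ := hreg.exists_bound
  obtain ⟨J, hJ, hJe⟩ := exists_measurable_phasePoint h hreg ht
  have hae : phasePoint ρ t =ᵐ[volume] J := by
    filter_upwards [ae_prod_mem_Ioo] with z hz using (hJe z hz.1 hz.2).symm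
  rw [h.density t ht, Measure.map_congr hae]
  ext s hs
  have hρ : Measurable (fun z : ℝ × ℝ => ENNReal.ofReal (ρ t z.1 z.2)) :=
    ENNReal.measurable_ofReal.comp (h.measurable t ht)
  rw [Measure.map_apply hJ hs, Measure.volume_eq_prod unitInterval unitInterval,
    Measure.prod_apply (hJ hs), withDensity_apply _ hs, ← lintegral_indicator hs,
    Measure.volume_eq_prod ℝ ℝ, ← Measure.restrict_univ (μ := (volume : Measure ℝ)),
    Measure.restrict_univ, ← Measure.prod_restrict, Measure.restrict_univ,
    lintegral_prod _ (hρ.indicator hs).aemeasurable]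
  have hpre := unitInterval.measurePreserving_coe
  have hmeas : Measurable (fun x : ℝ => ∫⁻ y, s.indicator (fun z : ℝ × ℝ =>
      ENNReal.ofReal (ρ t z.1 z.2)) (x, y)) := (hρ.indicator hs).lintegral_prod_right'
  rw [← hpre.lintegral_comp hmeas]
  refine lintegral_congr_ae ?_
  filter_upwards [ae_mem_Ioo] with x hx
  have hF := h.isCompactCDF ht hx (hM t ht _)
  have := h.isProbabilityMeasure_velocityLaw ht hx
  have hmap := hF.map_quantile (ν := velocityLaw ρ t x) fun v => rfl
  have hsx : MeasurableSet {v : ℝ | ((x : ℝ), v) ∈ s} := measurable_prodMk_left hs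
  calc ∫⁻ y, s.indicator (fun z : ℝ × ℝ => ENNReal.ofReal (ρ t z.1 z.2)) (x, y)
      = ∫⁻ y in {v : ℝ | ((x : ℝ), v) ∈ s}, ENNReal.ofReal (ρ t x y) := by
        rw [← lintegral_indicator hsx]; rfl
    _ = velocityLaw ρ t x {v : ℝ | ((x : ℝ), v) ∈ s} := by
        rw [velocityLaw_of_mem_Ioo ρ t hx, withDensity_apply _ hsx]
    _ = volume ((fun φ : unitInterval => quantile (velocityCDF ρ t x) φ) ⁻¹'
          {v : ℝ | ((x : ℝ), v) ∈ s}) := by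
        rw [← Measure.map_apply hF.measurable_quantile hsx, hmap]
    _ = volume (Prod.mk x ⁻¹' (J ⁻¹' s)) := by
        refine measure_congr ?_
        filter_upwards [ae_mem_Ioo] with φ hφ
        change (((x : ℝ), quantile (velocityCDF ρ t x) φ) ∈ s) = (J (x, φ) ∈ s)
        rw [hJe (x, φ) hx hφ]
        rfl

/-- Position and color can be recovered measurably from position and velocity. -/
lemma exists_measurable_color (h : IsPhaseDensity π ρ) (hreg : RegularityAssumptions T p ρ)
    {t : ℝ} (ht : t ∈ Icc 0 T) : ∃ ζ : ℝ × ℝ → unitInterval × unitInterval, Measurable ζ ∧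
      ∀ᵐ z, ζ (phasePoint ρ t z) = z := by
  obtain ⟨M, hM0, hM⟩ := hreg.exists_bound
  obtain ⟨G, hG, hGF⟩ := h.measurable_velocityCDF ht
  refine ⟨fun q => (projIcc 0 1 zero_le_one q.1, projIcc 0 1 zero_le_one (G q)), ?_, ?_⟩
  · exact (continuous_projIcc.measurable.comp measurable_fst).prodMk
      (continuous_projIcc.measurable.comp hG)
  · filter_upwards [ae_prod_mem_Ioo] with z hz
    have hF := h.isCompactCDF ht hz.1 (hM t ht _)
    have e : G (phasePoint ρ t z) = z.2 := by
      rw [phasePoint, hGF _ hz.1]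
      exact hF.apply_quantile z.2.2
    rw [e]
    exact Prod.ext (projIcc_val zero_le_one z.1) (projIcc_val zero_le_one z.2)

end Velocity


lemma integral_unitInterval_eq (f : ℝ → ℝ) :
    ∫ x : unitInterval, f x = ∫ x in (0 : ℝ)..1, f x := by
  rw [unitInterval.measurePreserving_coe.integral_comp unitInterval.measurableEmbedding_coe,
    intervalIntegral.integral_of_le zero_le_one]
  exact integral_Icc_eq_integral_Ioc

/-! ### Newton paths: speed, acceleration and distance from the boundary. -/

section Newton

variable {T : ℝ} {π : Measure (CadlagPath T)} {p : ℝ → ℝ → ℝ} {ρ : ℝ → ℝ → ℝ → ℝ}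
  {W : ℝ → ℝ → ℝ → ℝ → ℝ}

/-- The velocity of a path. -/
noncomputable def CadlagPath.velocity (γ : CadlagPath T) (t : ℝ) : ℝ :=
  derivWithin γ.toReal (Icc 0 T) t

/-- The path solves Newton's equation with pressure `p`. -/
def IsNewtonPath (p : ℝ → ℝ → ℝ) (γ : CadlagPath T) : Prop :=
  ∀ t ∈ Icc 0 T, HasDerivWithinAt γ.toReal (γ.velocity t) (Icc 0 T) t ∧
    HasDerivWithinAt γ.velocity (-pressureGradient p t (γ.toReal t)) (Icc 0 T) t

lemma IsGeneralizedEulerSolution.ae_isNewtonPath (hT : 0 < T)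
    (h : IsGeneralizedEulerSolution π p) : ∀ᵐ γ ∂π, IsNewtonPath p γ := by
  filter_upwards [h.equation] with γ ⟨v, hv⟩
  have he : EqOn γ.velocity v (Icc 0 T) := fun t ht =>
    (hv t ht).1.derivWithin (uniqueDiffOn_Icc hT t ht)
  intro t ht
  refine ⟨?_, (hv t ht).2.congr he (he ht)⟩
  rw [he ht]
  exact (hv t ht).1

lemma IsNewtonPath.continuousOn {γ : CadlagPath T} (h : IsNewtonPath p γ) :
    ContinuousOn γ.toReal (Icc 0 T) := fun t ht => (h t ht).1.continuousWithinAt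

lemma IsNewtonPath.continuousOn_velocity {γ : CadlagPath T} (h : IsNewtonPath p γ) :
    ContinuousOn γ.velocity (Icc 0 T) := fun t ht => (h t ht).2.continuousWithinAt

lemma phaseLaw_eq (π : Measure (CadlagPath T)) (t : ℝ) :
    phaseLaw π t = π.map fun γ => (γ.toReal t, γ.velocity t) := rfl

/-- Measurability of the velocity comes for free: the push-forward along a map that is not a.e.
measurable is zero by convention, whereas the phase law is a probability measure. -/
lemma aemeasurable_phase (hρ : IsPhaseDensity π ρ) (hreg : RegularityAssumptions T p ρ) {t : ℝ}
    (ht : t ∈ Icc 0 T) : AEMeasurable (fun γ : CadlagPath T => (γ.toReal t, γ.velocity t)) π := by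
  by_contra h
  have h1 : phaseLaw π t = 0 := Measure.map_of_not_aemeasurable h
  rw [phaseLaw_eq_map hρ hreg ht] at h1
  have : IsProbabilityMeasure ((volume : Measure (unitInterval × unitInterval)).map
      (phasePoint ρ t)) := Measure.isProbabilityMeasure_map (aemeasurable_phasePoint hρ hreg ht)
  exact IsProbabilityMeasure.ne_zero _ h1

lemma aemeasurable_velocity (hρ : IsPhaseDensity π ρ) (hreg : RegularityAssumptions T p ρ) {t : ℝ}
    (ht : t ∈ Icc 0 T) : AEMeasurable (fun γ : CadlagPath T => γ.velocity t) π :=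
  measurable_snd.comp_aemeasurable (aemeasurable_phase hρ hreg ht)

/-- Expectations of functions of position and velocity as integrals over position and color. -/
lemma integral_phase_eq (hρ : IsPhaseDensity π ρ) (hreg : RegularityAssumptions T p ρ) {t : ℝ}
    (ht : t ∈ Icc 0 T) {f : ℝ × ℝ → ℝ} (hf : Measurable f) :
    ∫ γ, f (γ.toReal t, γ.velocity t) ∂π = ∫ z, f (phasePoint ρ t z) := by
  rw [← integral_map (aemeasurable_phase hρ hreg ht) hf.aestronglyMeasurable, ← phaseLaw_eq,
    phaseLaw_eq_map hρ hreg ht,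
    integral_map (aemeasurable_phasePoint hρ hreg ht) hf.aestronglyMeasurable]

lemma abs_phasePoint_snd_le (hρ : IsPhaseDensity π ρ) {t M : ℝ} (ht : t ∈ Icc 0 T)
    (hM : ∀ t ∈ Icc 0 T, ∀ x v, ρ t x v ≠ 0 → |v| ≤ M) {z : unitInterval × unitInterval}
    (hz : (z.1 : ℝ) ∈ Ioo (0 : ℝ) 1) : |(phasePoint ρ t z).2| ≤ M :=
  abs_le.2 ((hρ.isCompactCDF ht hz (hM t ht _)).quantile_mem z.2.2)

/-- At a fixed time the bound holds almost surely by the support of the phase law. It extends from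
countably many grid times to all times by continuity of the velocity. -/
lemma ae_abs_velocity_le (hT : 0 < T) (hπ : IsGeneralizedEulerSolution π p)
    (hρ : IsPhaseDensity π ρ) (hreg : RegularityAssumptions T p ρ) {M : ℝ}
    (hM : ∀ t ∈ Icc 0 T, ∀ x v, ρ t x v ≠ 0 → |v| ≤ M) :
    ∀ᵐ γ ∂π, ∀ t ∈ Icc 0 T, |γ.velocity t| ≤ M := by
  have h1 : ∀ t ∈ Icc 0 T, ∀ᵐ γ ∂π, |γ.velocity t| ≤ M := by
    intro t ht
    have : ∀ᵐ q ∂phaseLaw π t, |q.2| ≤ M := by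
      rw [phaseLaw_eq_map hρ hreg ht, ae_map_iff (aemeasurable_phasePoint hρ hreg ht)
        (measurableSet_le (by fun_prop) (by fun_prop))]
      filter_upwards [ae_prod_mem_Ioo] with z hz
      exact abs_phasePoint_snd_le hρ ht hM hz.1
    exact ae_of_ae_map (aemeasurable_phase hρ hreg ht) this
  have h2 : ∀ᵐ γ ∂π, ∀ n m, |γ.velocity (gridPoint hT.le n m)| ≤ M :=
    ae_all_iff.2 fun n => ae_all_iff.2 fun m => h1 _ (gridPoint hT.le n m).2
  filter_upwards [h2, hπ.ae_isNewtonPath hT] with γ hγ hN t ht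
  have hlim : Tendsto (fun n => γ.velocity (gridAbove T n t)) atTop (𝓝 (γ.velocity t)) :=
    (hN.continuousOn_velocity t ht).tendsto.comp (tendsto_nhdsWithin_iff.2
      ⟨tendsto_gridAbove hT ht.1, Eventually.of_forall fun n => gridAbove_mem hT n ht⟩)
  refine le_of_tendsto hlim.abs (Eventually.of_forall fun n => ?_)
  obtain ⟨m, hm⟩ := exists_gridPoint_eq hT n ht
  have := hγ n m
  rwa [hm] at this

lemma IsBoundarySmoothing.exists_eq {V : ℝ → ℝ → ℝ → ℝ} (hW : IsBoundarySmoothing T V W) {x : ℝ}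
    (hx : x ∈ Ioo (0 : ℝ) 1) : ∃ β ∈ Ioo (0 : ℝ) (1 / 4), x ∈ Icc β (1 - β) ∧
      ∀ t ∈ Icc 0 T, ∀ φ ∈ Icc (0 : ℝ) 1, W β t x φ = V t x φ := by
  have h0 : 0 < min x (1 - x) := lt_min hx.1 (by linarith [hx.2])
  have h1 := min_le_left x (1 - x)
  have h2 := min_le_right x (1 - x)
  have hβ : min x (1 - x) / 3 ∈ Ioo (0 : ℝ) (1 / 4) := ⟨by linarith, by linarith⟩
  have hm : x ∈ Icc (min x (1 - x) / 3) (1 - min x (1 - x) / 3) := ⟨by linarith, by linarith⟩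
  exact ⟨_, hβ, hm, fun t ht φ hφ => hW.eq_inside _ hβ t ht x hm φ hφ⟩

/-- At each interior position the conditional mean already vanishes, since `V` agrees there with a
smoothing of mean zero. -/
lemma integral_velocity_eq_zero [IsProbabilityMeasure π]
    (hρ : IsPhaseDensity π ρ) (hreg : RegularityAssumptions T p ρ)
    (hW : IsBoundarySmoothing T (quantileVelocity ρ) W) {t : ℝ} (ht : t ∈ Icc 0 T) :
    ∫ γ, γ.velocity t ∂π = 0 := by
  obtain ⟨M, hM0, hM⟩ := hreg.exists_bound
  rw [integral_phase_eq hρ hreg ht measurable_snd]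
  have hint : Integrable (fun z => (phasePoint ρ t z).2)
      (volume : Measure (unitInterval × unitInterval)) := by
    refine Integrable.of_bound (measurable_snd.comp_aemeasurable
      (aemeasurable_phasePoint hρ hreg ht)).aestronglyMeasurable M ?_
    filter_upwards [ae_prod_mem_Ioo] with z hz using abs_phasePoint_snd_le hρ ht hM hz.1
  rw [Measure.volume_eq_prod] at hint ⊢
  rw [integral_prod _ hint]
  refine integral_eq_zero_of_ae ?_
  filter_upwards [ae_mem_Ioo] with x hx
  obtain ⟨β, hβ, hxβ, he⟩ := hW.exists_eq hx
  rw [Pi.zero_apply, ← hW.mean_zero β hβ t ht x x.2]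
  change ∫ φ : unitInterval, quantileVelocity ρ t x φ = _
  rw [integral_unitInterval_eq]
  refine intervalIntegral.integral_congr fun φ hφ => ?_
  rw [uIcc_of_le zero_le_one] at hφ
  exact (he t ht φ hφ).symm

/-- A Newton path with speed at most `M` and acceleration at most `L`. -/
structure IsRegularPath (p : ℝ → ℝ → ℝ) (L M : ℝ) (γ : CadlagPath T) : Prop where
  newton : IsNewtonPath p γ
  speed : ∀ t ∈ Icc 0 T, |γ.velocity t| ≤ M
  acceleration : ∀ s ∈ Icc 0 T, ∀ t ∈ Icc 0 T, |γ.velocity t - γ.velocity s| ≤ L * |t - s|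

/-- The velocities of two Newton paths differ by a Lipschitz function; since the mean velocity
vanishes, the velocities themselves are Lipschitz. -/
lemma ae_isRegularPath [IsProbabilityMeasure π] (hT : 0 < T) (hπ : IsGeneralizedEulerSolution π p)
    (hρ : IsPhaseDensity π ρ) (hreg : RegularityAssumptions T p ρ)
    (hW : IsBoundarySmoothing T (quantileVelocity ρ) W) {L M : ℝ} (hL0 : 0 ≤ L)
    (hM : ∀ t ∈ Icc 0 T, ∀ x v, ρ t x v ≠ 0 → |v| ≤ M)
    (hL : ∀ t ∈ Icc 0 T, ∀ x ∈ Icc (0 : ℝ) 1, ∀ y ∈ Icc (0 : ℝ) 1,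
      |pressureGradient p t x - pressureGradient p t y| ≤ L * |x - y|) :
    ∀ᵐ γ ∂π, IsRegularPath p L M γ := by
  have hN := hπ.ae_isNewtonPath hT
  have hS := ae_abs_velocity_le hT hπ hρ hreg hM
  filter_upwards [hN, hS] with γ hγ hγM
  refine ⟨hγ, hγM, fun s hs t ht => ?_⟩
  have hint : ∀ t ∈ Icc 0 T, Integrable (fun η : CadlagPath T => η.velocity t) π := by
    intro t ht
    refine Integrable.of_bound (aemeasurable_velocity hρ hreg ht).aestronglyMeasurable M ?_
    filter_upwards [hS] with η hη using hη t ht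
  -- The force itself need not be bounded in time, but its differences between positions are.
  -- Averaging over an independent path `η`, whose mean velocity is zero, leaves only such
  -- differences.
  have e : γ.velocity t - γ.velocity s
      = ∫ η, ((γ.velocity t - η.velocity t) - (γ.velocity s - η.velocity s)) ∂π := by
    have hi : ∀ t ∈ Icc 0 T, Integrable (fun η : CadlagPath T => γ.velocity t - η.velocity t) π :=
      fun t ht => (integrable_const _).sub (hint t ht)
    have hv : ∀ t ∈ Icc 0 T, ∫ η : CadlagPath T, (γ.velocity t - η.velocity t) ∂π
        = γ.velocity t := fun t ht => by
      rw [integral_sub (integrable_const _) (hint t ht), integral_velocity_eq_zero hρ hreg hW ht]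
      simp
    rw [integral_sub (hi t ht) (hi s hs), hv t ht, hv s hs]
  rw [e]
  have := norm_integral_le_of_norm_le_const (μ := π) (C := L * |t - s|)
    (f := fun η => (γ.velocity t - η.velocity t) - (γ.velocity s - η.velocity s)) ?_
  · simpa using this
  · filter_upwards [hN] with η hη
    refine (convex_Icc (0 : ℝ) T).norm_image_sub_le_of_norm_hasDerivWithin_le
      (f := fun r => γ.velocity r - η.velocity r)
      (fun r hr => (hγ r hr).2.sub (hη r hr).2) (fun r hr => ?_) hs ht
    have h1 := hL r hr _ (η.toReal_mem r) _ (γ.toReal_mem r)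
    have h2 : |η.toReal r - γ.toReal r| ≤ 1 := by
      have h1 := γ.toReal_mem r
      have h2 := η.toReal_mem r
      rw [abs_le]
      constructor <;> linarith [h1.1, h1.2, h2.1, h2.2]
    rw [Real.norm_eq_abs, show -pressureGradient p r (γ.toReal r) -
      -pressureGradient p r (η.toReal r) = pressureGradient p r (η.toReal r) -
        pressureGradient p r (γ.toReal r) by ring]
    nlinarith

lemma _root_.HasDerivWithinAt.Ici_of_Icc {E : Type*} [NormedAddCommGroup E] [NormedSpace ℝ E]
    {f : ℝ → E} {f' : E} {a b t : ℝ} (h : HasDerivWithinAt f f' (Icc a b) t) (ht : t ∈ Ico a b) :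
    HasDerivWithinAt f f' (Ici t) t :=
  h.mono_of_mem_nhdsWithin (Icc_mem_nhdsGE_of_mem ht)

/-- Grönwall's inequality in phase space, where the difference of the two vector fields is at most
`1 + L` times the distance. It makes the final state a Lipschitz function of the state at time `s`.
-/
lemma IsNewtonPath.norm_sub_le {γ η : CadlagPath T} (hγ : IsNewtonPath p γ) (hη : IsNewtonPath p η)
    {L : ℝ} (hL0 : 0 ≤ L) (hL : ∀ t ∈ Icc 0 T, ∀ x ∈ Icc (0 : ℝ) 1, ∀ y ∈ Icc (0 : ℝ) 1,
      |pressureGradient p t x - pressureGradient p t y| ≤ L * |x - y|) {s : ℝ} (hs : s ∈ Icc 0 T) :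
    ‖(γ.toReal T - η.toReal T, γ.velocity T - η.velocity T)‖
      ≤ ‖(γ.toReal s - η.toReal s, γ.velocity s - η.velocity s)‖ * Real.exp ((1 + L) * T) := by
  have key := norm_le_gronwallBound_of_norm_deriv_right_le (a := s) (b := T) (K := 1 + L) (ε := 0)
    (f := fun r => (γ.toReal r - η.toReal r, γ.velocity r - η.velocity r))
    (f' := fun r => (γ.velocity r - η.velocity r, -pressureGradient p r (γ.toReal r) -
      -pressureGradient p r (η.toReal r))) ?_ ?_ le_rfl ?_ T ⟨hs.2, le_rfl⟩
  · rw [gronwallBound_ε0] at key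
    refine key.trans ?_
    gcongr
    linarith [hs.1]
  · have hsub : Icc s T ⊆ Icc 0 T := Icc_subset_Icc_left hs.1
    exact ((hγ.continuousOn.sub hη.continuousOn).prodMk
      (hγ.continuousOn_velocity.sub hη.continuousOn_velocity)).mono hsub
  · intro r hr
    have hr0 : r ∈ Ico 0 T := ⟨hs.1.trans hr.1, hr.2⟩
    have hr' := Ico_subset_Icc_self hr0
    exact (((hγ r hr').1.sub (hη r hr').1).prodMk ((hγ r hr').2.sub (hη r hr').2)).Ici_of_Icc hr0
  · intro r hr
    have hr' : r ∈ Icc 0 T := ⟨hs.1.trans hr.1, hr.2.le⟩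
    have h1 := hL r hr' _ (η.toReal_mem r) _ (γ.toReal_mem r)
    rw [Prod.norm_mk, add_zero]
    set e := ‖(γ.toReal r - η.toReal r, γ.velocity r - η.velocity r)‖
    have he1 : |γ.toReal r - η.toReal r| ≤ e :=
      norm_fst_le (γ.toReal r - η.toReal r, γ.velocity r - η.velocity r)
    have he2 : |γ.velocity r - η.velocity r| ≤ e :=
      norm_snd_le (γ.toReal r - η.toReal r, γ.velocity r - η.velocity r)
    have he0 : 0 ≤ e := norm_nonneg _
    refine max_le ?_ ?_
    · rw [Real.norm_eq_abs]
      nlinarith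
    · rw [Real.norm_eq_abs, show -pressureGradient p r (γ.toReal r) -
        -pressureGradient p r (η.toReal r) = pressureGradient p r (η.toReal r) -
          pressureGradient p r (γ.toReal r) by ring]
      rw [abs_sub_comm (η.toReal r)] at h1
      nlinarith

lemma IsRegularPath.abs_sub_le {γ : CadlagPath T} {L M : ℝ} (h : IsRegularPath p L M γ) {s t : ℝ}
    (hs : s ∈ Icc 0 T) (ht : t ∈ Icc 0 T) : |γ.toReal t - γ.toReal s| ≤ M * |t - s| :=
  (convex_Icc (0 : ℝ) T).norm_image_sub_le_of_norm_hasDerivWithin_le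
    (fun r hr => (h.newton r hr).1) (fun r hr => h.speed r hr) hs ht

/-- The final positions and velocities of the paths that are at rest at the point `c` at some time
form a null set, since they lie on a Lipschitz curve. -/
lemma volume_endpoints_eq_zero {L M : ℝ} (hL0 : 0 ≤ L) (hM0 : 0 ≤ M)
    (hL : ∀ t ∈ Icc 0 T, ∀ x ∈ Icc (0 : ℝ) 1, ∀ y ∈ Icc (0 : ℝ) 1,
      |pressureGradient p t x - pressureGradient p t y| ≤ L * |x - y|) (c : ℝ) :
    volume {q : ℝ × ℝ | ∃ γ : CadlagPath T, IsRegularPath p L M γ ∧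
      (∃ t ∈ Icc 0 T, γ.toReal t = c ∧ γ.velocity t = 0) ∧ q = (γ.toReal T, γ.velocity T)} = 0 := by
  -- The possible times of contact; they parametrise the set of endpoints.
  let A : Set ℝ := {t | t ∈ Icc 0 T ∧ ∃ γ : CadlagPath T, IsRegularPath p L M γ ∧
    γ.toReal t = c ∧ γ.velocity t = 0}
  let C : ℝ := (L + M) * Real.exp ((1 + L) * T)
  have hC0 : 0 ≤ C := by positivity
  have hone : ∀ γ η : CadlagPath T, IsRegularPath p L M γ → IsRegularPath p L M η →
      ∀ s ∈ Icc 0 T, ∀ t ∈ Icc 0 T, γ.toReal t = c → γ.velocity t = 0 → η.toReal s = c →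
      η.velocity s = 0 →
      dist (γ.toReal T, γ.velocity T) (η.toReal T, η.velocity T) ≤ C * |t - s| := by
    intro γ η hγ hη s hs t ht h1 h2 h3 h4
    have key := hγ.newton.norm_sub_le hη.newton hL0 hL ht
    rw [dist_eq_norm]
    refine key.trans ?_
    have hb : ‖(γ.toReal t - η.toReal t, γ.velocity t - η.velocity t)‖ ≤ (L + M) * |t - s| := by
      have b1 := hη.abs_sub_le hs ht
      have b2 := hη.acceleration s hs t ht
      rw [h3] at b1
      rw [h4] at b2
      rw [Prod.norm_mk, h1, h2, Real.norm_eq_abs, Real.norm_eq_abs, abs_sub_comm,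
        abs_sub_comm (0 : ℝ)]
      refine max_le ?_ ?_ <;> nlinarith [abs_nonneg (t - s)]
    calc _ ≤ (L + M) * |t - s| * Real.exp ((1 + L) * T) := by gcongr
      _ = C * |t - s| := by ring
  have hch : ∀ t, ∃ γ : CadlagPath T, t ∈ A → IsRegularPath p L M γ ∧ γ.toReal t = c ∧
      γ.velocity t = 0 := by
    intro t
    by_cases h : t ∈ A
    · obtain ⟨_, γ, hγ⟩ := h
      exact ⟨γ, fun _ => hγ⟩
    · by_cases hT : ∃ γ : CadlagPath T, True
      · obtain ⟨γ, -⟩ := hT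
        exact ⟨γ, fun h' => absurd h' h⟩
      · exact ⟨⟨fun _ => 0, fun t => ⟨continuousWithinAt_const, 0, tendsto_const_nhds⟩⟩,
          fun h' => absurd h' h⟩
  choose g hg using hch
  let f : ℝ → ℝ × ℝ := fun t => ((g t).toReal T, (g t).velocity T)
  have hlip : LipschitzOnWith ⟨C, hC0⟩ f A := by
    refine LipschitzOnWith.of_dist_le_mul fun t ht s hs => ?_
    rw [Real.dist_eq]
    exact hone _ _ (hg t ht).1 (hg s hs).1 s hs.1 t ht.1 (hg t ht).2.1 (hg t ht).2.2 (hg s hs).2.1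
      (hg s hs).2.2
  -- A Lipschitz image of a subset of the line has dimension at most one, hence is null in the
  -- plane.
  have hzero : volume (f '' A) = 0 := by
    rw [← hausdorffMeasure_prod_real]
    refine measure_zero_of_dimH_lt (d := 2) Measure.AbsolutelyContinuous.rfl ?_
    calc dimH (f '' A) ≤ dimH A := hlip.dimH_image_le
      _ ≤ dimH (univ : Set ℝ) := dimH_mono (subset_univ _)
      _ < 2 := by rw [Real.dimH_univ]; norm_num
  refine measure_mono_null ?_ hzero
  rintro q ⟨γ, hγ, ⟨t, ht, h1, h2⟩, rfl⟩
  have htA : t ∈ A := ⟨ht, γ, hγ, h1, h2⟩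
  refine ⟨t, htA, ?_⟩
  -- With equal contact times the Lipschitz estimate becomes uniqueness: `γ` ends where the chosen
  -- path ends.
  have := hone _ _ (hg t htA).1 hγ t ht t ht (hg t htA).2.1 (hg t htA).2.2 h1 h2
  rw [sub_self, abs_zero, mul_zero] at this
  exact dist_le_zero.1 this

/-- A contact with the boundary is an extremum of the path, and at an interior time the derivative
vanishes there. -/
lemma IsNewtonPath.velocity_eq_zero {γ : CadlagPath T} (h : IsNewtonPath p γ) {t : ℝ}
    (ht : t ∈ Ioo 0 T) (hc : γ.toReal t = 0 ∨ γ.toReal t = 1) : γ.velocity t = 0 := by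
  have hd : HasDerivAt γ.toReal (γ.velocity t) t :=
    (h t (Ioo_subset_Icc_self ht)).1.hasDerivAt (Icc_mem_nhds ht.1 ht.2)
  rcases hc with hc | hc
  · refine IsLocalMin.hasDerivAt_eq_zero (Eventually.of_forall fun s => ?_) hd
    rw [hc]; exact (γ.toReal_mem s).1
  · refine IsLocalMax.hasDerivAt_eq_zero (Eventually.of_forall fun s => ?_) hd
    rw [hc]; exact (γ.toReal_mem s).2

/-- Almost every path stays away from the boundary. -/
lemma ae_forall_mem_Ioo (hT : 0 < T) (hπ : IsGeneralizedEulerSolution π p)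
    (hρ : IsPhaseDensity π ρ) (hreg : RegularityAssumptions T p ρ) {L M : ℝ} (hL0 : 0 ≤ L)
    (hM0 : 0 ≤ M) (hL : ∀ t ∈ Icc 0 T, ∀ x ∈ Icc (0 : ℝ) 1, ∀ y ∈ Icc (0 : ℝ) 1,
      |pressureGradient p t x - pressureGradient p t y| ≤ L * |x - y|)
    (hR : ∀ᵐ γ ∂π, IsRegularPath p L M γ) :
    ∀ᵐ γ ∂π, ∀ t ∈ Icc 0 T, γ.toReal t ∈ Ioo (0 : ℝ) 1 := by
  -- This serves the times `0` and `T`, where an extremum does not force zero velocity; the uniform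
  -- marginals exclude the boundary there.
  have hend : ∀ t ∈ Icc 0 T, ∀ᵐ γ ∂π, γ.toReal t ∈ Ioo (0 : ℝ) 1 := by
    intro t ht
    have h := ae_mem_Ioo
    rw [← hπ.isPermutonProcess.uniform_marginals ⟨t, ht⟩] at h
    filter_upwards [ae_of_ae_map (CadlagPath.measurable_eval _).aemeasurable h] with γ hγ
    rwa [γ.toReal_of_mem ht]
  have hTm : T ∈ Icc 0 T := ⟨hT.le, le_rfl⟩
  have hrest : ∀ c : ℝ, ∀ᵐ γ ∂π, IsRegularPath p L M γ →
      ¬ ∃ t ∈ Icc 0 T, γ.toReal t = c ∧ γ.velocity t = 0 := by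
    intro c
    have h0 := volume_endpoints_eq_zero (T := T) (p := p) hL0 hM0 hL c
    have h1 : phaseLaw π T ≪ volume := by
      rw [hρ.density T hTm]
      exact (withDensity_absolutelyContinuous _ _).trans 
        Measure.restrict_le_self.absolutelyContinuous
    have h2 := ae_of_ae_map (aemeasurable_phase hρ hreg hTm) (measure_eq_zero_iff_ae_notMem.1 (h1 h0))
    filter_upwards [h2] with γ hγ hr hex
    exact hγ ⟨γ, hr, hex, rfl⟩
  filter_upwards [hR, hrest 0, hrest 1, hend 0 ⟨le_rfl, hT.le⟩, hend T hTm] with γ hγ h0 h1 ha hb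
  intro t ht
  by_contra hout
  have hc : γ.toReal t = 0 ∨ γ.toReal t = 1 := by
    have hm := γ.toReal_mem t
    by_contra! hne
    exact hout ⟨lt_of_le_of_ne hm.1 hne.1.symm, lt_of_le_of_ne hm.2 hne.2⟩
  have hti : t ∈ Ioo 0 T := by
    refine ⟨lt_of_le_of_ne ht.1 ?_, lt_of_le_of_ne ht.2 ?_⟩
    · rintro rfl; exact hout ha
    · rintro rfl; exact hout hb
  have hv := hγ.newton.velocity_eq_zero hti hc
  rcases hc with hc | hc
  · exact h0 hγ ⟨t, ht, hc, hv⟩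
  · exact h1 hγ ⟨t, ht, hc, hv⟩

/-- The set of paths that come closer than `ε` to the boundary. -/
def nearBoundary (T ε : ℝ) : Set (CadlagPath T) :=
  {γ | ∀ t ∈ Icc 0 T, γ.toReal t ∈ Icc ε (1 - ε)}ᶜ

lemma measurableSet_nearBoundary (hT : 0 < T) (ε : ℝ) : MeasurableSet (nearBoundary T ε) :=
  (measurableSet_forall_toReal_mem hT isClosed_Icc).compl

/-- A continuous path on a compact interval that avoids the boundary keeps a positive distance from
it, so dominated convergence applies. -/
lemma tendsto_measure_nearBoundary [IsProbabilityMeasure π] (hT : 0 < T)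
    (hc : ∀ᵐ γ ∂π, ContinuousOn γ.toReal (Icc 0 T))
    (h : ∀ᵐ γ ∂π, ∀ t ∈ Icc 0 T, γ.toReal t ∈ Ioo (0 : ℝ) 1) :
    Tendsto (fun β => π (nearBoundary T (2 * β))) (𝓝[>] 0) (𝓝 0) := by
  have key := tendsto_lintegral_filter_of_dominated_convergence (μ := π) (l := 𝓝[>] (0 : ℝ))
    (F := fun β => (nearBoundary T (2 * β)).indicator 1) (f := fun _ => 0) (fun _ => 1)
    (Eventually.of_forall fun β => measurable_one.indicator (measurableSet_nearBoundary hT _))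
    (Eventually.of_forall fun β => ae_of_all _ fun γ => indicator_le_self _ _ γ) (by simp) ?_
  · simpa [lintegral_indicator_one, measurableSet_nearBoundary hT] using key
  · filter_upwards [hc, h] with γ hγc hγ
    have hne : (Icc 0 T).Nonempty := ⟨0, le_rfl, hT.le⟩
    obtain ⟨a, ha, hamin⟩ := isCompact_Icc.exists_isMinOn hne hγc
    obtain ⟨b, hb, hbmax⟩ := isCompact_Icc.exists_isMaxOn hne hγc
    have h1 := (hγ a ha).1
    have h2 := (hγ b hb).2
    have hpos : 0 < min (γ.toReal a) (1 - γ.toReal b) := lt_min h1 (by linarith)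
    refine tendsto_const_nhds.congr' ?_
    filter_upwards [Ioo_mem_nhdsGT (half_pos hpos)] with β hβ
    rw [indicator_of_notMem]
    simp only [nearBoundary, mem_compl_iff, not_not, mem_ofPred_eq]
    intro t ht
    have e1 := min_le_left (γ.toReal a) (1 - γ.toReal b)
    have e2 := min_le_right (γ.toReal a) (1 - γ.toReal b)
    have e3 : γ.toReal a ≤ γ.toReal t := hamin ht
    have e4 : γ.toReal t ≤ γ.toReal b := hbmax ht
    constructor <;> linarith [hβ.2]

end Newton


/-! ### Smooth velocity fields on the closed box and their color velocity. -/

/-- Differentiation under the integral sign, within a set, for a Lipschitz integrand. -/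
lemma hasDerivWithinAt_integral_of_lipschitz {α : Type*} [MeasurableSpace α] {μ : Measure α}
    [IsFiniteMeasure μ] {F : ℝ → α → ℝ} {F' : α → ℝ} {s : Set ℝ} {t₀ C : ℝ} (ht₀ : t₀ ∈ s)
    (hint : ∀ t ∈ s, Integrable (F t) μ)
    (hlip : ∀ t ∈ s, ∀ᵐ a ∂μ, |F t a - F t₀ a| ≤ C * |t - t₀|)
    (hd : ∀ᵐ a ∂μ, HasDerivWithinAt (fun t => F t a) (F' a) s t₀) :
    HasDerivWithinAt (fun t => ∫ a, F t a ∂μ) (∫ a, F' a ∂μ) s t₀ := by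
  rw [hasDerivWithinAt_iff_tendsto_slope]
  have key : Tendsto (fun t => ∫ a, slope (fun t => F t a) t₀ t ∂μ) (𝓝[s \ {t₀}] t₀)
      (𝓝 (∫ a, F' a ∂μ)) := by
    refine tendsto_integral_filter_of_dominated_convergence (fun _ => C) ?_ ?_
      (integrable_const _) ?_
    · filter_upwards [self_mem_nhdsWithin] with t ht
      exact ((((hint t ht.1).sub (hint t₀ ht₀)).const_mul _).aestronglyMeasurable)
    · filter_upwards [self_mem_nhdsWithin] with t ht
      filter_upwards [hlip t ht.1] with a ha
      rw [slope_def_field, Real.norm_eq_abs, abs_div,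
        div_le_iff₀ (abs_pos.2 (sub_ne_zero.2 ht.2))]
      exact ha
    · filter_upwards [hd] with a ha using hasDerivWithinAt_iff_tendsto_slope.1 ha
  refine key.congr' ?_
  filter_upwards [self_mem_nhdsWithin] with t ht
  simp only [slope_def_field]
  rw [integral_div, integral_sub (hint t ht.1) (hint t₀ ht₀)]

/-- The domain `[0,T] × [0,1]²` of the velocity fields. -/
def fieldBox (T : ℝ) : Set (ℝ × ℝ × ℝ) := Icc 0 T ×ˢ Icc 0 1 ×ˢ Icc 0 1

lemma isCompact_fieldBox (T : ℝ) : IsCompact (fieldBox T) :=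
  isCompact_Icc.prod (isCompact_Icc.prod isCompact_Icc)

/-- The nearest point of `fieldBox T`. -/
noncomputable def clampBox (T : ℝ) (q : ℝ × ℝ × ℝ) : ℝ × ℝ × ℝ :=
  (max 0 (min T q.1), max 0 (min 1 q.2.1), max 0 (min 1 q.2.2))

lemma continuous_clampBox (T : ℝ) : Continuous (clampBox T) := by
  unfold clampBox; fun_prop

lemma clampBox_mem {T : ℝ} (hT : 0 ≤ T) (q : ℝ × ℝ × ℝ) : clampBox T q ∈ fieldBox T :=
  ⟨⟨le_max_left _ _, max_le hT (min_le_left _ _)⟩,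
    ⟨le_max_left _ _, max_le zero_le_one (min_le_left _ _)⟩,
    ⟨le_max_left _ _, max_le zero_le_one (min_le_left _ _)⟩⟩

lemma clampBox_of_mem {T : ℝ} {q : ℝ × ℝ × ℝ} (hq : q ∈ fieldBox T) : clampBox T q = q := by
  obtain ⟨h1, h2, h3⟩ := hq
  simp only [clampBox, min_eq_right h1.2, max_eq_right h1.1, min_eq_right h2.2, max_eq_right h2.1,
    min_eq_right h3.2, max_eq_right h3.1]

/-- The continuous functions `u`, `ut`, `ux`, `uφ` extend `w` and its partial derivatives from
`fieldBox T`. -/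
structure IsFieldExtension (T : ℝ) (w : ℝ → ℝ → ℝ → ℝ) (u ut ux uφ : ℝ × ℝ × ℝ → ℝ) : Prop where
  cont : Continuous u
  cont_t : Continuous ut
  cont_x : Continuous ux
  cont_φ : Continuous uφ
  eq : ∀ q ∈ fieldBox T, w q.1 q.2.1 q.2.2 = u q
  chain : ∀ (s : Set ℝ) (a b c : ℝ → ℝ) (a' b' c' r : ℝ),
    (∀ y ∈ s, (a y, b y, c y) ∈ fieldBox T) → r ∈ s → HasDerivWithinAt a a' s r →
    HasDerivWithinAt b b' s r → HasDerivWithinAt c c' s r →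
    HasDerivWithinAt (fun y => w (a y) (b y) (c y))
      (a' * ut (a r, b r, c r) + b' * ux (a r, b r, c r) + c' * uφ (a r, b r, c r)) s r

/-- Field and partial derivatives are composed with the projection onto the box. The results are
continuous on the whole space, while differentiation is only claimed along curves inside the box. -/
lemma exists_isFieldExtension {T : ℝ} (hT : 0 < T) {w : ℝ → ℝ → ℝ → ℝ}
    (hw : ContDiffOn ℝ 1 (fun q : ℝ × ℝ × ℝ => w q.1 q.2.1 q.2.2) (fieldBox T)) :
    ∃ u ut ux uφ : ℝ × ℝ × ℝ → ℝ, IsFieldExtension T w u ut ux uφ := by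
  have hu : UniqueDiffOn ℝ (fieldBox T) := (uniqueDiffOn_Icc hT).prod
    ((uniqueDiffOn_Icc zero_lt_one).prod (uniqueDiffOn_Icc zero_lt_one))
  let f : ℝ × ℝ × ℝ → ℝ := fun q => w q.1 q.2.1 q.2.2
  let D : ℝ × ℝ × ℝ → (ℝ × ℝ × ℝ →L[ℝ] ℝ) := fun q =>
    fderivWithin ℝ f (fieldBox T) (clampBox T q)
  have hD : Continuous D := (hw.continuousOn_fderivWithin hu le_rfl).comp_continuous
    (continuous_clampBox T) (clampBox_mem hT.le)
  refine ⟨fun q => f (clampBox T q), fun q => D q (1, 0, 0), fun q => D q (0, 1, 0),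
    fun q => D q (0, 0, 1), ?_, ?_, ?_, ?_, ?_, ?_⟩
  · exact hw.continuousOn.comp_continuous (continuous_clampBox T) (clampBox_mem hT.le)
  · exact hD.clm_apply continuous_const
  · exact hD.clm_apply continuous_const
  · exact hD.clm_apply continuous_const
  · intro q hq
    simp only [clampBox_of_mem hq, f]
  · intro s a b c a' b' c' r hmem hr ha hb hc
    have hq := hmem r hr
    have hf : HasFDerivWithinAt f (D (a r, b r, c r)) (fieldBox T) (a r, b r, c r) := by
      simp only [D, clampBox_of_mem hq]
      exact (hw.differentiableOn one_ne_zero _ hq).hasFDerivWithinAt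
    have := hf.comp_hasDerivWithinAt r (ha.prodMk (hb.prodMk hc)) hmem
    have e : (a', b', c') = a' • ((1 : ℝ), (0 : ℝ), (0 : ℝ)) + b' • ((0 : ℝ), (1 : ℝ), (0 : ℝ))
        + c' • ((0 : ℝ), (0 : ℝ), (1 : ℝ)) := by simp
    rw [e, map_add, map_add, map_smul, map_smul, map_smul] at this
    exact this

namespace IsFieldExtension

variable {T : ℝ} {w : ℝ → ℝ → ℝ → ℝ} {u ut ux uφ : ℝ × ℝ × ℝ → ℝ}
  (h : IsFieldExtension T w u ut ux uφ)

include h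

lemma exists_bound : ∃ C > 0, ∀ q ∈ fieldBox T, |u q| ≤ C ∧ |ut q| ≤ C ∧ |ux q| ≤ C ∧ |uφ q| ≤ C := by
  obtain ⟨C, hC⟩ := (isCompact_fieldBox T).exists_bound_of_continuousOn
    ((h.cont.prodMk (h.cont_t.prodMk (h.cont_x.prodMk h.cont_φ))).continuousOn)
  refine ⟨max C 1, by positivity, fun q hq => ?_⟩
  have := (hC q hq).trans (le_max_left C 1)
  simp only [Prod.norm_mk, sup_le_iff, Real.norm_eq_abs] at this
  exact ⟨this.1, this.2.1, this.2.2.1, this.2.2.2⟩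

lemma hasDerivWithinAt_t {t x φ : ℝ} (hq : (t, x, φ) ∈ fieldBox T) :
    HasDerivWithinAt (fun s => w s x φ) (ut (t, x, φ)) (Icc 0 T) t := by
  have := h.chain (Icc 0 T) id (fun _ => x) (fun _ => φ) 1 0 0 t (fun y hy => ⟨hy, hq.2⟩) hq.1
    (hasDerivWithinAt_id _ _) (hasDerivWithinAt_const _ _ _) (hasDerivWithinAt_const _ _ _)
  simpa using this

lemma hasDerivWithinAt_x {t x φ : ℝ} (hq : (t, x, φ) ∈ fieldBox T) :
    HasDerivWithinAt (fun y => w t y φ) (ux (t, x, φ)) (Icc 0 1) x := by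
  have := h.chain (Icc 0 1) (fun _ => t) id (fun _ => φ) 0 1 0 x
    (fun y hy => ⟨hq.1, hy, hq.2.2⟩) hq.2.1
    (hasDerivWithinAt_const _ _ _) (hasDerivWithinAt_id _ _) (hasDerivWithinAt_const _ _ _)
  simpa using this

lemma hasDerivWithinAt_φ {t x φ : ℝ} (hq : (t, x, φ) ∈ fieldBox T) :
    HasDerivWithinAt (fun ψ => w t x ψ) (uφ (t, x, φ)) (Icc 0 1) φ := by
  have := h.chain (Icc 0 1) (fun _ => t) (fun _ => x) id 0 0 1 φ
    (fun y hy => ⟨hq.1, hq.2.1, hy⟩) hq.2.2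
    (hasDerivWithinAt_const _ _ _) (hasDerivWithinAt_const _ _ _) (hasDerivWithinAt_id _ _)
  simpa using this

end IsFieldExtension

/-- The velocity of the color as a globally continuous function. -/
noncomputable def colorExt (ux : ℝ × ℝ × ℝ → ℝ) (q : ℝ × ℝ × ℝ) : ℝ :=
  -∫ ψ in (0 : ℝ)..q.2.2, ux (q.1, q.2.1, ψ)

lemma continuous_colorExt {ux : ℝ × ℝ × ℝ → ℝ} (h : Continuous ux) : Continuous (colorExt ux) := by
  refine (intervalIntegral.continuous_parametric_intervalIntegral_of_continuous
    (f := fun q : ℝ × ℝ × ℝ => fun ψ => ux (q.1, q.2.1, ψ)) ?_ (by fun_prop)).neg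
  exact h.comp (by fun_prop)

/-- This is the identity `∂_φ R = -∂_x u`: the field `(u, R)` is divergence free. -/
lemma hasDerivAt_colorExt {ux : ℝ × ℝ × ℝ → ℝ} (h : Continuous ux) (t x φ : ℝ) :
    HasDerivAt (fun φ => colorExt ux (t, x, φ)) (-ux (t, x, φ)) φ := by
  have hc : Continuous fun ψ => ux (t, x, ψ) := h.comp (by fun_prop)
  exact (intervalIntegral.integral_hasDerivAt_right (hc.intervalIntegrable _ _)
    (hc.stronglyMeasurableAtFilter _ _) hc.continuousAt).neg

lemma IsFieldExtension.colorVelocity_eq {T : ℝ} {w : ℝ → ℝ → ℝ → ℝ} {u ut ux uφ : ℝ × ℝ × ℝ → ℝ}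
    (h : IsFieldExtension T w u ut ux uφ) {t x φ : ℝ} (hq : (t, x, φ) ∈ fieldBox T) :
    colorVelocity w t x φ = colorExt ux (t, x, φ) := by
  unfold colorVelocity colorExt
  congr 1
  refine intervalIntegral.integral_congr fun ψ hψ => ?_
  have hφ : φ ∈ Icc (0 : ℝ) 1 := hq.2.2
  rw [uIcc_of_le (show (0 : ℝ) ≤ φ from hφ.1)] at hψ
  exact (h.hasDerivWithinAt_x (t := t) (x := x) (φ := ψ) ⟨hq.1, hq.2.1, hψ.1, hψ.2.trans hφ.2⟩).derivWithin
    (uniqueDiffOn_Icc zero_lt_one x hq.2.1)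

/-- Differentiate the mean-zero condition in `x` under the integral. Hence no mass crosses the line
`φ = 1`. -/
lemma IsFieldExtension.colorExt_one {T : ℝ} {w : ℝ → ℝ → ℝ → ℝ} {u ut ux uφ : ℝ × ℝ × ℝ → ℝ}
    (h : IsFieldExtension T w u ut ux uφ) {t x : ℝ} (ht : t ∈ Icc 0 T) (hx : x ∈ Icc (0 : ℝ) 1)
    (hmean : ∀ x ∈ Icc (0 : ℝ) 1, ∫ ψ in (0 : ℝ)..1, w t x ψ = 0) :
    colorExt ux (t, x, 1) = 0 := by
  obtain ⟨C, hC0, hC⟩ := h.exists_bound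
  have hbox : ∀ y ∈ Icc (0 : ℝ) 1, ∀ ψ : unitInterval, (t, y, (ψ : ℝ)) ∈ fieldBox T :=
    fun y hy ψ => ⟨ht, hy, ψ.2⟩
  have key := hasDerivWithinAt_integral_of_lipschitz (μ := (volume : Measure unitInterval))
    (F := fun y ψ => w t y ψ) (F' := fun ψ => ux (t, x, ψ)) (s := Icc 0 1) (C := C) hx ?_ ?_ ?_
  · have h0 : HasDerivWithinAt (fun y => ∫ ψ : unitInterval, w t y ψ) 0 (Icc 0 1) x := by
      refine (hasDerivWithinAt_const x (Icc (0 : ℝ) 1) (0 : ℝ)).congr (fun y hy => ?_) ?_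
      · rw [integral_unitInterval_eq (fun ψ => w t y ψ), hmean y hy]
      · rw [integral_unitInterval_eq (fun ψ => w t x ψ), hmean x hx]
    have := (uniqueDiffOn_Icc zero_lt_one x hx).eq_deriv _ key h0
    rw [integral_unitInterval_eq (fun ψ => ux (t, x, ψ))] at this
    simp only [colorExt, this, neg_zero]
  · intro y hy
    have : (fun ψ : unitInterval => w t y ψ) = fun ψ : unitInterval => u (t, y, ψ) :=
      funext fun ψ => h.eq _ (hbox y hy ψ)
    rw [this]
    have hc : Continuous fun ψ : unitInterval => u (t, y, ψ) := h.cont.comp (by fun_prop)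
    exact hc.integrable_of_hasCompactSupport (HasCompactSupport.of_compactSpace _)
  · intro y hy
    refine ae_of_all _ fun ψ => ?_
    exact (convex_Icc (0 : ℝ) 1).norm_image_sub_le_of_norm_hasDerivWithin_le
      (fun r hr => h.hasDerivWithinAt_x (hbox r hr ψ)) (fun r hr => (hC _ (hbox r hr ψ)).2.2.1) hx hy
  · exact ae_of_all _ fun ψ => h.hasDerivWithinAt_x (hbox x hx ψ)


/-! ### Integration by parts on the unit square. -/

lemma integrable_of_continuous {f : unitInterval × unitInterval → ℝ} (hf : Continuous f) :
    Integrable f volume :=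
  hf.integrable_of_hasCompactSupport (HasCompactSupport.of_compactSpace _)

lemma integral_unitSquare_eq {f : ℝ → ℝ → ℝ} (hf : Continuous (Function.uncurry f)) :
    ∫ z : unitInterval × unitInterval, f z.1 z.2
      = ∫ x : unitInterval, ∫ φ in (0 : ℝ)..1, f x φ := by
  have hi := integrable_of_continuous (f := fun z => f z.1 z.2)
    (hf.comp (continuous_subtype_val.prodMap continuous_subtype_val))
  rw [Measure.volume_eq_prod] at hi ⊢
  rw [integral_prod _ hi]
  exact integral_congr_ae (ae_of_all _ fun x => integral_unitInterval_eq (f x))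

lemma integral_unitSquare_eq_symm {f : ℝ → ℝ → ℝ} (hf : Continuous (Function.uncurry f)) :
    ∫ z : unitInterval × unitInterval, f z.1 z.2
      = ∫ φ : unitInterval, ∫ x in (0 : ℝ)..1, f x φ := by
  have hi := integrable_of_continuous (f := fun z => f z.1 z.2)
    (hf.comp (continuous_subtype_val.prodMap continuous_subtype_val))
  rw [Measure.volume_eq_prod] at hi ⊢
  rw [integral_prod_symm _ hi]
  exact integral_congr_ae (ae_of_all _ fun φ => integral_unitInterval_eq fun x => f x φ)

section Parts

variable {T : ℝ} {w : ℝ → ℝ → ℝ → ℝ} {u ut ux uφ : ℝ × ℝ × ℝ → ℝ}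

lemma IsFieldExtension.hasDerivAt_u_x (h : IsFieldExtension T w u ut ux uφ) {t x φ : ℝ}
    (ht : t ∈ Icc 0 T) (hx : x ∈ Ioo (0 : ℝ) 1) (hφ : φ ∈ Icc (0 : ℝ) 1) :
    HasDerivAt (fun y => u (t, y, φ)) (ux (t, x, φ)) x := by
  have hx' := Ioo_subset_Icc_self hx
  refine HasDerivWithinAt.hasDerivAt (s := Icc 0 1) ?_ (Icc_mem_nhds hx.1 hx.2)
  exact (h.hasDerivWithinAt_x ⟨ht, hx', hφ⟩).congr (fun y hy => (h.eq _ ⟨ht, hy, hφ⟩).symm)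
    (h.eq _ ⟨ht, hx', hφ⟩).symm

lemma IsFieldExtension.hasDerivAt_u_φ (h : IsFieldExtension T w u ut ux uφ) {t x φ : ℝ}
    (ht : t ∈ Icc 0 T) (hx : x ∈ Icc (0 : ℝ) 1) (hφ : φ ∈ Ioo (0 : ℝ) 1) :
    HasDerivAt (fun ψ => u (t, x, ψ)) (uφ (t, x, φ)) φ := by
  have hφ' := Ioo_subset_Icc_self hφ
  refine HasDerivWithinAt.hasDerivAt (s := Icc 0 1) ?_ (Icc_mem_nhds hφ.1 hφ.2)
  exact (h.hasDerivWithinAt_φ ⟨ht, hx, hφ'⟩).congr (fun y hy => (h.eq _ ⟨ht, hx, hy⟩).symm)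
    (h.eq _ ⟨ht, hx, hφ'⟩).symm

/-- The field `(u, R)` is divergence free and tangent to the lines `φ = 0` and `φ = 1`: the
corresponding integration by parts for the test function `a(x) b(u)`. -/
lemma IsFieldExtension.integral_parts (h : IsFieldExtension T w u ut ux uφ) {t : ℝ}
    (ht : t ∈ Icc 0 T) (hmean : ∀ x ∈ Icc (0 : ℝ) 1, ∫ ψ in (0 : ℝ)..1, w t x ψ = 0)
    {a b g : ℝ → ℝ} (ha : ContDiff ℝ 1 a) (ha0 : a 0 = 0) (ha1 : a 1 = 0)
    (hb : ∀ v, HasDerivAt b (g v) v) (hg : Continuous g) :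
    ∫ z : unitInterval × unitInterval,
      (deriv a z.1 * (u (t, z.1, z.2) * b (u (t, z.1, z.2))) +
        a z.1 * (g (u (t, z.1, z.2)) * (u (t, z.1, z.2) * ux (t, z.1, z.2) +
          colorExt ux (t, z.1, z.2) * uφ (t, z.1, z.2)))) = 0 := by
  have hu := h.cont
  have hux := h.cont_x
  have huφ := h.cont_φ
  have hR := continuous_colorExt hux
  have hac := ha.continuous
  have ha' : Continuous (deriv a) := ha.continuous_deriv le_rfl
  have hbc : Continuous b := continuous_iff_continuousAt.2 fun v => (hb v).continuousAt
  -- Here `f₁ = ∂_x(a u b(u))` and `f₂ = ∂_φ(R b(u))`. In `f₁ + a f₂` the terms with `u_x b(u)`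
  -- cancel, and what remains is the integrand.
  let f₁ : ℝ → ℝ → ℝ := fun x φ => deriv a x * (u (t, x, φ) * b (u (t, x, φ))) +
    a x * (ux (t, x, φ) * b (u (t, x, φ)) + u (t, x, φ) * (g (u (t, x, φ)) * ux (t, x, φ)))
  let f₂ : ℝ → ℝ → ℝ := fun x φ => -ux (t, x, φ) * b (u (t, x, φ)) +
    colorExt ux (t, x, φ) * (g (u (t, x, φ)) * uφ (t, x, φ))
  have hf₁ : Continuous (Function.uncurry f₁) := by
    simp only [f₁, Function.uncurry_def]; fun_prop
  have hf₂ : Continuous (Function.uncurry f₂) := by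
    simp only [f₂, Function.uncurry_def]; fun_prop
  have hf₂' : Continuous (Function.uncurry fun x φ => a x * f₂ x φ) :=
    (hac.comp continuous_fst).mul hf₂
  have h1 : ∫ z : unitInterval × unitInterval, f₁ z.1 z.2 = 0 := by
    rw [integral_unitSquare_eq_symm hf₁]
    refine integral_eq_zero_of_ae (ae_of_all _ fun φ => ?_)
    change ∫ x in (0 : ℝ)..1, f₁ x φ = 0
    rw [intervalIntegral.integral_eq_sub_of_hasDerivAt_of_le zero_le_one
      (f := fun x => a x * (u (t, x, φ) * b (u (t, x, φ))))]
    · simp [ha0, ha1]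
    · exact Continuous.continuousOn (by fun_prop)
    · intro x hx
      have hd := h.hasDerivAt_u_x ht hx φ.2
      exact (ha.differentiable one_ne_zero x).hasDerivAt.mul (hd.mul ((hb _).comp x hd))
    · exact (hf₁.comp (by fun_prop : Continuous fun x : ℝ => (x, (φ : ℝ)))).intervalIntegrable _ _
  have h2 : ∫ z : unitInterval × unitInterval, a z.1 * f₂ z.1 z.2 = 0 := by
    rw [integral_unitSquare_eq hf₂']
    refine integral_eq_zero_of_ae (ae_of_all _ fun x => ?_)
    change ∫ φ in (0 : ℝ)..1, a x * f₂ x φ = 0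
    rw [intervalIntegral.integral_const_mul,
      intervalIntegral.integral_eq_sub_of_hasDerivAt_of_le zero_le_one
      (f := fun φ => colorExt ux (t, x, φ) * b (u (t, x, φ)))]
    · simp only [h.colorExt_one ht x.2 hmean]
      simp [colorExt]
    · exact Continuous.continuousOn (by fun_prop)
    · intro φ hφ
      have hd := h.hasDerivAt_u_φ ht x.2 hφ
      exact (hasDerivAt_colorExt hux t x φ).mul ((hb _).comp φ hd)
    · exact (hf₂.comp (by fun_prop : Continuous fun φ : ℝ => ((x : ℝ), φ))).intervalIntegrable _ _
  have i1 := integrable_of_continuous (f := fun z => f₁ z.1 z.2)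
    (hf₁.comp (continuous_subtype_val.prodMap continuous_subtype_val))
  have i2 := integrable_of_continuous (f := fun z => a z.1 * f₂ z.1 z.2)
    (hf₂'.comp (continuous_subtype_val.prodMap continuous_subtype_val))
  have h3 := integral_add i1 i2
  rw [h1, h2, add_zero] at h3
  rw [← h3]
  congr 1
  ext z
  simp only [f₁, f₂]
  ring

end Parts


/-! ### The Euler equation for the velocity field. -/

section Euler

variable {T : ℝ} {π : Measure (CadlagPath T)} {p : ℝ → ℝ → ℝ} {ρ : ℝ → ℝ → ℝ → ℝ}
  {W : ℝ → ℝ → ℝ → ℝ → ℝ} {u ut ux uφ : ℝ × ℝ × ℝ → ℝ} {L M β : ℝ}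

/-- The pressure gradient as a globally continuous function of the position. -/
noncomputable def pressureExt (p : ℝ → ℝ → ℝ) (t x : ℝ) : ℝ :=
  pressureGradient p t (projIcc 0 1 zero_le_one x)

lemma pressureExt_of_mem {t x : ℝ} (hx : x ∈ Icc (0 : ℝ) 1) :
    pressureExt p t x = pressureGradient p t x := by
  rw [pressureExt, projIcc_of_mem zero_le_one hx]

lemma continuous_pressureExt
    (hL : ∀ t ∈ Icc 0 T, ∀ x ∈ Icc (0 : ℝ) 1, ∀ y ∈ Icc (0 : ℝ) 1,
      |pressureGradient p t x - pressureGradient p t y| ≤ L * |x - y|) {t : ℝ} (ht : t ∈ Icc 0 T) :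
    Continuous (pressureExt p t) := by
  have h : ContinuousOn (pressureGradient p t) (Icc 0 1) := by
    refine (LipschitzOnWith.of_dist_le_mul (K := ⟨max L 0, le_max_right _ _⟩)
      fun x hx y hy => ?_).continuousOn
    rw [Real.dist_eq, Real.dist_eq]
    refine (hL t ht x hx y hy).trans ?_
    change L * |x - y| ≤ max L 0 * |x - y|
    gcongr
    exact le_max_left _ _
  exact h.comp_continuous (continuous_subtype_val.comp continuous_projIcc)
    fun x => (projIcc 0 1 zero_le_one x).2

/-- The expectations of `a(x) b(v)`, differentiated in time along the paths and along the field. -/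
lemma integral_test_eq [IsProbabilityMeasure π] (hT : 0 < T)
    (hρ : IsPhaseDensity π ρ) (hreg : RegularityAssumptions T p ρ) (hM0 : 0 ≤ M)
    (hL : ∀ t ∈ Icc 0 T, ∀ x ∈ Icc (0 : ℝ) 1, ∀ y ∈ Icc (0 : ℝ) 1,
      |pressureGradient p t x - pressureGradient p t y| ≤ L * |x - y|)
    (hR : ∀ᵐ γ ∂π, IsRegularPath p L M γ)
    (hW : IsBoundarySmoothing T (quantileVelocity ρ) W) (hβ : β ∈ Ioo (0 : ℝ) (1 / 4))
    (h : IsFieldExtension T (W β) u ut ux uφ) {t : ℝ} (ht : t ∈ Icc 0 T)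
    {a b g : ℝ → ℝ} (ha : ContDiff ℝ 1 a) (hac : HasCompactSupport a)
    (has : tsupport a ⊆ Ioo β (1 - β)) (hb : ∀ v, HasDerivAt b (g v) v) (hb0 : b 0 = 0)
    (hg : Continuous g) {H : ℝ} (hH : ∀ v, |g v| ≤ H) :
    ∫ z : unitInterval × unitInterval,
      (deriv a z.1 * (u (t, z.1, z.2) * b (u (t, z.1, z.2))) -
        a z.1 * (g (u (t, z.1, z.2)) * pressureExt p t z.1)) =
    ∫ z : unitInterval × unitInterval, a z.1 * (g (u (t, z.1, z.2)) * ut (t, z.1, z.2)) := by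
  have hbc : Continuous b := continuous_iff_continuousAt.2 fun v => (hb v).continuousAt
  have ha' : Continuous (deriv a) := ha.continuous_deriv le_rfl
  have hP := continuous_pressureExt hL ht
  have hu := h.cont
  have hut := h.cont_t
  have haC := ha.continuous
  have hH0 : 0 ≤ H := (abs_nonneg _).trans (hH 0)
  obtain ⟨A, hA⟩ := haC.bounded_above_of_compact_support hac
  obtain ⟨A', hA'⟩ := ha'.bounded_above_of_compact_support hac.deriv
  obtain ⟨C, hC0, hC⟩ := h.exists_bound
  have hA0 : 0 ≤ A := (norm_nonneg _).trans (hA 0)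
  have hA'0 : 0 ≤ A' := (norm_nonneg _).trans (hA' 0)
  have hblip : ∀ v v', |b v - b v'| ≤ H * |v - v'| := fun v v' =>
    convex_univ.norm_image_sub_le_of_norm_hasDerivWithin_le
      (fun r _ => (hb r).hasDerivWithinAt) (fun r _ => hH r) (mem_univ _) (mem_univ _)
  have halip : ∀ x x', |a x - a x'| ≤ A' * |x - x'| := fun x x' =>
    convex_univ.norm_image_sub_le_of_norm_hasDerivWithin_le
      (fun r _ => (ha.differentiable one_ne_zero r).hasDerivAt.hasDerivWithinAt)
      (fun r _ => hA' r) (mem_univ _) (mem_univ _)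
  have hfield : ∀ s ∈ Icc 0 T, ∀ z : unitInterval × unitInterval, (z.1 : ℝ) ∈ tsupport a →
      -- On the support of `a` the smoothing has not modified the quantile velocity; elsewhere the
      -- test function vanishes.
      (phasePoint ρ s z).2 = u (s, z.1, z.2) := by
    intro s hs z hz
    have hx := Ioo_subset_Icc_self (has hz)
    rw [← h.eq (s, z.1, z.2) ⟨hs, z.1.2, z.2.2⟩]
    exact (hW.eq_inside β hβ s hs z.1 hx z.2 z.2.2).symm
  have hval : ∀ s ∈ Icc 0 T, ∫ γ, a (γ.toReal s) * b (γ.velocity s) ∂π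
      = ∫ z : unitInterval × unitInterval, a z.1 * b (u (s, z.1, z.2)) := by
    intro s hs
    rw [integral_phase_eq hρ hreg hs (f := fun q => a q.1 * b q.2)
      (Continuous.measurable (by fun_prop))]
    congr 1
    ext z
    by_cases hz : (z.1 : ℝ) ∈ tsupport a
    · rw [hfield s hs z hz]; rfl
    · have : a (phasePoint ρ s z).1 = 0 := image_eq_zero_of_notMem_tsupport hz
      rw [this, image_eq_zero_of_notMem_tsupport hz, zero_mul, zero_mul]
  have hpath := hasDerivWithinAt_integral_of_lipschitz (μ := π) (s := Icc 0 T) (t₀ := t)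
    (C := A' * M * (H * M) + A * (H * L))
    (F := fun s γ => a (γ.toReal s) * b (γ.velocity s))
    (F' := fun γ => deriv a (γ.toReal t) * γ.velocity t * b (γ.velocity t) +
      a (γ.toReal t) * (g (γ.velocity t) * -pressureGradient p t (γ.toReal t))) ht ?_ ?_ ?_
  · have hsq := hasDerivWithinAt_integral_of_lipschitz
      (μ := (volume : Measure (unitInterval × unitInterval))) (s := Icc 0 T) (t₀ := t)
      (C := A * (H * C))
      (F := fun s z => a z.1 * b (u (s, z.1, z.2)))
      (F' := fun z => a z.1 * (g (u (t, z.1, z.2)) * ut (t, z.1, z.2))) ht ?_ ?_ ?_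
    · have heq := (uniqueDiffOn_Icc hT t ht).eq_deriv _
        (hpath.congr (fun s hs => (hval s hs).symm) (hval t ht).symm) hsq
      rw [← heq]
      have e1 : ∀ γ : CadlagPath T, deriv a (γ.toReal t) * γ.velocity t * b (γ.velocity t) +
          a (γ.toReal t) * (g (γ.velocity t) * -pressureGradient p t (γ.toReal t)) =
          (fun q : ℝ × ℝ => deriv a q.1 * (q.2 * b q.2) - a q.1 * (g q.2 * pressureExt p t q.1))
            (γ.toReal t, γ.velocity t) := by
        intro γ
        simp only [pressureExt_of_mem (γ.toReal_mem t)]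
        ring
      simp only [e1]
      rw [integral_phase_eq hρ hreg ht (f := fun q => deriv a q.1 * (q.2 * b q.2) -
        a q.1 * (g q.2 * pressureExt p t q.1)) (Continuous.measurable (by fun_prop))]
      congr 1
      ext z
      by_cases hz : (z.1 : ℝ) ∈ tsupport a
      · simp only [hfield t ht z hz]; rfl
      · have h1 : a z.1 = 0 := image_eq_zero_of_notMem_tsupport hz
        have h2 : deriv a z.1 = 0 :=
          image_eq_zero_of_notMem_tsupport fun h' => hz (tsupport_deriv_subset h')
        have h3 : (phasePoint ρ t z).1 = z.1 := rfl
        simp only [h1, h2, h3, zero_mul]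
    · intro s hs
      exact integrable_of_continuous (by fun_prop)
    · intro s hs
      refine ae_of_all _ fun z => ?_
      rw [← mul_sub, abs_mul, mul_assoc]
      refine mul_le_mul (hA _) ?_ (abs_nonneg _) hA0
      refine (hblip _ _).trans ?_
      rw [mul_assoc]
      gcongr
      rw [← h.eq (s, z.1, z.2) ⟨hs, z.1.2, z.2.2⟩, ← h.eq (t, z.1, z.2) ⟨ht, z.1.2, z.2.2⟩]
      exact (convex_Icc (0 : ℝ) T).norm_image_sub_le_of_norm_hasDerivWithin_le
        (fun r hr => h.hasDerivWithinAt_t (x := z.1) (φ := z.2) ⟨hr, z.1.2, z.2.2⟩)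
        (fun r hr => (hC (r, z.1, z.2) ⟨hr, z.1.2, z.2.2⟩).2.1) ht hs
    · refine ae_of_all _ fun z => ?_
      have hd : HasDerivWithinAt (fun s => u (s, z.1, z.2)) (ut (t, z.1, z.2)) (Icc 0 T) t :=
        (h.hasDerivWithinAt_t ⟨ht, z.1.2, z.2.2⟩).congr
          (fun s hs => (h.eq (s, z.1, z.2) ⟨hs, z.1.2, z.2.2⟩).symm)
          (h.eq (t, z.1, z.2) ⟨ht, z.1.2, z.2.2⟩).symm
      exact ((hb _).comp_hasDerivWithinAt t hd).const_mul _
  · intro s hs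
    refine Integrable.of_bound (AEMeasurable.aestronglyMeasurable ?_) (A * (H * M)) ?_
    · exact (haC.measurable.comp_aemeasurable (CadlagPath.measurable_toReal s).aemeasurable).mul
        (hbc.measurable.comp_aemeasurable (aemeasurable_velocity hρ hreg hs))
    · filter_upwards [hR] with γ hγ
      rw [norm_mul]
      refine mul_le_mul (hA _) ?_ (norm_nonneg _) hA0
      have := hblip (γ.velocity s) 0
      rw [hb0, sub_zero, sub_zero] at this
      exact this.trans (by gcongr; exact hγ.speed s hs)
  · intro s hs
    filter_upwards [hR] with γ hγ
    have e : a (γ.toReal s) * b (γ.velocity s) - a (γ.toReal t) * b (γ.velocity t) =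
        (a (γ.toReal s) - a (γ.toReal t)) * b (γ.velocity s) +
          a (γ.toReal t) * (b (γ.velocity s) - b (γ.velocity t)) := by ring
    rw [e]
    have h1 : |a (γ.toReal s) - a (γ.toReal t)| ≤ A' * (M * |s - t|) :=
      (halip _ _).trans (by gcongr; exact hγ.abs_sub_le ht hs)
    have h2 : |b (γ.velocity s) - b (γ.velocity t)| ≤ H * (L * |s - t|) :=
      (hblip _ _).trans (by gcongr; exact hγ.acceleration t ht s hs)
    have h3 : |b (γ.velocity s)| ≤ H * M := by
      have := hblip (γ.velocity s) 0
      rw [hb0, sub_zero, sub_zero] at this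
      exact this.trans (by gcongr; exact hγ.speed s hs)
    refine (abs_add_le _ _).trans ?_
    rw [abs_mul, abs_mul]
    have h4 := mul_le_mul h1 h3 (abs_nonneg _) (by positivity)
    have h5 := mul_le_mul (hA (γ.toReal t)) h2 (abs_nonneg _) hA0
    rw [Real.norm_eq_abs] at h5
    linarith
  · filter_upwards [hR] with γ hγ
    have h1 := (hγ.newton t ht).1
    have h2 := (hγ.newton t ht).2
    exact ((ha.differentiable one_ne_zero _).hasDerivAt.comp_hasDerivWithinAt t h1).mul
      ((hb _).comp_hasDerivWithinAt t h2)

/-- The defect of the Euler equation for the velocity field. -/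
noncomputable def eulerDefect (p : ℝ → ℝ → ℝ) (u ut ux uφ : ℝ × ℝ × ℝ → ℝ) (t x φ : ℝ) : ℝ :=
  ut (t, x, φ) + (u (t, x, φ) * ux (t, x, φ) + colorExt ux (t, x, φ) * uφ (t, x, φ)) +
    pressureExt p t x

/-- The Euler equation for the velocity field, away from the boundary. -/
lemma eulerDefect_eq_zero [IsProbabilityMeasure π] (hT : 0 < T)
    (hρ : IsPhaseDensity π ρ) (hreg : RegularityAssumptions T p ρ) (hM0 : 0 ≤ M)
    (hL : ∀ t ∈ Icc 0 T, ∀ x ∈ Icc (0 : ℝ) 1, ∀ y ∈ Icc (0 : ℝ) 1,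
      |pressureGradient p t x - pressureGradient p t y| ≤ L * |x - y|)
    (hR : ∀ᵐ γ ∂π, IsRegularPath p L M γ)
    (hW : IsBoundarySmoothing T (quantileVelocity ρ) W) (hβ : β ∈ Ioo (0 : ℝ) (1 / 4))
    (h : IsFieldExtension T (W β) u ut ux uφ) {t x φ : ℝ} (ht : t ∈ Icc 0 T)
    (hx : x ∈ Ioo β (1 - β)) (hφ : φ ∈ Icc (0 : ℝ) 1) : eulerDefect p u ut ux uφ t x φ = 0 := by
  have hu := h.cont
  have hut := h.cont_t
  have hux := h.cont_x
  have huφ := h.cont_φ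
  have hcol := continuous_colorExt hux
  have hP := continuous_pressureExt hL ht
  have hD : Continuous (Function.uncurry (eulerDefect p u ut ux uφ t)) := by
    unfold eulerDefect
    simp only [Function.uncurry_def]
    fun_prop
  have hsub : Ioo β (1 - β) ⊆ Ioo 0 1 := Ioo_subset_Ioo hβ.1.le (by linarith [hβ.1])
  have hx01 : x ∈ Ioo (0 : ℝ) 1 := hsub hx
  -- the defect is orthogonal to every bounded continuous function of the velocity
  have horth : ∀ g : BoundedContinuousFunction ℝ ℝ, ∀ y ∈ Ioo β (1 - β),
      ∫ ψ in (0 : ℝ)..1, g (u (t, y, ψ)) * eulerDefect p u ut ux uφ t y ψ = 0 := by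
    intro g
    have hg : Continuous g := g.continuous
    let J : ℝ → ℝ := fun y => ∫ ψ in (0 : ℝ)..1, g (u (t, y, ψ)) * eulerDefect p u ut ux uφ t y ψ
    have hJint : Continuous (Function.uncurry fun y ψ : ℝ =>
        g (u (t, y, ψ)) * eulerDefect p u ut ux uφ t y ψ) :=
      (hg.comp (hu.comp (by fun_prop))).mul hD
    have hJ : Continuous J := intervalIntegral.continuous_parametric_intervalIntegral_of_continuous
      hJint continuous_const
    have hae := isOpen_Ioo.ae_eq_zero_of_integral_contDiff_smul_eq_zero (U := Ioo β (1 - β))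
      (μ := volume) (f := J) (hJ.locallyIntegrable.locallyIntegrableOn _) ?_
    · have hEq : EqOn J (fun _ => 0) (Ioo β (1 - β)) :=
        Measure.eqOn_open_of_ae_eq (μ := volume)
          ((ae_restrict_iff' measurableSet_Ioo).2 hae) isOpen_Ioo hJ.continuousOn continuousOn_const
      exact fun y hy => hEq hy
    · intro a ha hac has
      have ha1 : ContDiff ℝ 1 a := ha.of_le (by exact_mod_cast le_top)
      have haC := ha.continuous
      have hout : ∀ y, y ∉ Ioo (0 : ℝ) 1 → a y = 0 := fun y hy =>
        image_eq_zero_of_notMem_tsupport fun h' => hy (hsub (has h'))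
      -- The primitive of `g` makes `a(x) b(v)` an admissible test function. Adding the weak
      -- equation along paths and the integration by parts removes the terms in `b` and leaves `∫ a
      -- g(u) D = 0`.
      let b : ℝ → ℝ := fun v => ∫ r in (0 : ℝ)..v, g r
      have hb : ∀ v, HasDerivAt b (g v) v := fun v => hg.integral_hasStrictDerivAt 0 v |>.hasDerivAt
      have hbc : Continuous b := continuous_iff_continuousAt.2 fun v => (hb v).continuousAt
      have ha' : Continuous (deriv a) := ha1.continuous_deriv le_rfl
      have e1 := integral_test_eq hT hρ hreg hM0 hL hR hW hβ h ht ha1 hac has hb (by simp [b]) hg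
        g.norm_coe_le_norm
      have e2 := h.integral_parts ht (hW.mean_zero β hβ t ht) ha1 (hout 0 (by simp))
        (hout 1 (by simp)) hb hg
      have i1 : Integrable (fun z : unitInterval × unitInterval =>
          deriv a z.1 * (u (t, z.1, z.2) * b (u (t, z.1, z.2))) -
            a z.1 * (g (u (t, z.1, z.2)) * pressureExt p t z.1)) :=
        integrable_of_continuous (by fun_prop)
      have i2 : Integrable (fun z : unitInterval × unitInterval =>
          a z.1 * (g (u (t, z.1, z.2)) * ut (t, z.1, z.2))) :=
        integrable_of_continuous (by fun_prop)
      have i3 : Integrable (fun z : unitInterval × unitInterval =>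
          deriv a z.1 * (u (t, z.1, z.2) * b (u (t, z.1, z.2))) +
          a z.1 * (g (u (t, z.1, z.2)) * (u (t, z.1, z.2) * ux (t, z.1, z.2) +
            colorExt ux (t, z.1, z.2) * uφ (t, z.1, z.2)))) :=
        integrable_of_continuous (by fun_prop)
      have e3 := integral_add (i2.sub i1) i3
      rw [e2] at e3
      have e4 : ∫ z : unitInterval × unitInterval, (fun y ψ : ℝ =>
          a y * (g (u (t, y, ψ)) * eulerDefect p u ut ux uφ t y ψ)) z.1 z.2 = 0 := by
        have e5 := integral_sub i2 i1
        rw [e1, sub_self] at e5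
        simp only [Pi.sub_apply] at e3
        rw [e5, add_zero] at e3
        rw [← e3]
        congr 1
        ext z
        simp only [eulerDefect]
        ring
      have hJint' : Continuous (Function.uncurry fun y ψ : ℝ =>
          a y * (g (u (t, y, ψ)) * eulerDefect p u ut ux uφ t y ψ)) :=
        (haC.comp continuous_fst).mul hJint
      rw [integral_unitSquare_eq hJint'] at e4
      simp only [intervalIntegral.integral_const_mul] at e4
      rw [integral_unitInterval_eq (fun y => a y * J y),
        intervalIntegral.integral_of_le zero_le_one] at e4
      rw [← e4, eq_comm]
      simp only [smul_eq_mul]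
      refine setIntegral_eq_integral_of_forall_compl_eq_zero fun y hy => ?_
      rw [hout y fun h' => hy (Ioo_subset_Ioc_self h'), zero_mul]
  obtain ⟨M', hM0', hM'⟩ := hreg.exists_bound
  let e : unitInterval → ℝ := fun ψ => u (t, x, ψ)
  have hec : Continuous e := hu.comp (by fun_prop)
  have heinj : Function.Injective e := by
    have hV : ∀ ψ : unitInterval, e ψ = quantile (velocityCDF ρ t x) ψ := fun ψ => by
      change u (t, x, (ψ : ℝ)) = _
      rw [← h.eq (t, x, ψ) ⟨ht, Ioo_subset_Icc_self hx01, ψ.2⟩]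
      exact hW.eq_inside β hβ t ht x (Ioo_subset_Icc_self hx) ψ ψ.2
    intro ψ ψ' he
    rw [hV, hV] at he
    exact Subtype.ext ((hρ.isCompactCDF ht hx01 (hM' t ht _)).injOn_quantile ψ.2 ψ'.2 he)
  have hDc : Continuous fun ψ : ℝ => eulerDefect p u ut ux uφ t x ψ :=
    hD.comp (by fun_prop : Continuous fun ψ : ℝ => (x, ψ))
  let D : BoundedContinuousFunction unitInterval ℝ := BoundedContinuousFunction.mkOfCompact
    ⟨fun ψ => eulerDefect p u ut ux uφ t x ψ, hDc.comp continuous_subtype_val⟩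
  -- The map from color to velocity is an embedding of a compact interval, so by Tietze the defect
  -- is `g(u)` for a bounded continuous `g`. Testing with this `g` gives `∫ D² = 0`.
  obtain ⟨g, -, hg⟩ := BoundedContinuousFunction.exists_extension_norm_eq_of_isClosedEmbedding D
    (hec.isClosedEmbedding heinj)
  have hz := horth g x hx
  have hsq : ∫ ψ in (0 : ℝ)..1, (eulerDefect p u ut ux uφ t x ψ) ^ 2 = 0 := by
    refine Eq.trans ?_ hz
    refine intervalIntegral.integral_congr fun ψ hψ => ?_
    rw [uIcc_of_le zero_le_one] at hψ
    have := congrFun hg ⟨ψ, hψ⟩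
    change g (u (t, x, ψ)) = eulerDefect p u ut ux uφ t x ψ at this
    simp only [this, sq]
  by_contra hne
  exact (intervalIntegral.integral_pos zero_lt_one (hDc.pow 2).continuousOn
    (fun ψ _ => sq_nonneg _) ⟨φ, hφ, sq_pos_of_ne_zero hne⟩).ne' hsq

end Euler


/-! ### Flow lines with frozen time and their comparison with Newton paths. -/

/-- `(x, φ)` follows the field `(u, R)` on `[0,T]`, where the field is evaluated at the times
`σ t`. -/
structure IsFlowLine (T : ℝ) (u R : ℝ × ℝ × ℝ → ℝ) (σ x φ : ℝ → ℝ) : Prop where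
  time_mem : ∀ t ∈ Icc 0 T, σ t ∈ Icc 0 T
  mem_left : ∀ t ∈ Icc 0 T, x t ∈ Icc (0 : ℝ) 1
  mem_right : ∀ t ∈ Icc 0 T, φ t ∈ Icc (0 : ℝ) 1
  continuous_left : ContinuousOn x (Icc 0 T)
  continuous_right : ContinuousOn φ (Icc 0 T)
  deriv_left : ∀ t ∈ Ico 0 T, HasDerivWithinAt x (u (σ t, x t, φ t)) (Ici t) t
  deriv_right : ∀ t ∈ Ico 0 T, HasDerivWithinAt φ (R (σ t, x t, φ t)) (Ici t) t

/-- The last multiple of `δ` before the time `t`. -/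
noncomputable def frozenTime (δ t : ℝ) : ℝ := (⌊t / δ⌋₊ : ℝ) * δ

lemma frozenTime_le {δ t : ℝ} (hδ : 0 < δ) (ht : 0 ≤ t) : frozenTime δ t ≤ t := by
  have := Nat.floor_le (a := t / δ) (by positivity)
  rwa [le_div_iff₀ hδ] at this

lemma frozenTime_nonneg {δ t : ℝ} (hδ : 0 < δ) : 0 ≤ frozenTime δ t := by
  unfold frozenTime; positivity

lemma abs_frozenTime_sub_le {δ t : ℝ} (hδ : 0 < δ) (ht : 0 ≤ t) : |frozenTime δ t - t| ≤ δ := by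
  have h := Nat.lt_floor_add_one (t / δ)
  rw [div_lt_iff₀ hδ] at h
  have h2 := frozenTime_le hδ ht
  rw [abs_le]
  unfold frozenTime at *
  constructor <;> linarith

section Flow

variable {T : ℝ} {w : ℝ → ℝ → ℝ → ℝ} {u ut ux uφ R : ℝ × ℝ × ℝ → ℝ} {σ x φ : ℝ → ℝ}

lemma IsFieldExtension.isFlowLine_of_freezeTime (h : IsFieldExtension T w u ut ux uφ) {δ : ℝ}
    (hδ : 0 < δ) (hs : IsColorSolution T (freezeTime δ w) x φ) :
    IsFlowLine T u (colorExt ux) (frozenTime δ) x φ := by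
  have hmem : ∀ t ∈ Icc 0 T, frozenTime δ t ∈ Icc 0 T := fun t ht =>
    ⟨frozenTime_nonneg hδ, (frozenTime_le hδ ht.1).trans ht.2⟩
  refine ⟨hmem, hs.mem_left, hs.mem_right, hs.continuous_left, hs.continuous_right,
    fun t ht => ?_, fun t ht => ?_⟩
  all_goals
    have ht' := Ico_subset_Icc_self ht
    have hbox : (frozenTime δ t, x t, φ t) ∈ fieldBox T :=
      ⟨hmem t ht', hs.mem_left t ht', hs.mem_right t ht'⟩
  · rw [← h.eq _ hbox]
    exact hs.deriv_left t ht
  · rw [← h.colorVelocity_eq hbox]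
    exact hs.deriv_right t ht

lemma IsFieldExtension.isColorSolution_iff (h : IsFieldExtension T w u ut ux uφ) :
    IsColorSolution T w x φ ↔ IsFlowLine T u (colorExt ux) id x φ := by
  constructor
  · intro hs
    refine ⟨fun t ht => ht, hs.mem_left, hs.mem_right, hs.continuous_left, hs.continuous_right,
      fun t ht => ?_, fun t ht => ?_⟩
    all_goals
      have ht' := Ico_subset_Icc_self ht
      have hbox : (id t, x t, φ t) ∈ fieldBox T := ⟨ht', hs.mem_left t ht', hs.mem_right t ht'⟩
    · rw [← h.eq _ hbox]
      exact hs.deriv_left t ht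
    · rw [← h.colorVelocity_eq hbox]
      exact hs.deriv_right t ht
  · intro hs
    refine ⟨hs.mem_left, hs.mem_right, hs.continuous_left, hs.continuous_right,
      fun t ht => ?_, fun t ht => ?_⟩
    all_goals
      have ht' := Ico_subset_Icc_self ht
      have hbox : (id t, x t, φ t) ∈ fieldBox T := ⟨ht', hs.mem_left t ht', hs.mem_right t ht'⟩
    · have := hs.deriv_left t ht
      rwa [← h.eq _ hbox] at this
    · have := hs.deriv_right t ht
      rwa [← h.colorVelocity_eq hbox] at this

lemma IsFlowLine.mem_fieldBox (hs : IsFlowLine T u R σ x φ) {t r : ℝ} (ht : t ∈ Icc 0 T)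
    (hr : r ∈ Icc 0 T) : (r, x t, φ t) ∈ fieldBox T :=
  ⟨hr, hs.mem_left t ht, hs.mem_right t ht⟩

lemma IsFlowLine.abs_sub_le (hs : IsFlowLine T u R σ x φ) {C : ℝ}
    (hu : ∀ q ∈ fieldBox T, |u q| ≤ C) {s t : ℝ} (hs0 : s ∈ Icc 0 T) (ht : t ∈ Icc 0 T)
    (hst : s ≤ t) : |x t - x s| ≤ C * (t - s) := by
  refine norm_image_sub_le_of_norm_deriv_right_le_segment (a := s) (b := T)
    (f' := fun r => u (σ r, x r, φ r)) (hs.continuous_left.mono (Icc_subset_Icc_left hs0.1))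
    (fun r hr => hs.deriv_left r ⟨hs0.1.trans hr.1, hr.2⟩) (fun r hr => ?_) t ⟨hst, ht.2⟩
  have hr' : r ∈ Icc 0 T := ⟨hs0.1.trans hr.1, hr.2.le⟩
  exact hu _ (hs.mem_fieldBox hr' (hs.time_mem r hr'))

lemma IsFlowLine.abs_sub_le_right (hs : IsFlowLine T u R σ x φ) {C : ℝ}
    (hR : ∀ q ∈ fieldBox T, |R q| ≤ C) {s t : ℝ} (hs0 : s ∈ Icc 0 T) (ht : t ∈ Icc 0 T)
    (hst : s ≤ t) : |φ t - φ s| ≤ C * (t - s) := by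
  refine norm_image_sub_le_of_norm_deriv_right_le_segment (a := s) (b := T)
    (f' := fun r => R (σ r, x r, φ r)) (hs.continuous_right.mono (Icc_subset_Icc_left hs0.1))
    (fun r hr => hs.deriv_right r ⟨hs0.1.trans hr.1, hr.2⟩) (fun r hr => ?_) t ⟨hst, ht.2⟩
  have hr' : r ∈ Icc 0 T := ⟨hs0.1.trans hr.1, hr.2.le⟩
  exact hR _ (hs.mem_fieldBox hr' (hs.time_mem r hr'))

lemma exists_modulus {f : ℝ × ℝ × ℝ → ℝ} (hf : Continuous f) (T : ℝ) {ε : ℝ} (hε : 0 < ε) :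
    ∃ κ > 0, ∀ q ∈ fieldBox T, ∀ q' ∈ fieldBox T, dist q q' ≤ κ → |f q - f q'| ≤ ε := by
  have h := (isCompact_fieldBox T).uniformContinuousOn_of_continuous hf.continuousOn
  obtain ⟨κ, hκ, hκ'⟩ := Metric.uniformContinuousOn_iff_le.1 h ε hε
  exact ⟨κ, hκ, fun q hq q' hq' hd => hκ' q hq q' hq' hd⟩

/-- The velocity is read off at the true time `t`, where it is continuous along the flow line,
although the motion uses the frozen time `σ t`. -/
lemma IsFieldExtension.hasDerivWithinAt_along (h : IsFieldExtension T w u ut ux uφ)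
    (hs : IsFlowLine T u R σ x φ) {t : ℝ} (ht : t ∈ Ico 0 T) :
    HasDerivWithinAt (fun r => u (r, x r, φ r))
      (ut (t, x t, φ t) + u (σ t, x t, φ t) * ux (t, x t, φ t) +
        R (σ t, x t, φ t) * uφ (t, x t, φ t)) (Ici t) t := by
  have hsub : ∀ y ∈ Icc t T, y ∈ Icc 0 T := fun y hy => ⟨ht.1.trans hy.1, hy.2⟩
  have hbox : ∀ y ∈ Icc t T, (y, x y, φ y) ∈ fieldBox T := fun y hy =>
    hs.mem_fieldBox (hsub y hy) (hsub y hy)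
  have htt : t ∈ Icc t T := ⟨le_rfl, ht.2.le⟩
  have key := h.chain (Icc t T) id x φ 1 _ _ t hbox htt (hasDerivWithinAt_id _ _)
    ((hs.deriv_left t ht).mono Icc_subset_Ici_self) ((hs.deriv_right t ht).mono Icc_subset_Ici_self)
  have key2 := key.congr (f₁ := fun r => u (r, x r, φ r)) (fun y hy => (h.eq _ (hbox y hy)).symm)
    (h.eq _ (hbox t htt)).symm
  simpa using key2.Ici_of_Icc ⟨le_rfl, ht.2⟩

/-- A path that solves Newton's equation and stays away from the boundary is approximated by the
flow lines of the field with the same initial position and velocity. -/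
lemma IsFieldExtension.exists_forall_flowLine_close (h : IsFieldExtension T w u ut ux uφ)
    {p : ℝ → ℝ → ℝ} {L β η : ℝ} (hL0 : 0 ≤ L) (hβ : 0 < β) (hη : 0 < η)
    (hL : ∀ t ∈ Icc 0 T, ∀ x ∈ Icc (0 : ℝ) 1, ∀ y ∈ Icc (0 : ℝ) 1,
      |pressureGradient p t x - pressureGradient p t y| ≤ L * |x - y|)
    (hE : ∀ t ∈ Icc 0 T, ∀ x ∈ Ioo β (1 - β), ∀ φ ∈ Icc (0 : ℝ) 1,
      eulerDefect p u ut ux uφ t x φ = 0) :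
    ∃ κ > 0, ∀ σ x φ : ℝ → ℝ, (∀ t ∈ Icc 0 T, |σ t - t| ≤ κ) →
      IsFlowLine T u (colorExt ux) σ x φ → ∀ γ : CadlagPath T, IsNewtonPath p γ →
      (∀ t ∈ Icc 0 T, γ.toReal t ∈ Icc (2 * β) (1 - 2 * β)) → x 0 = γ.toReal 0 →
      u (0, x 0, φ 0) = γ.velocity 0 →
      ∀ t ∈ Icc 0 T, |x t - γ.toReal t| ≤ η ∧ |u (σ t, x t, φ t) - γ.velocity t| ≤ η := by
  obtain ⟨C, hC0, hC⟩ := h.exists_bound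
  -- An error of at most `m` keeps the flow line in `(β, 1 - β)` when the path is in `[2β, 1 - 2β]`.
  -- The barrier starts at `η₀ > 0` and grows at rate `2 + L` without exceeding `m`, and `ε` is the
  -- freezing error that its slope can absorb.
  set m : ℝ := min (η / 2) (β / 2) with hm
  have hm0 : 0 < m := lt_min (half_pos hη) (half_pos hβ)
  set η₀ : ℝ := m * Real.exp (-((2 + L) * T)) with hη₀
  have hη₀0 : 0 < η₀ := by positivity
  set ε : ℝ := min (η / 2) (η₀ / (2 + 2 * C)) with hε
  have hε0 : 0 < ε := lt_min (half_pos hη) (by positivity)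
  have hεη : (1 + 2 * C) * ε < η₀ := by
    have h1 : ε ≤ η₀ / (2 + 2 * C) := min_le_right _ _
    rw [le_div_iff₀ (by positivity)] at h1
    nlinarith
  obtain ⟨κ₁, hκ₁, hu⟩ := exists_modulus h.cont T hε0
  obtain ⟨κ₂, hκ₂, hR⟩ := exists_modulus (continuous_colorExt h.cont_x) T hε0
  refine ⟨min κ₁ κ₂, lt_min hκ₁ hκ₂, fun σ x φ hσ hs γ hγ hγβ hx0 hv0 => ?_⟩
  have hdist : ∀ t ∈ Icc 0 T, dist (σ t, x t, φ t) (t, x t, φ t) ≤ min κ₁ κ₂ := by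
    intro t ht
    rw [Prod.dist_eq]
    rw [dist_self]
    exact max_le (hσ t ht) (lt_min hκ₁ hκ₂).le
  have hu' : ∀ t ∈ Icc 0 T, |u (σ t, x t, φ t) - u (t, x t, φ t)| ≤ ε := fun t ht =>
    hu _ (hs.mem_fieldBox ht (hs.time_mem t ht)) _ (hs.mem_fieldBox ht ht)
      ((hdist t ht).trans (min_le_left _ _))
  have hR' : ∀ t ∈ Icc 0 T, |colorExt ux (σ t, x t, φ t) - colorExt ux (t, x t, φ t)| ≤ ε :=
    fun t ht => hR _ (hs.mem_fieldBox ht (hs.time_mem t ht)) _ (hs.mem_fieldBox ht ht)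
      ((hdist t ht).trans (min_le_right _ _))
  have hBm : ∀ t ∈ Icc 0 T, η₀ * Real.exp ((2 + L) * t) ≤ m := by
    intro t ht
    rw [hη₀, mul_assoc, ← Real.exp_add]
    refine mul_le_of_le_one_right hm0.le (Real.exp_le_one_iff.2 ?_)
    nlinarith [ht.2]
  -- The slope only has to be compared where the error equals the barrier. There the error is at
  -- most `m`, so the Euler equation is available although the flow line is not known beforehand to
  -- stay inside.
  have key := image_norm_le_of_norm_deriv_right_lt_deriv_boundary' (a := 0) (b := T)
    (f := fun r => (x r - γ.toReal r, u (r, x r, φ r) - γ.velocity r))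
    (f' := fun t => (u (σ t, x t, φ t) - γ.velocity t,
      (ut (t, x t, φ t) + u (σ t, x t, φ t) * ux (t, x t, φ t) +
        colorExt ux (σ t, x t, φ t) * uφ (t, x t, φ t)) - -pressureGradient p t (γ.toReal t)))
    (B := fun t => η₀ * Real.exp ((2 + L) * t))
    (B' := fun t => (2 + L) * (η₀ * Real.exp ((2 + L) * t))) ?_ ?_ ?_ ?_ ?_ ?_
  · intro t ht
    have h1 := (key ht).trans (hBm t ht)
    have h2 := (norm_fst_le (x t - γ.toReal t, u (t, x t, φ t) - γ.velocity t)).trans h1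
    have h3 := (norm_snd_le (x t - γ.toReal t, u (t, x t, φ t) - γ.velocity t)).trans h1
    rw [Real.norm_eq_abs] at h2 h3
    have h4 : m ≤ η / 2 := min_le_left _ _
    have h5 : ε ≤ η / 2 := min_le_left _ _
    refine ⟨by linarith, ?_⟩
    have h6 := abs_add_le (u (σ t, x t, φ t) - u (t, x t, φ t)) (u (t, x t, φ t) - γ.velocity t)
    rw [sub_add_sub_cancel] at h6
    linarith [hu' t ht]
  · refine (hs.continuous_left.sub hγ.continuousOn).prodMk (ContinuousOn.sub ?_
      hγ.continuousOn_velocity)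
    exact h.cont.comp_continuousOn (continuousOn_id.prodMk
      (hs.continuous_left.prodMk hs.continuous_right))
  · intro t ht
    have ht' := Ico_subset_Icc_self ht
    exact ((hs.deriv_left t ht).sub ((hγ t ht').1.Ici_of_Icc ht)).prodMk
      ((h.hasDerivWithinAt_along hs ht).sub ((hγ t ht').2.Ici_of_Icc ht))
  · simp only [hx0, sub_self]
    rw [hx0] at hv0
    rw [hv0, sub_self, Prod.norm_mk, norm_zero, max_self]
    positivity
  · exact Continuous.continuousOn (by fun_prop)
  · intro t _
    have hd : HasDerivAt (fun t : ℝ => (2 + L) * t) ((2 + L) * 1) t :=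
      (hasDerivAt_id t).const_mul (2 + L)
    have := (hd.exp.const_mul η₀).hasDerivWithinAt (s := Ici t)
    have e : η₀ * (Real.exp ((2 + L) * t) * ((2 + L) * 1)) =
        (2 + L) * (η₀ * Real.exp ((2 + L) * t)) := by ring
    rw [e] at this
    exact this
  · intro t ht heq
    have ht' := Ico_subset_Icc_self ht
    have hb := hBm t ht'
    have hone : 1 ≤ Real.exp ((2 + L) * t) := Real.one_le_exp (by nlinarith [ht.1])
    have hBlow : η₀ ≤ η₀ * Real.exp ((2 + L) * t) := by nlinarith
    set B := η₀ * Real.exp ((2 + L) * t)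
    have e1 : |x t - γ.toReal t| ≤ B := by
      rw [← heq]; exact norm_fst_le (x t - γ.toReal t, u (t, x t, φ t) - γ.velocity t)
    have e2 : |u (t, x t, φ t) - γ.velocity t| ≤ B := by
      rw [← heq]; exact norm_snd_le (x t - γ.toReal t, u (t, x t, φ t) - γ.velocity t)
    have hmβ : m ≤ β / 2 := min_le_right _ _
    have hxβ : x t ∈ Ioo β (1 - β) := by
      have := abs_le.1 e1
      have := hγβ t ht'
      constructor <;> linarith [this.1, this.2]
    have hdef := hE t ht' (x t) hxβ (φ t) (hs.mem_right t ht')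
    rw [eulerDefect, pressureExt_of_mem (hs.mem_left t ht')] at hdef
    have hp := hL t ht' _ (γ.toReal_mem t) _ (hs.mem_left t ht')
    have hCt := hC _ (hs.mem_fieldBox ht' ht')
    have hut := hu' t ht'
    have hRt := hR' t ht'
    rw [Prod.norm_mk, Real.norm_eq_abs, Real.norm_eq_abs]
    refine max_lt ?_ ?_
    · have h6 := abs_add_le (u (σ t, x t, φ t) - u (t, x t, φ t)) (u (t, x t, φ t) - γ.velocity t)
      rw [sub_add_sub_cancel] at h6
      nlinarith
    · have e3 : ut (t, x t, φ t) + u (σ t, x t, φ t) * ux (t, x t, φ t) +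
          colorExt ux (σ t, x t, φ t) * uφ (t, x t, φ t) - -pressureGradient p t (γ.toReal t) =
          (u (σ t, x t, φ t) - u (t, x t, φ t)) * ux (t, x t, φ t) +
          (colorExt ux (σ t, x t, φ t) - colorExt ux (t, x t, φ t)) * uφ (t, x t, φ t) +
          (pressureGradient p t (γ.toReal t) - pressureGradient p t (x t)) := by
        linear_combination hdef
      rw [e3]
      have b1 : |(u (σ t, x t, φ t) - u (t, x t, φ t)) * ux (t, x t, φ t)| ≤ ε * C := by
        rw [abs_mul]
        exact mul_le_mul hut hCt.2.2.1 (abs_nonneg _) hε0.le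
      have b2 : |(colorExt ux (σ t, x t, φ t) - colorExt ux (t, x t, φ t)) * uφ (t, x t, φ t)|
          ≤ ε * C := by
        rw [abs_mul]
        exact mul_le_mul hRt hCt.2.2.2 (abs_nonneg _) hε0.le
      have b3 : |pressureGradient p t (γ.toReal t) - pressureGradient p t (x t)| ≤ L * B := by
        rw [abs_sub_comm (γ.toReal t)] at hp
        exact hp.trans (by gcongr)
      have b4 := abs_add_three ((u (σ t, x t, φ t) - u (t, x t, φ t)) * ux (t, x t, φ t))
        ((colorExt ux (σ t, x t, φ t) - colorExt ux (t, x t, φ t)) * uφ (t, x t, φ t))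
        (pressureGradient p t (γ.toReal t) - pressureGradient p t (x t))
      nlinarith

/-- Two functions with right derivatives that are close have close increments. -/
lemma abs_increment_sub_le {f g f' g' : ℝ → ℝ} {η : ℝ} (hf : ContinuousOn f (Icc 0 T))
    (hg : ContinuousOn g (Icc 0 T)) (hf' : ∀ t ∈ Ico 0 T, HasDerivWithinAt f (f' t) (Ici t) t)
    (hg' : ∀ t ∈ Ico 0 T, HasDerivWithinAt g (g' t) (Ici t) t)
    (hfg : ∀ t ∈ Ico 0 T, |f' t - g' t| ≤ η) {s t : ℝ} (hs : s ∈ Icc 0 T) (ht : t ∈ Icc 0 T)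
    (hst : s ≤ t) : |(f t - f s) - (g t - g s)| ≤ η * (t - s) := by
  have key := norm_image_sub_le_of_norm_deriv_right_le_segment (a := s) (b := T)
    (f := fun r => f r - g r) (f' := fun r => f' r - g' r) (C := η)
    ((hf.sub hg).mono (Icc_subset_Icc_left hs.1))
    (fun r hr => (hf' r ⟨hs.1.trans hr.1, hr.2⟩).sub (hg' r ⟨hs.1.trans hr.1, hr.2⟩))
    (fun r hr => hfg r ⟨hs.1.trans hr.1, hr.2⟩) t ⟨hst, ht.2⟩
  rw [Real.norm_eq_abs, sub_sub_sub_comm] at key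
  exact key

end Flow


/-! ### The coupling through the initial color. -/

section Coupling

variable {T : ℝ} {π : Measure (CadlagPath T)} {p : ℝ → ℝ → ℝ} {ρ : ℝ → ℝ → ℝ → ℝ}
  {W : ℝ → ℝ → ℝ → ℝ → ℝ} {L M β : ℝ}

/-- The initial position and color of the paths: a uniform random variable that determines the
initial position and velocity. -/
lemma exists_initial_color (hT : 0 < T) (hρ : IsPhaseDensity π ρ)
    (hreg : RegularityAssumptions T p ρ) :
    ∃ Z : CadlagPath T → unitInterval × unitInterval, AEMeasurable Z π ∧ π.map Z = volume ∧
      ∀ᵐ γ ∂π, phasePoint ρ 0 (Z γ) = (γ.toReal 0, γ.velocity 0) := by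
  have h0 : (0 : ℝ) ∈ Icc 0 T := ⟨le_rfl, hT.le⟩
  obtain ⟨ζ, hζ, hζJ⟩ := exists_measurable_color hρ hreg h0
  obtain ⟨J, hJ, hJe⟩ := exists_measurable_phasePoint hρ hreg h0
  have hph := aemeasurable_phase hρ hreg h0
  have hZ : AEMeasurable (fun γ : CadlagPath T => ζ (γ.toReal 0, γ.velocity 0)) π :=
    hζ.comp_aemeasurable hph
  have hlaw : π.map (fun γ : CadlagPath T => ζ (γ.toReal 0, γ.velocity 0)) = volume := by
    have h1 : π.map (fun γ : CadlagPath T => ζ (γ.toReal 0, γ.velocity 0))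
        = (phaseLaw π 0).map ζ :=
      (AEMeasurable.map_map_of_aemeasurable hζ.aemeasurable hph).symm
    rw [h1, phaseLaw_eq_map hρ hreg h0, AEMeasurable.map_map_of_aemeasurable hζ.aemeasurable
      (aemeasurable_phasePoint hρ hreg h0)]
    have : ζ ∘ phasePoint ρ 0 =ᵐ[volume] id := hζJ
    rw [Measure.map_congr this, Measure.map_id]
  refine ⟨_, hZ, hlaw, ?_⟩
  -- Recovering the color and then the velocity is the identity for almost every phase point, since
  -- the phase law is the image of the uniform law.
  have h1 : ∀ᵐ q ∂phaseLaw π 0, J (ζ q) = q := by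
    have hset : MeasurableSet {q : ℝ × ℝ | J (ζ q) = q} :=
      measurableSet_eq_fun (hJ.comp hζ) measurable_id
    rw [phaseLaw_eq_map hρ hreg h0, ae_map_iff (aemeasurable_phasePoint hρ hreg h0) hset]
    filter_upwards [hζJ, ae_prod_mem_Ioo] with z hz hz'
    rw [hz, hJe z hz'.1 hz'.2]
  have h2 := ae_prod_mem_Ioo
  rw [← hlaw] at h2
  filter_upwards [ae_of_ae_map hph h1, ae_of_ae_map hZ h2] with γ h3 h4
  rw [← hJe _ h4.1 h4.2, h3]

/-- The quantile bound covers only interior positions; at the two endpoints the field is zero. -/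
lemma IsBoundarySmoothing.abs_field_le (hW : IsBoundarySmoothing T (quantileVelocity ρ) W)
    (hρ : IsPhaseDensity π ρ) (hM0 : 0 ≤ M)
    (hM : ∀ t ∈ Icc 0 T, ∀ x v, ρ t x v ≠ 0 → |v| ≤ M) (hβ : β ∈ Ioo (0 : ℝ) (1 / 4))
    {q : ℝ × ℝ × ℝ} (hq : q ∈ fieldBox T) : |W β q.1 q.2.1 q.2.2| ≤ M + 1 := by
  obtain ⟨t, x, φ⟩ := q
  obtain ⟨ht, hx, hφ⟩ := hq
  change |W β t x φ| ≤ M + 1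
  rcases eq_or_ne x 0 with rfl | hx0
  · rw [hW.eq_zero_left β hβ t ht φ hφ, abs_zero]; linarith
  rcases eq_or_ne x 1 with rfl | hx1
  · rw [hW.eq_zero_right β hβ t ht φ hφ, abs_zero]; linarith
  have hx' : x ∈ Ioo (0 : ℝ) 1 := ⟨lt_of_le_of_ne hx.1 hx0.symm, lt_of_le_of_ne hx.2 hx1⟩
  have h1 := hW.bound β hβ t ht x hx φ hφ
  have h2 : |quantileVelocity ρ t x φ| ≤ M :=
    abs_le.2 ((hρ.isCompactCDF ht hx' (hM t ht _)).quantile_mem hφ)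
  linarith

lemma IsRegularPath.abs_sub_le_add_one {γ : CadlagPath T}
    (h : IsRegularPath p L M γ) {s t : ℝ} (hs : s ∈ Icc 0 T) (ht : t ∈ Icc 0 T) (hst : s ≤ t) :
    |γ.toReal t - γ.toReal s| ≤ (M + 1) * (t - s) := by
  have := h.abs_sub_le hs ht
  rw [abs_of_nonneg (sub_nonneg.2 hst)] at this
  nlinarith

/-- The approximations in terms of the probability that a path comes close to the boundary. -/
lemma eventually_close [IsProbabilityMeasure π] (hT : 0 < T)
    (hρ : IsPhaseDensity π ρ) (hreg : RegularityAssumptions T p ρ) (hL0 : 0 ≤ L) (hM0 : 0 ≤ M)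
    (hM : ∀ t ∈ Icc 0 T, ∀ x v, ρ t x v ≠ 0 → |v| ≤ M)
    (hL : ∀ t ∈ Icc 0 T, ∀ x ∈ Icc (0 : ℝ) 1, ∀ y ∈ Icc (0 : ℝ) 1,
      |pressureGradient p t x - pressureGradient p t y| ≤ L * |x - y|)
    (hR : ∀ᵐ γ ∂π, IsRegularPath p L M γ)
    (hW : IsBoundarySmoothing T (quantileVelocity ρ) W) (hβ : β ∈ Ioo (0 : ℝ) (1 / 4))
    {πapp : ℝ → Measure (CadlagPath T)}
    (happ : ∀ δ > 0, IsColoredTrajectoryLaw (freezeTime δ (W β)) (πapp δ)) {η : ℝ} (hη : 0 < η) :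
    ∀ᶠ δ in 𝓝[>] (0 : ℝ),
      wassersteinSup π (πapp δ) ≤ ENNReal.ofReal η + π (nearBoundary T (2 * β)) ∧
      energy π ≤ energy (πapp δ) + (ENNReal.ofReal (T * ((M + 1) * η)) +
        ENNReal.ofReal (T * ((M + 1) * (M + 1))) * π (nearBoundary T (2 * β))) ∧
      energy (πapp δ) ≤ energy π + (ENNReal.ofReal (T * ((M + 1) * η)) +
        ENNReal.ofReal (T * ((M + 1) * (M + 1))) * π (nearBoundary T (2 * β))) := by
  have h0 : (0 : ℝ) ∈ Icc 0 T := ⟨le_rfl, hT.le⟩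
  obtain ⟨u, ut, ux, uφ, h⟩ := exists_isFieldExtension hT (hW.smooth β hβ)
  obtain ⟨κ, hκ, hclose⟩ := h.exists_forall_flowLine_close hL0 hβ.1 hη hL
    fun t ht x hx φ hφ => eulerDefect_eq_zero hT hρ hreg hM0 hL hR hW hβ h ht hx hφ
  obtain ⟨Z, hZ, hZlaw, hZ0⟩ := exists_initial_color hT hρ hreg
  have hub : ∀ q ∈ fieldBox T, |u q| ≤ M + 1 := fun q hq => by
    rw [← h.eq q hq]; exact hW.abs_field_le hρ hM0 hM hβ hq
  filter_upwards [Ioc_mem_nhdsGT hκ] with δ hδ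
  obtain ⟨X, Φ, hX, hΦ, hsol, hlaw⟩ := happ δ hδ.1
  have hXZ : AEMeasurable (fun γ => X (Z γ)) π := hX.comp_aemeasurable hZ
  -- The initial color is uniform under `π`, so `γ ↦ (γ, X (Z γ))` couples the two laws.
  have hmap : πapp δ = π.map fun γ => X (Z γ) := by
    rw [hlaw, ← hZlaw]
    exact AEMeasurable.map_map_of_aemeasurable hX.aemeasurable hZ
  have hflow : ∀ z, IsFlowLine T u (colorExt ux) (frozenTime δ) (X z).toReal (Φ z).toReal :=
    fun z => h.isFlowLine_of_freezeTime hδ.1 (hsol z).2.2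
  have hXlip : ∀ z, ∀ s ∈ Icc 0 T, ∀ t ∈ Icc 0 T, s ≤ t →
      |(X z).toReal t - (X z).toReal s| ≤ (M + 1) * (t - s) := fun z s hs t ht hst =>
    (hflow z).abs_sub_le hub hs ht hst
  have hgood : ∀ᵐ γ ∂π, γ ∉ nearBoundary T (2 * β) → ∀ t ∈ Icc 0 T,
      |(X (Z γ)).toReal t - γ.toReal t| ≤ η ∧
      |u (frozenTime δ t, (X (Z γ)).toReal t, (Φ (Z γ)).toReal t) - γ.velocity t| ≤ η := by
    filter_upwards [hR, hZ0] with γ hγ hγ0 hnear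
    have hin : ∀ t ∈ Icc 0 T, γ.toReal t ∈ Icc (2 * β) (1 - 2 * β) := not_not.1 hnear
    have hz1 : ((Z γ).1 : ℝ) = γ.toReal 0 := congrArg Prod.fst hγ0
    have hz2 : quantileVelocity ρ 0 (Z γ).1 (Z γ).2 = γ.velocity 0 := congrArg Prod.snd hγ0
    refine hclose _ _ _ (fun t ht => (abs_frozenTime_sub_le hδ.1 ht.1).trans hδ.2) (hflow _) γ
      hγ.newton hin ((hsol _).1.trans hz1) ?_
    rw [(hsol (Z γ)).1, (hsol (Z γ)).2.1, ← hz2, ← h.eq (0, _, _) ⟨h0, (Z γ).1.2, (Z γ).2.2⟩]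
    refine hW.eq_inside β hβ 0 h0 _ ?_ _ (Z γ).2.2
    have := hin 0 h0
    rw [← hz1] at this
    constructor <;> linarith [this.1, this.2, hβ.1]
  have hmeas := measurableSet_nearBoundary (T := T) hT (2 * β)
  -- Away from the boundary the error is `a`; near it only the crude bound `b` is used, weighted by
  -- the small probability.
  have hcompare : ∀ f g : CadlagPath T → ℝ≥0∞, ∀ a b : ℝ≥0∞, AEMeasurable g π →
      (∀ᵐ γ ∂π, γ ∉ nearBoundary T (2 * β) → f γ ≤ g γ + a) → (∀ᵐ γ ∂π, f γ ≤ b) →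
      ∫⁻ γ, f γ ∂π ≤ ∫⁻ γ, g γ ∂π + (a + b * π (nearBoundary T (2 * β))) := by
    intro f g a b hg hfg hfb
    calc ∫⁻ γ, f γ ∂π
        ≤ ∫⁻ γ, (g γ + (a + (nearBoundary T (2 * β)).indicator (fun _ => b) γ)) ∂π := by
          refine lintegral_mono_ae ?_
          filter_upwards [hfg, hfb] with γ h1 h2
          by_cases hγ : γ ∈ nearBoundary T (2 * β)
          · rw [indicator_of_mem hγ]
            exact h2.trans (le_add_left (le_add_left le_rfl))
          · rw [indicator_of_notMem hγ, add_zero]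
            exact h1 hγ
      _ = _ := by
          rw [lintegral_add_left' hg, lintegral_add_left measurable_const, lintegral_const,
            measure_univ, mul_one, lintegral_indicator_const hmeas]
  have hE : energy (πapp δ) = ∫⁻ γ, pathEnergy (X (Z γ)) ∂π := by
    rw [energy, hmap, lintegral_map' (measurable_pathEnergy hT).aemeasurable hXZ]
  have hincr : ∀ᵐ γ ∂π, γ ∉ nearBoundary T (2 * β) → ∀ s ∈ Icc 0 T, ∀ t ∈ Icc 0 T, s ≤ t →
      |((X (Z γ)).toReal t - (X (Z γ)).toReal s) - (γ.toReal t - γ.toReal s)| ≤ η * (t - s) := by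
    filter_upwards [hgood, hR] with γ hγ hγR hnear s hs t ht hst
    exact abs_increment_sub_le (hflow (Z γ)).continuous_left hγR.newton.continuousOn
      (hflow (Z γ)).deriv_left
      (fun r hr => (hγR.newton r (Ico_subset_Icc_self hr)).1.Ici_of_Icc hr)
      (fun r hr => (hγ hnear r (Ico_subset_Icc_self hr)).2) hs ht hst
  refine ⟨?_, ?_, ?_⟩
  · rw [hmap]
    refine (wassersteinSup_map_le_lintegral hXZ).trans ?_
    have := hcompare (fun γ => supDist γ (X (Z γ))) (fun _ => 0) (ENNReal.ofReal η) 1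
      aemeasurable_const ?_ (ae_of_all _ fun γ => supDist_le_one _ _)
    · simpa using this
    · filter_upwards [hgood] with γ hγ hnear
      rw [zero_add, supDist_comm]
      exact supDist_le_ofReal fun t ht => (hγ hnear t ht).1
  · rw [hE]
    refine hcompare pathEnergy (fun γ => pathEnergy (X (Z γ))) _ _
      ((measurable_pathEnergy hT).comp_aemeasurable hXZ) ?_ ?_
    · filter_upwards [hincr, hR] with γ hγ hγR hnear
      refine pathEnergy_le_add hη.le
        (fun s hs t ht hst => IsRegularPath.abs_sub_le_add_one hγR hs ht hst) (hXlip _) ?_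
      intro s hs t ht hst
      rw [abs_sub_comm]
      exact hγ hnear s hs t ht hst
    · filter_upwards [hR] with γ hγR
      exact pathEnergy_le fun s hs t ht hst => IsRegularPath.abs_sub_le_add_one hγR hs ht hst
  · rw [hE]
    refine hcompare (fun γ => pathEnergy (X (Z γ))) pathEnergy _ _
      (measurable_pathEnergy hT).aemeasurable ?_ (ae_of_all _ fun γ => pathEnergy_le (hXlip _))
    filter_upwards [hincr, hR] with γ hγ hγR hnear
    exact pathEnergy_le_add hη.le (hXlip _)
      (fun s hs t ht hst => IsRegularPath.abs_sub_le_add_one hγR hs ht hst) (hγ hnear)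

/-- The two iterated limits, without uniqueness of solutions. -/
lemma iterated_limits (hT : 0 < T) (hπ : IsGeneralizedEulerSolution π p)
    (hρ : IsPhaseDensity π ρ) (hreg : RegularityAssumptions T p ρ)
    (hW : IsBoundarySmoothing T (quantileVelocity ρ) W) {πapp : ℝ → ℝ → Measure (CadlagPath T)}
    (happ : ∀ β ∈ Ioo (0 : ℝ) (1 / 4), ∀ δ > 0,
      IsColoredTrajectoryLaw (freezeTime δ (W β)) (πapp β δ)) :
    (∀ U ∈ 𝓝 (0 : ℝ≥0∞), ∀ᶠ β in 𝓝[>] (0 : ℝ), ∀ᶠ δ in 𝓝[>] (0 : ℝ),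
      wassersteinSup π (πapp β δ) ∈ U) ∧
    (∀ U ∈ 𝓝 (energy π), ∀ᶠ β in 𝓝[>] (0 : ℝ), ∀ᶠ δ in 𝓝[>] (0 : ℝ),
      energy (πapp β δ) ∈ U) := by
  have := hπ.isPermutonProcess.isProbability
  obtain ⟨M, hM0, hM⟩ := hreg.exists_bound
  obtain ⟨L, hL⟩ := hreg.pressure_lipschitz
  have hL' : ∀ t ∈ Icc 0 T, ∀ x ∈ Icc (0 : ℝ) 1, ∀ y ∈ Icc (0 : ℝ) 1,
      |pressureGradient p t x - pressureGradient p t y| ≤ L * |x - y| := fun t ht x hx y hy =>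
    (hL t ht).dist_le_mul x hx y hy
  have hR := ae_isRegularPath hT hπ hρ hreg hW L.2 hM hL'
  have hin := ae_forall_mem_Ioo hT hπ hρ hreg L.2 hM0.le hL' hR
  have hnear := tendsto_measure_nearBoundary hT (hR.mono fun γ hγ => hγ.newton.continuousOn) hin
  have hclose : ∀ β ∈ Ioo (0 : ℝ) (1 / 4), ∀ η > (0 : ℝ), _ := fun β hβ η hη =>
    eventually_close hT hρ hreg L.2 hM0.le hM hL' hR hW hβ (happ β hβ) (η := η) hη
  have hβev : ∀ᶠ β in 𝓝[>] (0 : ℝ), β ∈ Ioo (0 : ℝ) (1 / 4) := Ioo_mem_nhdsGT (by norm_num)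
  have hpick : ∀ ε : ℝ≥0∞, 0 < ε → ∃ η > 0, ENNReal.ofReal (T * ((M + 1) * η)) ≤ ε / 2 ∧
      ENNReal.ofReal η ≤ ε / 2 := by
    intro ε hε
    have h2 : (0 : ℝ≥0∞) < ε / 2 := ENNReal.half_pos hε.ne'
    have t1 : Tendsto (fun η : ℝ => ENNReal.ofReal (T * ((M + 1) * η))) (𝓝[>] 0) (𝓝 0) := by
      have : Continuous fun η : ℝ => ENNReal.ofReal (T * ((M + 1) * η)) :=
        ENNReal.continuous_ofReal.comp (by fun_prop)
      simpa using (this.tendsto 0).mono_left nhdsWithin_le_nhds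
    have t2 : Tendsto (fun η : ℝ => ENNReal.ofReal η) (𝓝[>] 0) (𝓝 0) := by
      simpa using (ENNReal.continuous_ofReal.tendsto 0).mono_left nhdsWithin_le_nhds
    obtain ⟨η, h1, h3, h4⟩ := ((t1.eventually_le_const h2).and
      ((t2.eventually_le_const h2).and self_mem_nhdsWithin)).exists
    exact ⟨η, h4, h1, h3⟩
  constructor
  · intro U hU
    obtain ⟨ε, hε, hεU⟩ := (ENNReal.hasBasis_nhds_of_ne_top ENNReal.zero_ne_top).mem_iff.1 hU
    obtain ⟨η, hη, -, hη2⟩ := hpick ε hε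
    filter_upwards [hβev, hnear.eventually_le_const (ENNReal.half_pos hε.ne')] with β hβ hβn
    filter_upwards [hclose β hβ η hη] with δ hδ
    refine hεU ⟨by simp, ?_⟩
    rw [zero_add, ← ENNReal.add_halves ε]
    exact hδ.1.trans (add_le_add hη2 hβn)
  · intro U hU
    have hfin : energy π ≠ ⊤ := by
      refine ne_top_of_le_ne_top (b := ENNReal.ofReal (T * ((M + 1) * (M + 1))))
        ENNReal.ofReal_ne_top ?_
      calc energy π ≤ ∫⁻ _, ENNReal.ofReal (T * ((M + 1) * (M + 1))) ∂π := by
            refine lintegral_mono_ae (hR.mono fun γ hγ => ?_)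
            exact pathEnergy_le fun s hs t ht hst =>
              IsRegularPath.abs_sub_le_add_one hγ hs ht hst
        _ = _ := by simp
    obtain ⟨ε, hε, hεU⟩ := (ENNReal.hasBasis_nhds_of_ne_top hfin).mem_iff.1 hU
    obtain ⟨η, hη, hη1, -⟩ := hpick ε hε
    have hnear' : Tendsto (fun β => ENNReal.ofReal (T * ((M + 1) * (M + 1))) *
        π (nearBoundary T (2 * β))) (𝓝[>] 0) (𝓝 0) := by
      simpa using ENNReal.Tendsto.const_mul hnear (Or.inr ENNReal.ofReal_ne_top)
    filter_upwards [hβev, hnear'.eventually_le_const (ENNReal.half_pos hε.ne')] with β hβ hβn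
    filter_upwards [hclose β hβ η hη] with δ hδ
    have hr := add_le_add hη1 hβn
    rw [ENNReal.add_halves] at hr
    exact hεU ⟨tsub_le_iff_right.2 (hδ.2.1.trans (by gcongr)), hδ.2.2.trans (by gcongr)⟩

end Coupling


/-! ### Limits of flow lines as the time step vanishes. -/

section Limits

variable {T : ℝ} {w : ℝ → ℝ → ℝ → ℝ} {u ut ux uφ R : ℝ × ℝ × ℝ → ℝ}

lemma IsFlowLine.abs_sub_le_abs {σ x φ : ℝ → ℝ} (hs : IsFlowLine T u R σ x φ) {C : ℝ}
    (hu : ∀ q ∈ fieldBox T, |u q| ≤ C) {s t : ℝ} (hs0 : s ∈ Icc 0 T) (ht : t ∈ Icc 0 T) :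
    |x t - x s| ≤ C * |t - s| := by
  rcases le_total s t with h | h
  · rw [abs_of_nonneg (sub_nonneg.2 h)]
    exact hs.abs_sub_le hu hs0 ht h
  · rw [abs_sub_comm, abs_sub_comm t, abs_of_nonneg (sub_nonneg.2 h)]
    exact hs.abs_sub_le hu ht hs0 h

lemma IsFlowLine.abs_sub_le_abs_right {σ x φ : ℝ → ℝ} (hs : IsFlowLine T u R σ x φ) {C : ℝ}
    (hR : ∀ q ∈ fieldBox T, |R q| ≤ C) {s t : ℝ} (hs0 : s ∈ Icc 0 T) (ht : t ∈ Icc 0 T) :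
    |φ t - φ s| ≤ C * |t - s| := by
  rcases le_total s t with h | h
  · rw [abs_of_nonneg (sub_nonneg.2 h)]
    exact hs.abs_sub_le_right hR hs0 ht h
  · rw [abs_sub_comm, abs_sub_comm t, abs_of_nonneg (sub_nonneg.2 h)]
    exact hs.abs_sub_le_right hR ht hs0 h

lemma exists_abs_le_fieldBox {f : ℝ × ℝ × ℝ → ℝ} (hf : Continuous f) (T : ℝ) :
    ∃ C > 0, ∀ q ∈ fieldBox T, |f q| ≤ C := by
  obtain ⟨C, hC⟩ := (isCompact_fieldBox T).exists_bound_of_continuousOn hf.continuousOn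
  exact ⟨max C 1, by positivity, fun q hq => (hC q hq).trans (le_max_left _ _)⟩

variable {ι : Type*} {l : Filter ι} {σ x φ : ι → ℝ → ℝ} {x₀ φ₀ : ℝ → ℝ}

/-- A component `y` of a pointwise limit of flow lines has the expected right derivative. -/
lemma hasDerivWithinAt_of_tendsto_flowLine [l.NeBot] (hu : Continuous u) (hR : Continuous R)
    (hσ : ∀ κ > 0, ∀ᶠ i in l, ∀ t ∈ Icc 0 T, |σ i t - t| ≤ κ)
    (hs : ∀ᶠ i in l, IsFlowLine T u R (σ i) (x i) (φ i))
    (hx : ∀ t ∈ Icc 0 T, Tendsto (fun i => x i t) l (𝓝 (x₀ t)))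
    (hφ : ∀ t ∈ Icc 0 T, Tendsto (fun i => φ i t) l (𝓝 (φ₀ t)))
    (hbox : ∀ t ∈ Icc 0 T, (t, x₀ t, φ₀ t) ∈ fieldBox T)
    {F : ℝ × ℝ × ℝ → ℝ} (hF : Continuous F) {y : ι → ℝ → ℝ} {y₀ : ℝ → ℝ}
    (hy : ∀ t ∈ Icc 0 T, Tendsto (fun i => y i t) l (𝓝 (y₀ t)))
    (hyc : ∀ᶠ i in l, ContinuousOn (y i) (Icc 0 T))
    (hyd : ∀ᶠ i in l, ∀ t ∈ Ico 0 T, HasDerivWithinAt (y i) (F (σ i t, x i t, φ i t)) (Ici t) t)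
    {t : ℝ} (ht : t ∈ Ico 0 T) :
    HasDerivWithinAt y₀ (F (t, x₀ t, φ₀ t)) (Ici t) t := by
  have ht' := Ico_subset_Icc_self ht
  rw [hasDerivWithinAt_iff_isLittleO, Asymptotics.isLittleO_iff]
  intro ε hε
  obtain ⟨κ, hκ, hmod⟩ := exists_modulus hF T hε
  obtain ⟨C₁, hC₁, hC₁'⟩ := exists_abs_le_fieldBox hu T
  obtain ⟨C₂, hC₂, hC₂'⟩ := exists_abs_le_fieldBox hR T
  have hκ2 : 0 < κ / 2 := half_pos hκ
  -- Within time `r` a flow line moves by at most `κ / 2`, uniformly in `i`; the freezing error or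
  -- the distance from the limit at `t` costs another `κ / 2`. So the field varies by at most `ε` on
  -- a window independent of `i`, and the slope estimate survives the limit.
  set r : ℝ := min (T - t) (κ / 2 / (1 + C₁ + C₂)) with hr
  have hr0 : 0 < r := lt_min (sub_pos.2 ht.2) (by positivity)
  have hrT : r ≤ T - t := min_le_left _ _
  have hrκ : (1 + C₁ + C₂) * r ≤ κ / 2 := by
    have : r ≤ κ / 2 / (1 + C₁ + C₂) := min_le_right _ _
    rwa [le_div_iff₀ (by positivity), mul_comm] at this
  filter_upwards [Icc_mem_nhdsGE (show t < t + r by linarith)] with s hs'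
  have hsI : s ∈ Icc 0 T := ⟨ht.1.trans hs'.1, by linarith [hs'.2]⟩
  have hlim : Tendsto (fun i => ‖y i s - y i t - (s - t) • F (t, x₀ t, φ₀ t)‖) l
      (𝓝 ‖y₀ s - y₀ t - (s - t) • F (t, x₀ t, φ₀ t)‖) :=
    (((hy s hsI).sub (hy t ht')).sub_const _).norm
  refine le_of_tendsto hlim ?_
  have hxt := (Metric.tendsto_nhds.1 (hx t ht')) (κ / 2) hκ2
  have hφt := (Metric.tendsto_nhds.1 (hφ t ht')) (κ / 2) hκ2
  filter_upwards [hσ (κ / 2) hκ2, hs, hyc, hyd, hxt, hφt] with i h1 h2 h3 h4 h5 h6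
  have key := norm_image_sub_le_of_norm_deriv_right_le_segment (a := t) (b := s)
    (f := fun q => y i q - q * F (t, x₀ t, φ₀ t))
    (f' := fun q => F (σ i q, x i q, φ i q) - 1 * F (t, x₀ t, φ₀ t)) (C := ε) ?_ ?_ ?_ s
    ⟨hs'.1, le_rfl⟩
  · have e : y i s - s * F (t, x₀ t, φ₀ t) - (y i t - t * F (t, x₀ t, φ₀ t)) =
        y i s - y i t - (s - t) • F (t, x₀ t, φ₀ t) := by rw [smul_eq_mul]; ring
    rw [e] at key
    rwa [Real.norm_of_nonneg (sub_nonneg.2 hs'.1)]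
  · exact (h3.mono (Icc_subset_Icc ht.1 hsI.2)).sub (by fun_prop)
  · intro q hq
    exact (h4 q ⟨ht.1.trans hq.1, hq.2.trans_le hsI.2⟩).sub
      ((hasDerivWithinAt_id q _).mul_const _)
  · intro q hq
    have hqI : q ∈ Icc 0 T := ⟨ht.1.trans hq.1, hq.2.le.trans hsI.2⟩
    rw [one_mul]
    refine hmod _ (h2.mem_fieldBox hqI (h2.time_mem q hqI)) _ (hbox t ht') ?_
    have hqt : |q - t| ≤ r := by
      rw [abs_of_nonneg (sub_nonneg.2 hq.1)]
      linarith [hq.2, hs'.2]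
    have b1 := h2.abs_sub_le_abs hC₁' ht' hqI
    have b2 := h2.abs_sub_le_abs_right hC₂' ht' hqI
    have b3 : C₁ * |q - t| ≤ C₁ * r := by gcongr
    have b4 : C₂ * |q - t| ≤ C₂ * r := by gcongr
    have b5 : 0 ≤ C₁ * r := by positivity
    have b6 : 0 ≤ C₂ * r := by positivity
    rw [Real.dist_eq] at h5 h6
    have a1 := abs_sub_le (σ i q) q t
    have a2 := abs_sub_le (x i q) (x i t) (x₀ t)
    have a3 := abs_sub_le (φ i q) (φ i t) (φ₀ t)
    have a4 := h1 q hqI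
    rw [Prod.dist_eq, Prod.dist_eq]
    simp only [Real.dist_eq]
    refine max_le ?_ (max_le ?_ ?_) <;> nlinarith

/-- Pointwise limits of flow lines are flow lines. -/
lemma isFlowLine_of_tendsto [l.NeBot] (hu : Continuous u) (hR : Continuous R)
    (hσ : ∀ κ > 0, ∀ᶠ i in l, ∀ t ∈ Icc 0 T, |σ i t - t| ≤ κ)
    (hs : ∀ᶠ i in l, IsFlowLine T u R (σ i) (x i) (φ i))
    (hx : ∀ t ∈ Icc 0 T, Tendsto (fun i => x i t) l (𝓝 (x₀ t)))
    (hφ : ∀ t ∈ Icc 0 T, Tendsto (fun i => φ i t) l (𝓝 (φ₀ t))) :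
    IsFlowLine T u R id x₀ φ₀ := by
  have hx01 : ∀ t ∈ Icc 0 T, x₀ t ∈ Icc (0 : ℝ) 1 := fun t ht =>
    isClosed_Icc.mem_of_tendsto (hx t ht) (hs.mono fun i hi => hi.mem_left t ht)
  have hφ01 : ∀ t ∈ Icc 0 T, φ₀ t ∈ Icc (0 : ℝ) 1 := fun t ht =>
    isClosed_Icc.mem_of_tendsto (hφ t ht) (hs.mono fun i hi => hi.mem_right t ht)
  have hlip : ∀ {f : ℝ → ℝ} {C : ℝ}, 0 < C →
      (∀ s ∈ Icc 0 T, ∀ t ∈ Icc 0 T, |f t - f s| ≤ C * |t - s|) → ContinuousOn f (Icc 0 T) := by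
    intro f C hC hf
    refine (LipschitzOnWith.of_dist_le_mul (K := ⟨C, hC.le⟩) fun t ht s hs => ?_).continuousOn
    rw [Real.dist_eq, Real.dist_eq]
    exact hf s hs t ht
  obtain ⟨C₁, hC₁, hC₁'⟩ := exists_abs_le_fieldBox hu T
  obtain ⟨C₂, hC₂, hC₂'⟩ := exists_abs_le_fieldBox hR T
  have hbox : ∀ t ∈ Icc 0 T, (t, x₀ t, φ₀ t) ∈ fieldBox T := fun t ht =>
    ⟨ht, hx01 t ht, hφ01 t ht⟩
  refine ⟨fun t ht => ht, hx01, hφ01, hlip hC₁ fun s hs' t ht => ?_,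
    hlip hC₂ fun s hs' t ht => ?_, fun t ht => ?_, fun t ht => ?_⟩
  · exact le_of_tendsto ((hx t ht).sub (hx s hs')).abs
      (hs.mono fun i hi => hi.abs_sub_le_abs hC₁' hs' ht)
  · exact le_of_tendsto ((hφ t ht).sub (hφ s hs')).abs
      (hs.mono fun i hi => hi.abs_sub_le_abs_right hC₂' hs' ht)
  · exact hasDerivWithinAt_of_tendsto_flowLine hu hR hσ hs hx hφ hbox hu hx
      (hs.mono fun i hi => hi.continuous_left) (hs.mono fun i hi => hi.deriv_left) ht
  · exact hasDerivWithinAt_of_tendsto_flowLine hu hR hσ hs hx hφ hbox hR hφ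
      (hs.mono fun i hi => hi.continuous_right) (hs.mono fun i hi => hi.deriv_right) ht

/-- Pointwise convergence of equi-Lipschitz functions on a compact interval is uniform. -/
lemma eventually_forall_abs_sub_le {f : ι → ℝ → ℝ} {f₀ : ℝ → ℝ} {C ε : ℝ} (hC : 0 < C)
    (hf : ∀ᶠ i in l, ∀ s ∈ Icc 0 T, ∀ t ∈ Icc 0 T, |f i t - f i s| ≤ C * |t - s|)
    (hf₀ : ∀ s ∈ Icc 0 T, ∀ t ∈ Icc 0 T, |f₀ t - f₀ s| ≤ C * |t - s|)
    (hlim : ∀ t ∈ Icc 0 T, Tendsto (fun i => f i t) l (𝓝 (f₀ t))) (hε : 0 < ε) :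
    ∀ᶠ i in l, ∀ t ∈ Icc 0 T, |f i t - f₀ t| ≤ ε := by
  have key : ∀ᶠ i in l, ∀ t ∈ Icc 0 T, t ∈ Icc 0 T → |f i t - f₀ t| ≤ ε := by
    refine isCompact_Icc.induction_on (p := fun s => ∀ᶠ i in l, ∀ t ∈ s, t ∈ Icc 0 T →
      |f i t - f₀ t| ≤ ε) ?_ ?_ ?_ ?_
    · simp
    · intro s s' hss h
      exact h.mono fun i hi t ht => hi t (hss ht)
    · intro s s' h h'
      filter_upwards [h, h'] with i h1 h2 t ht
      exact ht.elim (h1 t) (h2 t)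
    · intro t ht
      have hr : 0 < ε / (4 * C) := by positivity
      refine ⟨Metric.ball t (ε / (4 * C)), mem_nhdsWithin_of_mem_nhds (Metric.ball_mem_nhds t hr), ?_⟩
      filter_upwards [hf, Metric.tendsto_nhds.1 (hlim t ht) (ε / 2) (half_pos hε)] with i h1 h2 s hs hsI
      rw [Metric.mem_ball, Real.dist_eq] at hs
      rw [Real.dist_eq] at h2
      have b1 := h1 t ht s hsI
      have b2 := hf₀ t ht s hsI
      have b3 : C * |s - t| ≤ ε / 4 := by
        calc C * |s - t| ≤ C * (ε / (4 * C)) := by gcongr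
          _ = ε / 4 := by field_simp
      have e : f i s - f₀ s = (f i s - f i t) + (f i t - f₀ t) - (f₀ s - f₀ t) := by ring
      rw [e]
      have a1 := abs_sub (f i s - f i t + (f i t - f₀ t)) (f₀ s - f₀ t)
      have a2 := abs_add_le (f i s - f i t) (f i t - f₀ t)
      linarith
  exact key.mono fun i hi t ht => hi t ht ht

end Limits


/-! ### Convergence under uniqueness. -/

section Unique

variable {T : ℝ} {w : ℝ → ℝ → ℝ → ℝ} {u ut ux uφ : ℝ × ℝ × ℝ → ℝ}

lemma eventually_abs_frozenTime_sub_le (T : ℝ) {κ : ℝ} (hκ : 0 < κ) :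
    ∀ᶠ δ in 𝓝[>] (0 : ℝ), ∀ t ∈ Icc 0 T, |frozenTime δ t - t| ≤ κ := by
  filter_upwards [Ioc_mem_nhdsGT hκ] with δ hδ t ht
  exact (abs_frozenTime_sub_le hδ.1 ht.1).trans hδ.2

/-- If solutions are unique, the flow lines of the frozen fields from a given initial point converge
to the solution. -/
lemma IsFieldExtension.exists_limit_solution (hT : 0 < T) (h : IsFieldExtension T w u ut ux uφ)
    (huniq : HasUniqueColorSolutions T w) {x φ : ℝ → ℝ → ℝ} {a b : ℝ}
    (hs : ∀ δ > 0, IsFlowLine T u (colorExt ux) (frozenTime δ) (x δ) (φ δ))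
    (hx0 : ∀ δ > 0, x δ 0 = a) (hφ0 : ∀ δ > 0, φ δ 0 = b) :
    ∃ x₀ φ₀ : ℝ → ℝ, IsFlowLine T u (colorExt ux) id x₀ φ₀ ∧
      (∀ t ∈ Icc 0 T, Tendsto (fun δ => x δ t) (𝓝[>] 0) (𝓝 (x₀ t))) ∧
      (∀ t ∈ Icc 0 T, Tendsto (fun δ => φ δ t) (𝓝[>] 0) (𝓝 (φ₀ t))) := by
  have h0 : (0 : ℝ) ∈ Icc 0 T := ⟨le_rfl, hT.le⟩
  have hR := continuous_colorExt h.cont_x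
  have hpos : ∀ᶠ δ in 𝓝[>] (0 : ℝ), 0 < δ := self_mem_nhdsWithin
  -- Along an ultrafilter all values converge simultaneously, by compactness of `[0,1]`. The limit
  -- is a solution, and uniqueness later makes it the same for every ultrafilter.
  have hcpt : ∀ 𝒰 : Ultrafilter ℝ, (𝒰 : Filter ℝ) ≤ 𝓝[>] 0 → ∃ x₀ φ₀ : ℝ → ℝ,
      IsFlowLine T u (colorExt ux) id x₀ φ₀ ∧ x₀ 0 = a ∧ φ₀ 0 = b ∧
      (∀ t ∈ Icc 0 T, Tendsto (fun δ => x δ t) 𝒰 (𝓝 (x₀ t))) ∧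
      (∀ t ∈ Icc 0 T, Tendsto (fun δ => φ δ t) 𝒰 (𝓝 (φ₀ t))) := by
    intro 𝒰 hU
    have hlim : ∀ f : ℝ → ℝ → ℝ, (∀ t ∈ Icc 0 T, ∀ δ > 0, f δ t ∈ Icc (0 : ℝ) 1) →
        ∃ f₀ : ℝ → ℝ, ∀ t ∈ Icc 0 T, Tendsto (fun δ => f δ t) 𝒰 (𝓝 (f₀ t)) := by
      intro f hf
      have : ∀ t, ∃ y, t ∈ Icc 0 T → Tendsto (fun δ => f δ t) 𝒰 (𝓝 y) := by
        intro t
        by_cases ht : t ∈ Icc 0 T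
        · obtain ⟨y, -, hy⟩ := (isCompact_Icc (a := (0 : ℝ)) (b := 1)).ultrafilter_le_nhds
            (𝒰.map fun δ => f δ t) (le_principal_iff.2 (hU (hpos.mono (hf t ht))))
          exact ⟨y, fun _ => hy⟩
        · exact ⟨0, fun h => absurd h ht⟩
      choose f₀ hf₀ using this
      exact ⟨f₀, hf₀⟩
    obtain ⟨x₀, hx₀⟩ := hlim x fun t ht δ hδ => (hs δ hδ).mem_left t ht
    obtain ⟨φ₀, hφ₀⟩ := hlim φ fun t ht δ hδ => (hs δ hδ).mem_right t ht
    refine ⟨x₀, φ₀, isFlowLine_of_tendsto h.cont hR (l := (𝒰 : Filter ℝ)) (σ := frozenTime)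
      (fun κ hκ => hU (eventually_abs_frozenTime_sub_le T hκ)) (hU (hpos.mono hs)) hx₀ hφ₀,
      ?_, ?_, hx₀, hφ₀⟩
    · exact tendsto_nhds_unique (hx₀ 0 h0) (tendsto_const_nhds.congr'
        (hU (hpos.mono fun δ hδ => (hx0 δ hδ).symm)))
    · exact tendsto_nhds_unique (hφ₀ 0 h0) (tendsto_const_nhds.congr'
        (hU (hpos.mono fun δ hδ => (hφ0 δ hδ).symm)))
  obtain ⟨x₀, φ₀, hf, ha, hb, -, -⟩ := hcpt (Ultrafilter.of (𝓝[>] 0)) (Ultrafilter.of_le _)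
  refine ⟨x₀, φ₀, hf, fun t ht => ?_, fun t ht => ?_⟩
  all_goals
    rw [tendsto_iff_ultrafilter]
    intro 𝒰 hU
    obtain ⟨x₁, φ₁, hf₁, ha₁, hb₁, hx₁, hφ₁⟩ := hcpt 𝒰 hU
    obtain ⟨e1, e2⟩ := huniq x₀ φ₀ x₁ φ₁ (h.isColorSolution_iff.2 hf) (h.isColorSolution_iff.2 hf₁)
      (ha.trans ha₁.symm) (hb.trans hb₁.symm)
  · rw [e1 ht]; exact hx₁ t ht
  · rw [e2 ht]; exact hφ₁ t ht

/-- Uniform convergence of the paths and of their velocities. -/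
lemma IsFieldExtension.eventually_flowLine_close (h : IsFieldExtension T w u ut ux uφ)
    {x φ : ℝ → ℝ → ℝ} {x₀ φ₀ : ℝ → ℝ}
    (hs : ∀ δ > 0, IsFlowLine T u (colorExt ux) (frozenTime δ) (x δ) (φ δ))
    (hs₀ : IsFlowLine T u (colorExt ux) id x₀ φ₀)
    (hx : ∀ t ∈ Icc 0 T, Tendsto (fun δ => x δ t) (𝓝[>] 0) (𝓝 (x₀ t)))
    (hφ : ∀ t ∈ Icc 0 T, Tendsto (fun δ => φ δ t) (𝓝[>] 0) (𝓝 (φ₀ t))) {η : ℝ} (hη : 0 < η) :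
    ∀ᶠ δ in 𝓝[>] (0 : ℝ), ∀ t ∈ Icc 0 T, |x δ t - x₀ t| ≤ η ∧
      |u (frozenTime δ t, x δ t, φ δ t) - u (t, x₀ t, φ₀ t)| ≤ η := by
  have hpos : ∀ᶠ δ in 𝓝[>] (0 : ℝ), 0 < δ := self_mem_nhdsWithin
  obtain ⟨C₁, hC₁, hC₁'⟩ := exists_abs_le_fieldBox h.cont T
  obtain ⟨C₂, hC₂, hC₂'⟩ := exists_abs_le_fieldBox (continuous_colorExt h.cont_x) T
  obtain ⟨κ, hκ, hmod⟩ := exists_modulus h.cont T hη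
  have hm : 0 < min κ η := lt_min hκ hη
  filter_upwards [hpos, eventually_abs_frozenTime_sub_le T hκ,
    eventually_forall_abs_sub_le hC₁ (hpos.mono fun δ hδ s hs' t ht =>
      (hs δ hδ).abs_sub_le_abs hC₁' hs' ht)
      (fun s hs' t ht => hs₀.abs_sub_le_abs hC₁' hs' ht) hx hm,
    eventually_forall_abs_sub_le hC₂ (hpos.mono fun δ hδ s hs' t ht =>
      (hs δ hδ).abs_sub_le_abs_right hC₂' hs' ht)
      (fun s hs' t ht => hs₀.abs_sub_le_abs_right hC₂' hs' ht) hφ hm] with δ hδ h1 h2 h3 t ht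
  refine ⟨(h2 t ht).trans (min_le_right _ _), hmod _ ((hs δ hδ).mem_fieldBox ht
    ((hs δ hδ).time_mem t ht)) _ (hs₀.mem_fieldBox ht ht) ?_⟩
  exact max_le (h1 t ht) (max_le ((h2 t ht).trans (min_le_left _ _))
    ((h3 t ht).trans (min_le_left _ _)))

lemma exists_pos_ofReal_mul_le (c : ℝ) {ε : ℝ≥0∞} (hε : 0 < ε) :
    ∃ η > 0, ENNReal.ofReal (c * η) ≤ ε := by
  have hc : Continuous fun η : ℝ => ENNReal.ofReal (c * η) :=
    ENNReal.continuous_ofReal.comp (by fun_prop)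
  have ht : Tendsto (fun η : ℝ => ENNReal.ofReal (c * η)) (𝓝[>] 0) (𝓝 0) := by
    simpa using (hc.tendsto 0).mono_left nhdsWithin_le_nhds
  obtain ⟨η, h1, h2⟩ := ((ht.eventually_le_const hε).and self_mem_nhdsWithin).exists
  exact ⟨η, h2, h1⟩

/-- If solutions are unique, the approximations converge as the time step tends to zero. -/
lemma exists_limit_law (hT : 0 < T) (π : Measure (CadlagPath T))
    (hw : ContDiffOn ℝ 1 (fun q : ℝ × ℝ × ℝ => w q.1 q.2.1 q.2.2) (fieldBox T))
    (huniq : HasUniqueColorSolutions T w) {πapp : ℝ → Measure (CadlagPath T)}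
    (happ : ∀ δ > 0, IsColoredTrajectoryLaw (freezeTime δ w) (πapp δ)) :
    ∃ ν : Measure (CadlagPath T),
      Tendsto (fun δ => wassersteinSup π (πapp δ)) (𝓝[>] 0) (𝓝 (wassersteinSup π ν)) ∧
      Tendsto (fun δ => energy (πapp δ)) (𝓝[>] 0) (𝓝 (energy ν)) := by
  obtain ⟨u, ut, ux, uφ, h⟩ := exists_isFieldExtension hT hw
  obtain ⟨C, hC0, hC⟩ := exists_abs_le_fieldBox h.cont T
  have hpos : ∀ᶠ δ in 𝓝[>] (0 : ℝ), 0 < δ := self_mem_nhdsWithin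
  have hch : ∀ δ : ℝ, ∃ X Φ : unitInterval × unitInterval → CadlagPath T, Measurable X ∧
      (0 < δ → (∀ z, (X z).toReal 0 = z.1 ∧ (Φ z).toReal 0 = z.2 ∧
        IsFlowLine T u (colorExt ux) (frozenTime δ) (X z).toReal (Φ z).toReal) ∧
        πapp δ = volume.map X) := by
    intro δ
    by_cases hδ : 0 < δ
    · obtain ⟨X, Φ, hX, -, hs, hl⟩ := happ δ hδ
      exact ⟨X, Φ, hX, fun _ => ⟨fun z => ⟨(hs z).1, (hs z).2.1,
        h.isFlowLine_of_freezeTime hδ (hs z).2.2⟩, hl⟩⟩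
    -- For `δ ≤ 0` only measurability is needed, and the maps for `δ = 1` supply it.
    · obtain ⟨X, Φ, hX, -⟩ := happ 1 one_pos
      exact ⟨X, Φ, hX, fun h => absurd h hδ⟩
  choose X Φ hX hXΦ using hch
  have hlim : ∀ z : unitInterval × unitInterval, ∃ x₀ φ₀ : ℝ → ℝ,
      IsFlowLine T u (colorExt ux) id x₀ φ₀ ∧
      (∀ t ∈ Icc 0 T, Tendsto (fun δ => (X δ z).toReal t) (𝓝[>] 0) (𝓝 (x₀ t))) ∧
      (∀ t ∈ Icc 0 T, Tendsto (fun δ => (Φ δ z).toReal t) (𝓝[>] 0) (𝓝 (φ₀ t))) := fun z =>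
    h.exists_limit_solution hT huniq (fun δ hδ => ((hXΦ δ hδ).1 z).2.2)
      (fun δ hδ => ((hXΦ δ hδ).1 z).1) (fun δ hδ => ((hXΦ δ hδ).1 z).2.1)
  choose S Ψ hflow hS hΨ using hlim
  have hScont : ∀ z, Continuous fun t : Icc (0 : ℝ) T =>
      (⟨S z t, (hflow z).mem_left t t.2⟩ : unitInterval) := fun z =>
    ((hflow z).continuous_left.domRestrict).subtype_mk _
  let Y : unitInterval × unitInterval → CadlagPath T := fun z =>
    ⟨fun t => ⟨S z t, (hflow z).mem_left t t.2⟩, fun t => ⟨(hScont z).continuousWithinAt,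
      _, ((hScont z).tendsto t).mono_left nhdsWithin_le_nhds⟩⟩
  have hYS : ∀ z, ∀ t ∈ Icc 0 T, (Y z).toReal t = S z t := fun z t ht =>
    (Y z).toReal_of_mem ht
  have hY : Measurable Y := by
    refine Measurable.subtype_mk (measurable_pi_lambda _ fun t => Measurable.subtype_mk ?_)
    -- The limit flow inherits measurability in the initial point as a pointwise limit of measurable
    -- maps.
    refine measurable_of_tendsto_metrizable' (𝓝[>] (0 : ℝ))
      (f := fun δ z => (X δ z).toReal t) (fun δ => (CadlagPath.measurable_toReal _).comp (hX δ))
      (tendsto_pi_nhds.2 fun z => hS z t t.2)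
  have hXlip : ∀ δ > 0, ∀ z, ∀ s ∈ Icc 0 T, ∀ t ∈ Icc 0 T, s ≤ t →
      |(X δ z).toReal t - (X δ z).toReal s| ≤ C * (t - s) := fun δ hδ z s hs t ht hst =>
    ((hXΦ δ hδ).1 z).2.2.abs_sub_le hC hs ht hst
  have hYlip : ∀ z, ∀ s ∈ Icc 0 T, ∀ t ∈ Icc 0 T, s ≤ t →
      |(Y z).toReal t - (Y z).toReal s| ≤ C * (t - s) := fun z s hs t ht hst => by
    rw [hYS z s hs, hYS z t ht]
    exact (hflow z).abs_sub_le hC hs ht hst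
  have hclose : ∀ z, ∀ η > 0, ∀ᶠ δ in 𝓝[>] (0 : ℝ), ∀ t ∈ Icc 0 T,
      |(X δ z).toReal t - S z t| ≤ η ∧
      |u (frozenTime δ t, (X δ z).toReal t, (Φ δ z).toReal t) - u (t, S z t, Ψ z t)| ≤ η :=
    fun z η hη => h.eventually_flowLine_close (fun δ hδ => ((hXΦ δ hδ).1 z).2.2) (hflow z) (hS z)
      (hΨ z) hη
  have hdist : ∀ z, Tendsto (fun δ => supDist (X δ z) (Y z)) (𝓝[>] 0) (𝓝 0) := by
    intro z
    refine ENNReal.tendsto_nhds_zero.2 fun ε hε => ?_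
    obtain ⟨η, hη, hηε⟩ := exists_pos_ofReal_mul_le 1 hε
    rw [one_mul] at hηε
    filter_upwards [hclose z η hη] with δ hδ
    refine (supDist_le_ofReal fun t ht => ?_).trans hηε
    rw [hYS z t ht]
    exact (hδ t ht).1
  have henergy : ∀ z, Tendsto (fun δ => pathEnergy (X δ z)) (𝓝[>] 0) (𝓝 (pathEnergy (Y z))) := by
    intro z
    refine (ENNReal.tendsto_nhds (ne_top_of_le_ne_top ENNReal.ofReal_ne_top
      (pathEnergy_le (hYlip z)))).2 fun ε hε => ?_
    obtain ⟨η, hη, hηε⟩ := exists_pos_ofReal_mul_le (T * C) hε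
    rw [mul_assoc] at hηε
    filter_upwards [hpos, hclose z η hη] with δ hδ hδη
    have hinc : ∀ s ∈ Icc 0 T, ∀ t ∈ Icc 0 T, s ≤ t →
        |((X δ z).toReal t - (X δ z).toReal s) - ((Y z).toReal t - (Y z).toReal s)|
          ≤ η * (t - s) := by
      intro s hs t ht hst
      have hfl := ((hXΦ δ hδ).1 z).2.2
      rw [hYS z s hs, hYS z t ht]
      exact abs_increment_sub_le hfl.continuous_left (hflow z).continuous_left hfl.deriv_left
        (hflow z).deriv_left (fun r hr => (hδη r (Ico_subset_Icc_self hr)).2) hs ht hst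
    constructor
    · refine tsub_le_iff_right.2 ((pathEnergy_le_add hη.le (hYlip z) (hXlip δ hδ z) ?_).trans
        (by gcongr))
      intro s hs t ht hst
      rw [abs_sub_comm]
      exact hinc s hs t ht hst
    · exact (pathEnergy_le_add hη.le (hXlip δ hδ z) (hYlip z) hinc).trans (by gcongr)
  refine ⟨volume.map Y, ?_, ?_⟩
  · have hr : Tendsto (fun δ => ∫⁻ z, supDist (X δ z) (Y z)) (𝓝[>] 0) (𝓝 0) := by
      have := tendsto_lintegral_filter_of_dominated_convergence
        (μ := (volume : Measure (unitInterval × unitInterval))) (l := 𝓝[>] (0 : ℝ))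
        (F := fun δ z => supDist (X δ z) (Y z)) (f := fun _ => 0) (fun _ => 1) ?_
        (Eventually.of_forall fun δ => ae_of_all _ fun z => supDist_le_one _ _) (by simp)
        (ae_of_all _ hdist)
      · simpa using this
      · refine Eventually.of_forall fun δ => ?_
        have hm := (measurable_supDist hT).comp ((hX δ).prodMk hY)
        exact hm
    -- The gluing estimate is applied in both directions, with the two flows driven by the same
    -- initial point.
    refine tendsto_of_le_add_of_le_add ?_ ?_ hr
    · filter_upwards [hpos] with δ hδ
      rw [(hXΦ δ hδ).2]
      exact wassersteinSup_map_le_add hT π (hX δ) hY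
    · filter_upwards [hpos] with δ hδ
      rw [(hXΦ δ hδ).2]
      simp only [supDist_comm (X δ _)]
      exact wassersteinSup_map_le_add hT π hY (hX δ)
  · have hmE := measurable_pathEnergy hT
    have key := tendsto_lintegral_filter_of_dominated_convergence
      (μ := (volume : Measure (unitInterval × unitInterval))) (l := 𝓝[>] (0 : ℝ))
      (F := fun δ z => pathEnergy (X δ z)) (f := fun z => pathEnergy (Y z))
      (fun _ => ENNReal.ofReal (T * (C * C))) (Eventually.of_forall fun δ => hmE.comp (hX δ))
      (hpos.mono fun δ hδ => ae_of_all _ fun z => pathEnergy_le (hXlip δ hδ z)) (by simp)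
      (ae_of_all _ henergy)
    rw [energy, lintegral_map hmE hY]
    refine key.congr' ?_
    filter_upwards [hpos] with δ hδ
    rw [energy, (hXΦ δ hδ).2, lintegral_map hmE (hX δ)]

end Unique

end PermutonEuler

theorem mainTheorem9 {T : ℝ} (hT : 0 < T) (π : Measure (CadlagPath T))
    (p : ℝ → ℝ → ℝ) (ρ : ℝ → ℝ → ℝ → ℝ)
    (hπ : IsGeneralizedEulerSolution π p) (hρ : IsPhaseDensity π ρ)
    (hreg : RegularityAssumptions T p ρ)
    (W : ℝ → ℝ → ℝ → ℝ → ℝ) (hW : IsBoundarySmoothing T (quantileVelocity ρ) W)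
    (πapp : ℝ → ℝ → Measure (CadlagPath T))
    (happ : ∀ β ∈ Ioo (0 : ℝ) (1 / 4), ∀ δ > 0,
      IsColoredTrajectoryLaw (freezeTime δ (W β)) (πapp β δ)) :
    (∀ U ∈ 𝓝 (0 : ℝ≥0∞), ∀ᶠ β in 𝓝[>] (0 : ℝ), ∀ᶠ δ in 𝓝[>] (0 : ℝ),
      wassersteinSup π (πapp β δ) ∈ U) ∧
    (∀ U ∈ 𝓝 (energy π), ∀ᶠ β in 𝓝[>] (0 : ℝ), ∀ᶠ δ in 𝓝[>] (0 : ℝ),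
      energy (πapp β δ) ∈ U) ∧
    ((∀ β ∈ Ioo (0 : ℝ) (1 / 4), HasUniqueColorSolutions T (W β)) →
      (∃ d : ℝ → ℝ≥0∞,
        (∀ β ∈ Ioo (0 : ℝ) (1 / 4),
          Tendsto (fun δ => wassersteinSup π (πapp β δ)) (𝓝[>] 0) (𝓝 (d β))) ∧
        Tendsto d (𝓝[>] 0) (𝓝 0)) ∧
      (∃ e : ℝ → ℝ≥0∞,
        (∀ β ∈ Ioo (0 : ℝ) (1 / 4),
          Tendsto (fun δ => energy (πapp β δ)) (𝓝[>] 0) (𝓝 (e β))) ∧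
        Tendsto e (𝓝[>] 0) (𝓝 (energy π)))) := by
  obtain ⟨h1, h2⟩ := iterated_limits hT hπ hρ hreg hW happ
  refine ⟨h1, h2, fun huniq => ?_⟩
  have hlim : ∀ β : ℝ, ∃ ν : Measure (CadlagPath T), β ∈ Ioo (0 : ℝ) (1 / 4) →
      Tendsto (fun δ => wassersteinSup π (πapp β δ)) (𝓝[>] 0) (𝓝 (wassersteinSup π ν)) ∧
      Tendsto (fun δ => energy (πapp β δ)) (𝓝[>] 0) (𝓝 (energy ν)) := by
    intro β
    by_cases hβ : β ∈ Ioo (0 : ℝ) (1 / 4)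
    · obtain ⟨ν, hν⟩ := exists_limit_law hT π (hW.smooth β hβ) (huniq β hβ) (happ β hβ)
      exact ⟨ν, fun _ => hν⟩
    · exact ⟨π, fun h => absurd h hβ⟩
  choose ν hν using hlim
  have hq : (0 : ℝ) < 1 / 4 := by norm_num
  exact ⟨⟨fun β => wassersteinSup π (ν β), fun β hβ => (hν β hβ).1,
      tendsto_of_eventually_eventually hq h1 fun β hβ => (hν β hβ).1⟩,
    ⟨fun β => energy (ν β), fun β hβ => (hν β hβ).2,
      tendsto_of_eventually_eventually hq h2 fun β hβ => (hν β hβ).2⟩⟩
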